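/- For every $c>0$ there are constants $a,b>0$, depending only on $c$, such that for every integer $n\ge 2$ there is a compact, connected, smooth ($C^\infty$) surface $\Sigma\subset\mathbb{R}^3$ without boundary, of positive finite area, with the following property. If $x_1,\dots,x_n$ are independent random points, each uniformly distributed on $\Sigma$ (with respect to surface area), then with probability at least $1-n^{-c}$ the Delaunay triangulation of $\{x_1,\dots,x_n\}$ has complexity between $a\,n^2/\log^2 n$ and $b\,n^2/\log^2 n$. In other words, the complexity is $\Theta(n^2/\log^2 n)$ with high probability. Here the complexity of the Delaunay triangulation of a finite set $P\subset\mathbb{R}^3$ is its number of edges, where two distinct points of $P$ are joined by an edge if and only if they lie on a sphere with no points of $P$ in its interior. -/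

import Mathlib

open MeasureTheory
open scoped ContDiff

/-- Euclidean three-space. -/
abbrev E3 : Type := EuclideanSpace ℝ (Fin 3)

/-- `S` is a smooth (`C^∞`) embedded surface without boundary in `ℝ³`: near each of its points
it is the zero set of a smooth real function with nonvanishing derivative. -/
def IsSmoothSurface (S : Set E3) : Prop :=
  ∀ p ∈ S, ∃ (U : Set E3) (f : E3 → ℝ), IsOpen U ∧ p ∈ U ∧ ContDiffOn ℝ ∞ f U ∧
    (∀ x ∈ U, x ∈ S ↔ f x = 0) ∧ ∀ x ∈ U ∩ S, fderiv ℝ f x ≠ 0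

/-- The graph of the Delaunay triangulation of `P ⊆ ℝ³`: two distinct points of `P` are joined
by an edge iff they lie on a sphere with no points of `P` in its interior. -/
def delaunayGraph (P : Set E3) : SimpleGraph E3 where
  Adj p q := p ≠ q ∧ p ∈ P ∧ q ∈ P ∧
    ∃ (z : E3) (r : ℝ), p ∈ Metric.sphere z r ∧ q ∈ Metric.sphere z r ∧
      ∀ s ∈ P, s ∉ Metric.ball z r
  symm := ⟨fun _ _ h => ⟨h.1.symm, h.2.2.1, h.2.1,
    let ⟨z, r, hp, hq, he⟩ := h.2.2.2; ⟨z, r, hq, hp, he⟩⟩⟩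
  loopless := ⟨fun _ h => h.1 rfl⟩

/-- The Delaunay graph of a finite point set has finitely many edges, so that counting them with
`Set.ncard` is meaningful. -/
theorem delaunayGraph_edgeSet_finite {P : Set E3} (hP : P.Finite) :
    (delaunayGraph P).edgeSet.Finite := by
  refine ((hP.prod hP).image (fun x : E3 × E3 => s(x.1, x.2))).subset ?_
  intro e
  induction e using Sym2.ind with
  | _ p q =>
    intro h
    have h' : (delaunayGraph P).Adj p q := h
    exact ⟨(p, q), ⟨h'.2.1, h'.2.2.1⟩, rfl⟩

/-- The complexity of the Delaunay triangulation of a finite set `P`: its number of edges. -/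
noncomputable def delaunayComplexity (P : Set E3) : ℕ := (delaunayGraph P).edgeSet.ncard

/-- Surface area in `ℝ³`, as two-dimensional Hausdorff measure (its normalization plays no role
for uniform distributions). -/
noncomputable def surfaceArea : Measure E3 := Measure.hausdorffMeasure 2

/-- The uniform distribution on a surface `S` of positive finite area: the surface area measure
on `S`, divided by the area of `S`. -/
noncomputable def uniformOnSurface (S : Set E3) : Measure E3 :=
  (surfaceArea S)⁻¹ • surfaceArea.restrict S

/-! The surface depends on `n`: a tiny ellipsoid of revolution (the body) carries most of the area,
and a thin tail of length 3 follows a slightly bent axis. With `L = log n` and thickness `ε = ρ ^ 2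
/ L`, the tail and its middle part each have a share of the area of order `1 / L`, so they receive
about `n / log n` sample points.

Lower bound: for `x ≥ 1` the axis is `(x, η x³, η x⁴)`. Restricted to it, the equation of a sphere
is, up to terms of order `η²`, a combination of `1, x, x², x³, x⁴`, and it can be made equal to `(x
- a)² (x - b)²`. This is nonnegative and vanishes exactly at `a` and `b`, so any two points of the
middle part lie on an empty sphere (`TubeParams.adj_of_middle`). The errors caused by `η²` and by
the thickness of the tube are harmless because distinct tail points have abscissas at least `g`
apart and `η`, `ρ` are chosen after `g`. This gives order `(n / log n)²` edges.

Upper bound: cut the body into `K = 2H` slabs, with `K` of order `log² n`, and each slab into `4 K²`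
sectors; with high probability every cell away from the poles is hit. On this elongated ellipsoid
`x² + y² + z²` is a strictly convex quadratic function of the abscissa. Hence a sphere through two
body points contains every cell between them that faces its centre, and only nearby slabs are joined
(`TubeParams.slab_le_of_adj`): about `K (n / K)² = n² / K` edges.

If a sphere passes through a body point and a tail point and leaves an earlier tail point outside,
then its centre must be very far off the axis. Near the body the sphere then looks like a plane
almost parallel to the axis, and it contains sample points at the equator unless the body point
itself lies in a belt of relative width `1 / L` (`TubeParams.mem_belt_of_adj`). Apart from the first
tail point, tail-body edges therefore number at most (belt) × (tail), of order `(n / L)²`. Tail-tail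
edges have the same order, and the joint between body and tail contains only about `n / K` points,
hence contributes about `n² / K` edges.

All counts are controlled by Chernoff bounds (`TubeParams.measure_not_typical_le`). The finitely
many small `n` are absorbed into the constants. -/

section Sampling

/-! ### Chernoff bounds and null events for independent samples -/

variable {E : Type*}

open Classical in
/-- The number of sample points lying in `R`. -/
noncomputable def hits {n : ℕ} (R : Set E) (x : Fin n → E) : ℕ :=
  (Finset.univ.filter (fun i => x i ∈ R)).card

open Classical in
theorem prod_ite_mem_eq_pow_hits {n : ℕ} (R : Set E) (x : Fin n → E) (t : ℝ) :
    ∏ i, (if x i ∈ R then t else 1) = t ^ hits R x := by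
  rw [Finset.prod_ite]
  simp [hits]

variable [MeasurableSpace E]

-- Markov's inequality for the product of the factors `t` or `1`, whose integral factorizes by
-- independence. Both tails of the binomial count follow, with `t = 2` and `t = 1 / 2`.
open Classical in
theorem measure_le_pow_hits_le (μ : Measure E) [IsProbabilityMeasure μ] {n : ℕ} {R : Set E}
    (hR : MeasurableSet R) {t s : ℝ} (ht : 0 ≤ t) (hs : 0 < s) :
    (Measure.pi (fun _ : Fin n => μ)).real {x | s ≤ t ^ hits R x} ≤
      (1 + (t - 1) * μ.real R) ^ n / s := by
  have hm : Measurable (fun y : E => if y ∈ R then t else (1 : ℝ)) :=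
    Measurable.ite hR measurable_const measurable_const
  have hint : Integrable (fun y : E => if y ∈ R then t else (1 : ℝ)) μ := by
    refine Integrable.of_bound hm.aestronglyMeasurable (max t 1) (Filter.Eventually.of_forall ?_)
    intro y
    split_ifs
    · rw [Real.norm_of_nonneg ht]; exact le_max_left _ _
    · simp
  have hval : ∫ y, (if y ∈ R then t else (1 : ℝ)) ∂μ = 1 + (t - 1) * μ.real R := by
    have : (fun y : E => if y ∈ R then t else (1 : ℝ)) =
        fun y => 1 + R.indicator (fun _ => t - 1) y := by
      funext y
      by_cases h : y ∈ R <;> simp [h]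
    rw [this, integral_add (integrable_const _) ((integrable_const _).indicator hR),
      integral_indicator_const _ hR]
    simp [mul_comm]
  have h1 := mul_meas_ge_le_integral_of_nonneg (μ := Measure.pi (fun _ : Fin n => μ))
    (f := fun x : Fin n → E => ∏ i, (if x i ∈ R then t else (1 : ℝ)))
    (Filter.Eventually.of_forall fun x => Finset.prod_nonneg fun i _ => by
      split_ifs <;> simp [ht]) (Integrable.fintype_prod (fun _ => hint)) s
  rw [integral_fintype_prod_eq_prod (fun _ : Fin n => fun y : E => if y ∈ R then t else (1 : ℝ)),
    hval] at h1
  simp only [Finset.prod_const, Finset.card_univ, Fintype.card_fin,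
    prod_ite_mem_eq_pow_hits] at h1
  rw [le_div_iff₀ hs, mul_comm]
  exact h1

/-- With `t = 2` the numerator is at most `exp (b / 4)` because `1 + p ≤ exp p`, while `2 ^ b ≥ exp
(b / 2)` because `log 2 > 1 / 2`. -/
theorem measure_le_hits_le (μ : Measure E) [IsProbabilityMeasure μ] {n : ℕ} {R : Set E}
    (hR : MeasurableSet R) {b : ℝ} (hb : n * μ.real R ≤ b / 4) :
    (Measure.pi (fun _ : Fin n => μ)).real {x | b ≤ hits R x} ≤ Real.exp (-(b / 4)) := by
  have h1 := measure_le_pow_hits_le μ (n := n) hR (t := 2) (s := (2 : ℝ) ^ b) (by norm_num)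
    (by positivity)
  have h2 : {x : Fin n → E | b ≤ hits R x} ⊆ {x | (2 : ℝ) ^ b ≤ 2 ^ hits R x} := by
    intro x hx
    simp only [Set.mem_ofPred_eq] at hx ⊢
    rw [← Real.rpow_natCast]
    exact Real.rpow_le_rpow_of_exponent_le (by norm_num) hx
  refine (measureReal_mono h2).trans (h1.trans ?_)
  have hp : 0 ≤ μ.real R := measureReal_nonneg
  have hb0 : 0 ≤ b := by
    have : 0 ≤ n * μ.real R := by positivity
    linarith
  have h3 : (1 + (2 - 1) * μ.real R) ^ n ≤ Real.exp (b / 4) := by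
    calc (1 + (2 - 1) * μ.real R) ^ n ≤ (Real.exp (μ.real R)) ^ n := by
          gcongr
          linarith [Real.add_one_le_exp (μ.real R)]
      _ = Real.exp (n * μ.real R) := by rw [← Real.exp_nat_mul]
      _ ≤ _ := Real.exp_le_exp.2 hb
  have h4 : Real.exp (b / 2) ≤ (2 : ℝ) ^ b := by
    rw [Real.rpow_def_of_pos (by norm_num)]
    apply Real.exp_le_exp.2
    nlinarith [Real.log_two_gt_d9]
  rw [div_le_iff₀ (by positivity)]
  calc _ ≤ Real.exp (b / 4) := h3
    _ = Real.exp (-(b / 4)) * Real.exp (b / 2) := by rw [← Real.exp_add]; ring_nf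
    _ ≤ _ := by gcongr

/-- With `t = 1 / 2` the numerator is at most `exp (-(2 * b))`, and the denominator is at least `exp
(-b)` because `log 2 < 1`. -/
theorem measure_hits_le_le (μ : Measure E) [IsProbabilityMeasure μ] {n : ℕ} {R : Set E}
    (hR : MeasurableSet R) {b : ℝ} (hb0 : 0 ≤ b) (hb : 4 * b ≤ n * μ.real R) :
    (Measure.pi (fun _ : Fin n => μ)).real {x | (hits R x : ℝ) ≤ b} ≤ Real.exp (-b) := by
  have h1 := measure_le_pow_hits_le μ (n := n) hR (t := 1 / 2) (s := (1 / 2 : ℝ) ^ b)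
    (by norm_num) (by positivity)
  have h2 : {x : Fin n → E | (hits R x : ℝ) ≤ b} ⊆ {x | (1 / 2 : ℝ) ^ b ≤ (1 / 2) ^ hits R x} := by
    intro x hx
    simp only [Set.mem_ofPred_eq] at hx ⊢
    rw [← Real.rpow_natCast]
    exact Real.rpow_le_rpow_of_exponent_ge (by norm_num) (by norm_num) hx
  refine (measureReal_mono h2).trans (h1.trans ?_)
  have hp1 : μ.real R ≤ 1 := measureReal_le_one
  have h3 : (1 + (1 / 2 - 1) * μ.real R) ^ n ≤ Real.exp (-(2 * b)) := by
    calc (1 + (1 / 2 - 1) * μ.real R) ^ n ≤ (Real.exp (-(1 / 2) * μ.real R)) ^ n := by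
          gcongr
          · linarith
          · linarith [Real.add_one_le_exp (-(1 / 2) * μ.real R)]
      _ = Real.exp (n * (-(1 / 2) * μ.real R)) := by rw [← Real.exp_nat_mul]
      _ ≤ _ := Real.exp_le_exp.2 (by linarith)
  have h4 : Real.exp (-b) ≤ (1 / 2 : ℝ) ^ b := by
    rw [Real.rpow_def_of_pos (by norm_num)]
    apply Real.exp_le_exp.2
    rw [one_div, Real.log_inv]
    nlinarith [Real.log_two_lt_d9]
  rw [div_le_iff₀ (by positivity)]
  calc _ ≤ Real.exp (-(2 * b)) := h3
    _ = Real.exp (-b) * Real.exp (-b) := by rw [← Real.exp_add]; ring_nf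
    _ ≤ _ := by gcongr

theorem measure_two_mem_eq (μ : Measure E) [IsProbabilityMeasure μ] {n : ℕ} (R : Set E)
    {i j : Fin n} (hij : i ≠ j) :
    (Measure.pi (fun _ : Fin n => μ)).real {x | x i ∈ R ∧ x j ∈ R} = μ.real R ^ 2 := by
  have : {x : Fin n → E | x i ∈ R ∧ x j ∈ R} =
      Set.univ.pi (fun k => if k = i ∨ k = j then R else Set.univ) := by
    ext x
    simp only [Set.mem_ofPred_eq, Set.mem_pi, Set.mem_univ, true_imp_iff]
    constructor
    · rintro ⟨h1, h2⟩ k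
      split_ifs with h
      · rcases h with rfl | rfl <;> assumption
      · trivial
    · intro h
      exact ⟨by simpa using h i, by simpa using h j⟩
  rw [this, measureReal_def, Measure.pi_pi, ENNReal.toReal_prod]
  have h2 : ∀ k : Fin n, (μ (if k = i ∨ k = j then R else Set.univ)).toReal =
      (if k ∈ ({i, j} : Finset (Fin n)) then μ.real R else 1) := by
    intro k
    simp only [Finset.mem_insert, Finset.mem_singleton]
    split_ifs <;> simp [measureReal_def]
  rw [Finset.prod_congr rfl fun k _ => h2 k, Finset.prod_ite_mem, Finset.univ_inter,
    Finset.prod_const, Finset.card_pair hij]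

theorem measure_exists_notMem_eq_zero (μ : Measure E) [IsProbabilityMeasure μ] {n : ℕ} {R : Set E}
    (hR : μ Rᶜ = 0) : (Measure.pi (fun _ : Fin n => μ)) {x | ∃ i, x i ∉ R} = 0 := by
  rw [Set.ofPred_exists]
  refine measure_iUnion_null fun i => ?_
  have h := (measurePreserving_eval (fun _ : Fin n => μ) i).quasiMeasurePreserving
  exact h.preimage_null hR

/-- Two coordinates are independent, so the diagonal is null by Fubini: its slices are singletons.
This serves only the small values of `n`. -/
theorem measure_eval_eq_eval_eq_zero (μ : Measure E) [IsProbabilityMeasure μ] [NullSingletonClass μ]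
    [MeasurableEq E] {n : ℕ} {i j : Fin n}
    (hij : i ≠ j) : (Measure.pi (fun _ : Fin n => μ)) {x | x i = x j} = 0 := by
  have hind := (ProbabilityTheory.iIndepFun_pi (μ := fun _ : Fin n => μ)
    (X := fun _ => id) (fun _ => aemeasurable_id)).indepFun hij
  have hi : Measure.map (fun x : Fin n → E => x i) (Measure.pi (fun _ : Fin n => μ)) = μ :=
    (measurePreserving_eval (fun _ : Fin n => μ) i).map_eq
  have hj : Measure.map (fun x : Fin n → E => x j) (Measure.pi (fun _ : Fin n => μ)) = μ :=
    (measurePreserving_eval (fun _ : Fin n => μ) j).map_eq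
  have hmap := (ProbabilityTheory.indepFun_iff_map_prod_eq_prod_map_map
    (measurable_pi_apply i).aemeasurable (measurable_pi_apply j).aemeasurable).1 hind
  have hdiag : MeasurableSet (Set.diagonal E) := measurableSet_diagonal
  have : {x : Fin n → E | x i = x j} = (fun x : Fin n → E => (x i, x j)) ⁻¹' Set.diagonal E := by
    ext x; simp
  rw [this, ← Measure.map_apply ((measurable_pi_apply i).prodMk (measurable_pi_apply j)) hdiag]
  rw [hmap, hi, hj,
    Measure.measure_prod_null hdiag]
  refine Filter.Eventually.of_forall fun y => ?_
  have : Prod.mk y ⁻¹' Set.diagonal E = {y} := by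
    ext z; simp [eq_comm]
  change μ (Prod.mk y ⁻¹' Set.diagonal E) = 0
  rw [this]; exact measure_singleton y

end Sampling

/-! ### Hausdorff area of pieces of tubes, from above and from below -/

section Area

/-- The point of `ℝ³` with the given coordinates. -/
def pt (x y z : ℝ) : E3 := !₂[x, y, z]

@[simp] theorem pt_zero (x y z : ℝ) : pt x y z 0 = x := rfl
@[simp] theorem pt_one (x y z : ℝ) : pt x y z 1 = y := rfl
@[simp] theorem pt_two (x y z : ℝ) : pt x y z 2 = z := rfl

theorem pt_eta (X : E3) : pt (X 0) (X 1) (X 2) = X := by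
  ext i; fin_cases i <;> rfl

theorem sq_dist_E3 (X Y : E3) :
    dist X Y ^ 2 = (X 0 - Y 0) ^ 2 + (X 1 - Y 1) ^ 2 + (X 2 - Y 2) ^ 2 := by
  rw [EuclideanSpace.dist_eq, Real.sq_sqrt (Finset.sum_nonneg fun _ _ => sq_nonneg _)]
  simp [Fin.sum_univ_three, Real.dist_eq, sq_abs]

theorem dist_E3_le (X Y : E3) :
    dist X Y ≤ |X 0 - Y 0| + |X 1 - Y 1| + |X 2 - Y 2| := by
  refine abs_le_of_sq_le_sq' ?_ (by positivity) |>.2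
  rw [sq_dist_E3, ← sq_abs (X 0 - Y 0), ← sq_abs (X 1 - Y 1), ← sq_abs (X 2 - Y 2)]
  have h0 := abs_nonneg (X 0 - Y 0)
  have h1 := abs_nonneg (X 1 - Y 1)
  have h2 := abs_nonneg (X 2 - Y 2)
  nlinarith [mul_nonneg h0 h1, mul_nonneg h0 h2, mul_nonneg h1 h2]

theorem abs_sub_le_dist_E3 (X Y : E3) (i : Fin 3) : |X i - Y i| ≤ dist X Y := by
  refine abs_le_of_sq_le_sq (a := X i - Y i) ?_ dist_nonneg
  rw [sq_dist_E3]
  fin_cases i <;> simp <;> nlinarith [sq_nonneg (X 0 - Y 0), sq_nonneg (X 1 - Y 1), sq_nonneg (X 2 - Y 2)]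

theorem exists_mem_Ico_cos_sin (θ : ℝ) :
    ∃ t ∈ Set.Ico 0 (2 * Real.pi), Real.cos t = Real.cos θ ∧ Real.sin t = Real.sin θ := by
  refine ⟨θ - ⌊θ / (2 * Real.pi)⌋ * (2 * Real.pi), ⟨?_, ?_⟩, Real.cos_sub_int_mul_two_pi _ _,
    Real.sin_sub_int_mul_two_pi _ _⟩
  · have := Int.floor_le (θ / (2 * Real.pi))
    rw [le_div_iff₀ (by positivity)] at this
    linarith
  · have := Int.lt_floor_add_one (θ / (2 * Real.pi))
    rw [div_lt_iff₀ (by positivity)] at this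
    linarith

/-- Upper bound for the area of a piece of a tube with axis `x ↦ (x, φ₁ x, φ₂ x)`. -/
theorem surfaceArea_tube_le {φ₁ φ₂ f R : ℝ → ℝ} {a b l M : ℝ} (hab : a ≤ b) (hl : 0 < l)
    (hM : 0 < M)
    (hf : ∀ y ∈ Set.Icc a b, ∀ z ∈ Set.Icc a b, |f y - f z| ≤ l * |y - z|)
    (hR : ∀ y ∈ Set.Icc a b, ∀ z ∈ Set.Icc a b, |R y - R z| ≤ l * |y - z|)
    (hRM : ∀ y ∈ Set.Icc a b, |R y| ≤ M)
    (hφ₁ : ∀ y ∈ Set.Icc a b, ∀ z ∈ Set.Icc a b, |φ₁ (f y) - φ₁ (f z)| ≤ |f y - f z|)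
    (hφ₂ : ∀ y ∈ Set.Icc a b, ∀ z ∈ Set.Icc a b, |φ₂ (f y) - φ₂ (f z)| ≤ |f y - f z|) :
    surfaceArea {X : E3 | ∃ y ∈ Set.Icc a b, ∃ θ : ℝ,
      X = pt (f y) (φ₁ (f y) + R y * Real.cos θ) (φ₂ (f y) + R y * Real.sin θ)} ≤
      ENNReal.ofReal (400 * (l * (b - a) * M)) := by
  -- Both parameters are rescaled, by `l` and by `M`, so that the Lipschitz constant of the chart
  -- depends neither on the size nor on the thickness of the tube.
  set g : (Fin 2 → ℝ) → E3 := fun p =>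
    pt (f (a + p 0 / l)) (φ₁ (f (a + p 0 / l)) + R (a + p 0 / l) * Real.cos (p 1 / M))
      (φ₂ (f (a + p 0 / l)) + R (a + p 0 / l) * Real.sin (p 1 / M)) with hg
  set Q : Set (Fin 2 → ℝ) := Set.Icc ![0, 0] ![l * (b - a), 2 * Real.pi * M] with hQ
  have hsub : {X : E3 | ∃ y ∈ Set.Icc a b, ∃ θ : ℝ,
      X = pt (f y) (φ₁ (f y) + R y * Real.cos θ) (φ₂ (f y) + R y * Real.sin θ)} ⊆ g '' Q := by
    rintro X ⟨y, hy, θ, rfl⟩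
    obtain ⟨t, ht, hc, hs⟩ := exists_mem_Ico_cos_sin θ
    refine ⟨![l * (y - a), t * M], ?_, ?_⟩
    · rw [hQ, Set.mem_Icc, Pi.le_def, Pi.le_def]
      simp only [Fin.forall_fin_two, Matrix.cons_val_zero, Matrix.cons_val_one]
      refine ⟨⟨mul_nonneg hl.le (by linarith [hy.1]), mul_nonneg ht.1 hM.le⟩, ?_, ?_⟩
      · have := hy.2; gcongr
      · have := ht.2; gcongr
    · have h1 : a + l * (y - a) / l = y := by field_simp; ring
      have h2 : t * M / M = t := by field_simp
      simp only [hg, Matrix.cons_val_zero, Matrix.cons_val_one, h1, h2, hc, hs]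
  have hmem : ∀ p ∈ Q, a + p 0 / l ∈ Set.Icc a b := by
    intro p hp
    rw [hQ, Set.mem_Icc, Pi.le_def, Pi.le_def] at hp
    simp only [Fin.forall_fin_two, Matrix.cons_val_zero, Matrix.cons_val_one] at hp
    have h1 : 0 ≤ p 0 / l := div_nonneg hp.1.1 hl.le
    have h2 : p 0 / l ≤ b - a := by
      rw [div_le_iff₀ hl]; linarith [hp.2.1]
    exact ⟨by linarith, by linarith⟩
  -- The constant is `1 + 3 + 3`: one for the abscissa, three for each lateral coordinate (variation
  -- of the radius, of the angle and of the axis). Areas then grow by at most `49`, and `49 * 2 * π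
  -- < 400`.
  have hlip : LipschitzOnWith 7 g Q := by
    refine LipschitzOnWith.of_dist_le_mul fun p hp q hq => ?_
    have hy := hmem p hp
    have hz := hmem q hq
    set y := a + p 0 / l with hydef
    set z := a + q 0 / l with hzdef
    have hd0 : |p 0 - q 0| ≤ dist p q := by
      simpa [Real.dist_eq] using dist_le_pi_dist p q 0
    have hd1 : |p 1 - q 1| ≤ dist p q := by
      simpa [Real.dist_eq] using dist_le_pi_dist p q 1
    have hyz : l * |y - z| = |p 0 - q 0| := by
      rw [hydef, hzdef, show a + p 0 / l - (a + q 0 / l) = (p 0 - q 0) / l by ring, abs_div,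
        abs_of_pos hl]
      field_simp
    have e0 : |f y - f z| ≤ dist p q := (hf y hy z hz).trans (hyz.le.trans hd0)
    have eR : |R y - R z| ≤ dist p q := (hR y hy z hz).trans (hyz.le.trans hd0)
    have e1 := (hφ₁ y hy z hz).trans e0
    have e2 := (hφ₂ y hy z hz).trans e0
    have trig : ∀ u v c d : ℝ, |u| ≤ 1 → |R z| * |u - v| ≤ dist p q → c = R y * u - R z * v + d →
        |d| ≤ dist p q → |c| ≤ 3 * dist p q := by
      intro u v c d hu huv hc hd
      have : c = (R y - R z) * u + R z * (u - v) + d := by rw [hc]; ring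
      rw [this]
      calc _ ≤ |(R y - R z) * u| + |R z * (u - v)| + |d| := abs_add_three _ _ _
        _ ≤ dist p q * 1 + dist p q + dist p q := by
          rw [abs_mul, abs_mul]
          gcongr
        _ = _ := by ring
    have hang : |p 1 / M - q 1 / M| * |R z| ≤ dist p q := by
      rw [← sub_div, abs_div, abs_of_pos hM]
      calc _ ≤ |p 1 - q 1| / M * M := by gcongr; exact hRM z hz
        _ = |p 1 - q 1| := by field_simp
        _ ≤ _ := hd1
    have hcos : |R z| * |Real.cos (p 1 / M) - Real.cos (q 1 / M)| ≤ dist p q := by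
      refine le_trans ?_ hang
      rw [mul_comm]
      refine mul_le_mul_of_nonneg_right ?_ (abs_nonneg _)
      have := Real.lipschitzWith_cos.dist_le_mul (p 1 / M) (q 1 / M)
      simpa [Real.dist_eq] using this
    have hsin : |R z| * |Real.sin (p 1 / M) - Real.sin (q 1 / M)| ≤ dist p q := by
      refine le_trans ?_ hang
      rw [mul_comm]
      refine mul_le_mul_of_nonneg_right ?_ (abs_nonneg _)
      have := Real.lipschitzWith_sin.dist_le_mul (p 1 / M) (q 1 / M)
      simpa [Real.dist_eq] using this
    have c1 := trig _ _ ((g p) 1 - (g q) 1) _ (Real.abs_cos_le_one (p 1 / M)) hcos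
      (by simp only [hg, pt_one]; ring) e1
    have c2 := trig _ _ ((g p) 2 - (g q) 2) _ (Real.abs_sin_le_one (p 1 / M)) hsin
      (by simp only [hg, pt_two]; ring) e2
    have c0 : |(g p) 0 - (g q) 0| ≤ dist p q := e0
    refine (dist_E3_le _ _).trans ?_
    simp only [NNReal.coe_ofNat]
    linarith
  have hvol : (Measure.hausdorffMeasure 2 : Measure (Fin 2 → ℝ)) Q =
      ENNReal.ofReal (l * (b - a) * (2 * Real.pi * M)) := by
    have h := hausdorffMeasure_pi_real (ι := Fin 2)
    simp only [Fintype.card_fin, Nat.cast_ofNat] at h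
    rw [h, hQ, Real.volume_Icc_pi, Fin.prod_univ_two]
    simp only [Matrix.cons_val_zero, Matrix.cons_val_one, sub_zero]
    rw [← ENNReal.ofReal_mul (mul_nonneg hl.le (by linarith))]
  calc surfaceArea _ ≤ surfaceArea (g '' Q) := measure_mono hsub
    _ ≤ ((7 : NNReal) : ENNReal) ^ (2 : ℝ) * (Measure.hausdorffMeasure 2 : Measure (Fin 2 → ℝ)) Q :=
      hlip.hausdorffMeasure_image_le (by norm_num)
    _ = ENNReal.ofReal (49 * (l * (b - a) * (2 * Real.pi * M))) := by
      rw [hvol, ENNReal.ofReal_mul (p := 49) (by norm_num)]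
      congr 1
      norm_num
    _ ≤ _ := by
      apply ENNReal.ofReal_le_ofReal
      have : 0 ≤ l * (b - a) * M := mul_nonneg (mul_nonneg hl.le (by linarith)) hM.le
      nlinarith [Real.pi_lt_d2]

/-- Lower bound for the area of a set whose projection, sheared along the axis
`x ↦ (x, φ₁ x, φ₂ x)`, covers a rectangle. -/
theorem le_surfaceArea_of_rectangle {φ₁ φ₂ : ℝ → ℝ} {P : Set E3} {a b m e₁ e₂ : ℝ} (hab : a ≤ b)
    (he₁ : |e₁| ≤ 1) (he₂ : |e₂| ≤ 1)
    (hφ₁ : ∀ X ∈ P, ∀ Y ∈ P, |φ₁ (X 0) - φ₁ (Y 0)| ≤ |X 0 - Y 0|)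
    (hφ₂ : ∀ X ∈ P, ∀ Y ∈ P, |φ₂ (X 0) - φ₂ (Y 0)| ≤ |X 0 - Y 0|)
    (hP : ∀ x ∈ Set.Icc a b, ∀ y ∈ Set.Icc 0 m, ∃ X ∈ P, X 0 = x ∧
      e₁ * (X 1 - φ₁ (X 0)) + e₂ * (X 2 - φ₂ (X 0)) = y) :
    ENNReal.ofReal ((b - a) * m / 16) ≤ surfaceArea P := by
  set g : E3 → (Fin 2 → ℝ) := fun X =>
    ![X 0, e₁ * (X 1 - φ₁ (X 0)) + e₂ * (X 2 - φ₂ (X 0))] with hg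
  set Q : Set (Fin 2 → ℝ) := Set.Icc ![a, 0] ![b, m] with hQ
  -- Each of the two sheared lateral coordinates is 2-Lipschitz, since the axis is 1-Lipschitz.
  -- Areas shrink by at most `4 ^ 2 = 16`.
  have hlip : LipschitzOnWith 4 g P := by
    refine LipschitzOnWith.of_dist_le_mul fun X hX Y hY => ?_
    have d0 := abs_sub_le_dist_E3 X Y 0
    have d1 := abs_sub_le_dist_E3 X Y 1
    have d2 := abs_sub_le_dist_E3 X Y 2
    have f1 := hφ₁ X hX Y hY
    have f2 := hφ₂ X hX Y hY
    rw [dist_pi_le_iff (by positivity)]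
    simp only [Fin.forall_fin_two, hg, Matrix.cons_val_zero, Matrix.cons_val_one, Real.dist_eq,
      NNReal.coe_ofNat]
    refine ⟨by linarith [abs_nonneg (X 0 - Y 0)], ?_⟩
    have key : ∀ e u v : ℝ, |e| ≤ 1 → |u| ≤ dist X Y → |v| ≤ dist X Y →
        |e * (u - v)| ≤ 2 * dist X Y := by
      intro e u v he hu hv
      rw [abs_mul]
      calc _ ≤ 1 * (|u| + |v|) := by gcongr; exact abs_sub _ _
        _ ≤ _ := by linarith
    have k1 := key e₁ (X 1 - Y 1) (φ₁ (X 0) - φ₁ (Y 0)) he₁ d1 (f1.trans d0)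
    have k2 := key e₂ (X 2 - Y 2) (φ₂ (X 0) - φ₂ (Y 0)) he₂ d2 (f2.trans d0)
    calc _ = |e₁ * (X 1 - Y 1 - (φ₁ (X 0) - φ₁ (Y 0))) + e₂ * (X 2 - Y 2 - (φ₂ (X 0) - φ₂ (Y 0)))| := by
          congr 1; ring
      _ ≤ _ := abs_add_le _ _
      _ ≤ _ := by linarith
  have hsub : Q ⊆ g '' P := by
    intro q hq
    rw [hQ, Set.mem_Icc, Pi.le_def, Pi.le_def] at hq
    simp only [Fin.forall_fin_two, Matrix.cons_val_zero, Matrix.cons_val_one] at hq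
    obtain ⟨X, hX, h0, h1⟩ := hP (q 0) ⟨hq.1.1, hq.2.1⟩ (q 1) ⟨hq.1.2, hq.2.2⟩
    refine ⟨X, hX, ?_⟩
    ext i
    fin_cases i
    · exact h0
    · exact h1
  have hvol : (Measure.hausdorffMeasure 2 : Measure (Fin 2 → ℝ)) Q =
      ENNReal.ofReal ((b - a) * m) := by
    have h := hausdorffMeasure_pi_real (ι := Fin 2)
    simp only [Fintype.card_fin, Nat.cast_ofNat] at h
    rw [h, hQ, Real.volume_Icc_pi, Fin.prod_univ_two]
    simp only [Matrix.cons_val_zero, Matrix.cons_val_one, sub_zero]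
    rw [← ENNReal.ofReal_mul (by linarith)]
  have h16 : ENNReal.ofReal ((b - a) * m) ≤ 16 * surfaceArea P := by
    calc _ = (Measure.hausdorffMeasure 2 : Measure (Fin 2 → ℝ)) Q := hvol.symm
      _ ≤ (Measure.hausdorffMeasure 2 : Measure (Fin 2 → ℝ)) (g '' P) := measure_mono hsub
      _ ≤ ((4 : NNReal) : ENNReal) ^ (2 : ℝ) * surfaceArea P :=
        hlip.hausdorffMeasure_image_le (by norm_num)
      _ = _ := by
        congr 1
        norm_num
  rw [ENNReal.ofReal_div_of_pos (by norm_num)]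
  apply ENNReal.div_le_of_le_mul
  rw [mul_comm (surfaceArea P)]
  simpa only [ENNReal.ofReal_ofNat] using h16

end Area

/-! ### The body with its bent tail: parametrization, topology and smoothness -/

section Surface

theorem exists_lipschitz_bound_of_contDiff {f : ℝ → ℝ} (hf : ContDiff ℝ 1 f) (a b : ℝ) :
    ∃ C : ℝ, 1 ≤ C ∧ ∀ x ∈ Set.Icc a b, ∀ y ∈ Set.Icc a b, |f x - f y| ≤ C * |x - y| := by
  obtain ⟨K, hK⟩ := (hf.locallyLipschitz.locallyLipschitzOn
    (s := Set.Icc a b)).exists_lipschitzOnWith_of_compact isCompact_Icc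
  refine ⟨max K 1, le_max_right _ _, fun x hx y hy => ?_⟩
  have := hK.dist_le_mul x hx y hy
  rw [Real.dist_eq, Real.dist_eq] at this
  refine this.trans ?_
  gcongr
  exact le_max_left _ _

/-- The first function is the profile of the transition, the other two are the unscaled coordinates
of the axis. One constant for all three lets `η * lipConst ≤ 1` make the axis 1-Lipschitz and also
bounds the area of the transition. -/
theorem exists_lipschitz_const : ∃ C : ℝ, 1 ≤ C ∧ ∀ x ∈ Set.Icc (-5 : ℝ) 5,
    ∀ y ∈ Set.Icc (-5 : ℝ) 5,
      |Real.smoothTransition x - Real.smoothTransition y| ≤ C * |x - y| ∧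
      |Real.smoothTransition x * x ^ 3 - Real.smoothTransition y * y ^ 3| ≤ C * |x - y| ∧
      |Real.smoothTransition x * x ^ 4 - Real.smoothTransition y * y ^ 4| ≤ C * |x - y| := by
  have hst : ContDiff ℝ 1 Real.smoothTransition := Real.smoothTransition.contDiff
  obtain ⟨C₁, h1, H1⟩ := exists_lipschitz_bound_of_contDiff hst (-5) 5
  obtain ⟨C₂, h2, H2⟩ := exists_lipschitz_bound_of_contDiff
    (f := fun x => Real.smoothTransition x * x ^ 3) (hst.mul (contDiff_id.pow 3)) (-5) 5
  obtain ⟨C₃, h3, H3⟩ := exists_lipschitz_bound_of_contDiff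
    (f := fun x => Real.smoothTransition x * x ^ 4) (hst.mul (contDiff_id.pow 4)) (-5) 5
  refine ⟨C₁ + C₂ + C₃, by linarith, fun x hx y hy => ⟨?_, ?_, ?_⟩⟩
  · refine (H1 x hx y hy).trans ?_
    gcongr; linarith
  · refine (H2 x hx y hy).trans ?_
    gcongr; linarith
  · refine (H3 x hx y hy).trans ?_
    gcongr; linarith

/-- A common Lipschitz constant, on `[-5, 5]`, of the three functions of
`exists_lipschitz_const`. -/
noncomputable def lipConst : ℝ := exists_lipschitz_const.choose

theorem one_le_lipConst : 1 ≤ lipConst := exists_lipschitz_const.choose_spec.1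

/-- Parameters of the surface: size `ρ` of the body, thickness `ε` of the tail, relative size `w`
of the transition between body and tail, size `η` of the bending of the tail. -/
structure TubeParams where
  ρ : ℝ
  ε : ℝ
  w : ℝ
  η : ℝ
  ρ_pos : 0 < ρ
  ρ_le : ρ ≤ 1 / 2
  ε_pos : 0 < ε
  ε_le : ε ≤ ρ * w
  w_pos : 0 < w
  w_le : w ≤ 1 / 8
  η_pos : 0 < η
  η_le : η * lipConst ≤ 1

namespace TubeParams

variable (p : TubeParams)

/-- First coordinate of the bent axis. -/
noncomputable def axis₁ (x : ℝ) : ℝ := p.η * (Real.smoothTransition x * x ^ 3)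

/-- Second coordinate of the bent axis. -/
noncomputable def axis₂ (x : ℝ) : ℝ := p.η * (Real.smoothTransition x * x ^ 4)

/-- The transition function between body and tail. -/
noncomputable def cut (x : ℝ) : ℝ := Real.smoothTransition (2 + x / (p.ρ * p.w))

/-- The radius of the tube around its axis: an ellipsoid of revolution on the left, a thin
paraboloid of revolution on the right. -/
noncomputable def radius (x : ℝ) : ℝ :=
  (1 - p.cut x) * (√(-x * (x + 2 * p.ρ)) / 2) + p.cut x * (p.ε * √(3 - x))

/-- The surface: a small ellipsoid of revolution with a long thin bent tail. -/
def surf : Set E3 :=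
  {X | -(2 * p.ρ) ≤ X 0 ∧ X 0 ≤ 3 ∧
    (X 1 - p.axis₁ (X 0)) ^ 2 + (X 2 - p.axis₂ (X 0)) ^ 2 = p.radius (X 0) ^ 2}

/-- Parametrization of the surface by the abscissa and an angle. -/
noncomputable def param (x θ : ℝ) : E3 :=
  pt x (p.axis₁ x + p.radius x * Real.cos θ) (p.axis₂ x + p.radius x * Real.sin θ)

theorem ρw_pos : 0 < p.ρ * p.w := mul_pos p.ρ_pos p.w_pos

theorem ρw_le : p.ρ * p.w ≤ p.ρ / 8 := by
  have := mul_le_mul_of_nonneg_left p.w_le p.ρ_pos.le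
  linarith

theorem cut_nonneg (x : ℝ) : 0 ≤ p.cut x := Real.smoothTransition.nonneg _

theorem cut_le_one (x : ℝ) : p.cut x ≤ 1 := Real.smoothTransition.le_one _

theorem cut_of_le {x : ℝ} (hx : x ≤ -(2 * (p.ρ * p.w))) : p.cut x = 0 := by
  apply Real.smoothTransition.zero_of_nonpos
  have : x / (p.ρ * p.w) ≤ -2 := by
    rw [div_le_iff₀ p.ρw_pos]; linarith
  linarith

theorem cut_of_ge {x : ℝ} (hx : -(p.ρ * p.w) ≤ x) : p.cut x = 1 := by
  apply Real.smoothTransition.one_of_one_le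
  have : -1 ≤ x / (p.ρ * p.w) := by
    rw [le_div_iff₀ p.ρw_pos]; linarith
  linarith

theorem radius_nonneg (x : ℝ) : 0 ≤ p.radius x := by
  have h1 := p.cut_nonneg x
  have h2 := p.cut_le_one x
  have h3 := p.ε_pos
  have : 0 ≤ 1 - p.cut x := by linarith
  unfold radius
  positivity

theorem radius_of_le {x : ℝ} (hx : x ≤ -(2 * (p.ρ * p.w))) :
    p.radius x = √(-x * (x + 2 * p.ρ)) / 2 := by
  simp [radius, p.cut_of_le hx]

theorem radius_of_ge {x : ℝ} (hx : -(p.ρ * p.w) ≤ x) : p.radius x = p.ε * √(3 - x) := by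
  simp [radius, p.cut_of_ge hx]

theorem sq_radius_of_le {x : ℝ} (h0 : -(2 * p.ρ) ≤ x) (hx : x ≤ -(2 * (p.ρ * p.w))) :
    p.radius x ^ 2 = -x * (x + 2 * p.ρ) / 4 := by
  have := p.ρw_pos
  rw [p.radius_of_le hx, div_pow, Real.sq_sqrt (mul_nonneg (by linarith) (by linarith))]
  norm_num

theorem sq_radius_of_ge {x : ℝ} (hx : -(p.ρ * p.w) ≤ x) (h3 : x ≤ 3) :
    p.radius x ^ 2 = p.ε ^ 2 * (3 - x) := by
  rw [p.radius_of_ge hx, mul_pow, Real.sq_sqrt (by linarith)]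

theorem radius_pos {x : ℝ} (h0 : -(2 * p.ρ) < x) (hx : x < 0) : 0 < p.radius x := by
  have h1 := p.cut_nonneg x
  have h2 := p.cut_le_one x
  have h3 := p.ε_pos
  have ha : 0 < √(-x * (x + 2 * p.ρ)) / 2 := by
    have : 0 < -x * (x + 2 * p.ρ) := mul_pos (by linarith) (by linarith)
    positivity
  have hb : 0 < p.ε * √(3 - x) := by
    have : 0 < 3 - x := by linarith
    positivity
  unfold radius
  rcases h1.eq_or_lt with h | h
  · rw [← h]; simpa using ha
  · have : 0 ≤ (1 - p.cut x) * (√(-x * (x + 2 * p.ρ)) / 2) := mul_nonneg (by linarith) ha.le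
    have := mul_pos h hb
    linarith

theorem contDiff_axis₁ : ContDiff ℝ ∞ p.axis₁ := by
  have h : ContDiff ℝ ∞ Real.smoothTransition := Real.smoothTransition.contDiff
  unfold axis₁
  fun_prop

theorem contDiff_axis₂ : ContDiff ℝ ∞ p.axis₂ := by
  have h : ContDiff ℝ ∞ Real.smoothTransition := Real.smoothTransition.contDiff
  unfold axis₂
  fun_prop

theorem contDiff_cut : ContDiff ℝ ∞ p.cut := by
  have h : ContDiff ℝ ∞ Real.smoothTransition := Real.smoothTransition.contDiff
  unfold cut
  exact h.comp (contDiff_const.add (contDiff_id.div_const _))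

theorem continuous_radius : Continuous p.radius := by
  have := p.contDiff_cut.continuous
  unfold radius
  fun_prop

theorem axis₁_of_nonpos {x : ℝ} (hx : x ≤ 0) : p.axis₁ x = 0 := by
  simp [axis₁, Real.smoothTransition.zero_of_nonpos hx]

theorem axis₂_of_nonpos {x : ℝ} (hx : x ≤ 0) : p.axis₂ x = 0 := by
  simp [axis₂, Real.smoothTransition.zero_of_nonpos hx]

theorem axis₁_lipschitz {x y : ℝ} (hx : x ∈ Set.Icc (-5 : ℝ) 5) (hy : y ∈ Set.Icc (-5 : ℝ) 5) :
    |p.axis₁ x - p.axis₁ y| ≤ |x - y| := by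
  have h := (exists_lipschitz_const.choose_spec.2 x hx y hy).2.1
  unfold axis₁
  rw [← mul_sub, abs_mul, abs_of_pos p.η_pos]
  calc _ ≤ p.η * (lipConst * |x - y|) := mul_le_mul_of_nonneg_left h p.η_pos.le
    _ = (p.η * lipConst) * |x - y| := by ring
    _ ≤ 1 * |x - y| := mul_le_mul_of_nonneg_right p.η_le (abs_nonneg _)
    _ = _ := one_mul _

theorem axis₂_lipschitz {x y : ℝ} (hx : x ∈ Set.Icc (-5 : ℝ) 5) (hy : y ∈ Set.Icc (-5 : ℝ) 5) :
    |p.axis₂ x - p.axis₂ y| ≤ |x - y| := by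
  have h := (exists_lipschitz_const.choose_spec.2 x hx y hy).2.2
  unfold axis₂
  rw [← mul_sub, abs_mul, abs_of_pos p.η_pos]
  calc _ ≤ p.η * (lipConst * |x - y|) := mul_le_mul_of_nonneg_left h p.η_pos.le
    _ = (p.η * lipConst) * |x - y| := by ring
    _ ≤ 1 * |x - y| := mul_le_mul_of_nonneg_right p.η_le (abs_nonneg _)
    _ = _ := one_mul _

theorem param_mem {x : ℝ} (hx : x ∈ Set.Icc (-(2 * p.ρ)) 3) (θ : ℝ) : p.param x θ ∈ p.surf := by
  refine ⟨hx.1, hx.2, ?_⟩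
  simp only [param, pt_zero, pt_one, pt_two]
  linear_combination p.radius x ^ 2 * Real.sin_sq_add_cos_sq θ

theorem exists_param {X : E3} (hX : X ∈ p.surf) : ∃ θ, X = p.param (X 0) θ := by
  obtain ⟨-, -, h⟩ := hX
  set z : ℂ := ⟨X 1 - p.axis₁ (X 0), X 2 - p.axis₂ (X 0)⟩ with hz
  have hn : ‖z‖ = p.radius (X 0) := by
    rw [← abs_of_nonneg (p.radius_nonneg (X 0)), ← abs_of_nonneg (norm_nonneg z), ← sq_eq_sq_iff_abs_eq_abs,
      ← h, Complex.sq_norm, Complex.normSq_apply]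
    ring
  refine ⟨z.arg, ?_⟩
  have h1 : p.radius (X 0) * Real.cos z.arg = X 1 - p.axis₁ (X 0) := by
    rw [← hn, Complex.norm_mul_cos_arg]
  have h2 : p.radius (X 0) * Real.sin z.arg = X 2 - p.axis₂ (X 0) := by
    rw [← hn, Complex.norm_mul_sin_arg]
  rw [param, h1, h2]
  nth_rewrite 1 [← pt_eta X]
  congr 1 <;> ring

theorem continuous_param : Continuous (fun q : ℝ × ℝ => p.param q.1 q.2) := by
  have h1 := p.contDiff_axis₁.continuous
  have h2 := p.contDiff_axis₂.continuous
  have h3 := p.continuous_radius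
  unfold param pt
  refine (PiLp.continuous_toLp 2 _).comp ?_
  refine continuous_pi fun i => ?_
  fin_cases i
  · exact continuous_fst
  · exact (h1.comp continuous_fst).add ((h3.comp continuous_fst).mul
      (Real.continuous_cos.comp continuous_snd))
  · exact (h2.comp continuous_fst).add ((h3.comp continuous_fst).mul
      (Real.continuous_sin.comp continuous_snd))

theorem surf_eq_image : p.surf =
    (fun q : ℝ × ℝ => p.param q.1 q.2) '' (Set.Icc (-(2 * p.ρ)) 3 ×ˢ Set.Icc 0 (2 * Real.pi)) := by
  ext X
  constructor
  · intro hX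
    obtain ⟨θ, hθ⟩ := p.exists_param hX
    obtain ⟨t, ht, hc, hs⟩ := exists_mem_Ico_cos_sin θ
    refine ⟨(X 0, t), ⟨⟨hX.1, hX.2.1⟩, ht.1, ht.2.le⟩, ?_⟩
    rw [hθ]
    simp only [param, hc, hs, pt_zero]
  · rintro ⟨⟨x, θ⟩, ⟨hx, -⟩, rfl⟩
    exact p.param_mem hx θ

theorem isCompact_surf : IsCompact p.surf := by
  rw [surf_eq_image]
  exact (isCompact_Icc.prod isCompact_Icc).image p.continuous_param

theorem isConnected_surf : IsConnected p.surf := by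
  rw [surf_eq_image]
  have := p.ρ_pos
  refine IsConnected.image ?_ _ p.continuous_param.continuousOn
  exact (isConnected_Icc (by linarith)).prod (isConnected_Icc (by positivity))

/-- The defining function of a surface of revolution around the bent axis. -/
noncomputable def revol (H : ℝ → ℝ) (X : E3) : ℝ :=
  (X 1 - p.axis₁ (X 0)) ^ 2 + (X 2 - p.axis₂ (X 0)) ^ 2 - H (X 0)

theorem contDiffOn_revol {J : Set ℝ} {H : ℝ → ℝ} (hH : ContDiffOn ℝ ∞ H J) :
    ContDiffOn ℝ ∞ (p.revol H) {X : E3 | X 0 ∈ J} := by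
  have hc : ∀ i : Fin 3, ContDiff ℝ ∞ (fun X : E3 => X i) := fun i => by fun_prop
  have h1 : ContDiff ℝ ∞ (fun X : E3 => (X 1 - p.axis₁ (X 0)) ^ 2 + (X 2 - p.axis₂ (X 0)) ^ 2) :=
    (((hc 1).sub (p.contDiff_axis₁.comp (hc 0))).pow 2).add
      (((hc 2).sub (p.contDiff_axis₂.comp (hc 0))).pow 2)
  exact h1.contDiffOn.sub (hH.comp (hc 0).contDiffOn fun X hX => hX)

/-- The two lateral derivatives vanish together only on the axis. There `H` is zero, and the
derivative in the direction of the abscissa is `-H'`, since the contributions of the axis carry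
factors that vanish. -/
theorem fderiv_revol_ne_zero {J : Set ℝ} (hJ : IsOpen J) {H : ℝ → ℝ} (hH : ContDiffOn ℝ ∞ H J)
    {X : E3} (hX : X 0 ∈ J) (h0 : p.revol H X = 0) (hd : H (X 0) = 0 → deriv H (X 0) ≠ 0) :
    fderiv ℝ (p.revol H) X ≠ 0 := by
  intro hf
  have hHd : HasDerivAt H (deriv H (X 0)) (X 0) :=
    ((hH.differentiableOn (by simp)).differentiableAt (hJ.mem_nhds hX)).hasDerivAt
  have hopen : IsOpen {X : E3 | X 0 ∈ J} := by
    have : Continuous (fun X : E3 => X 0) := by fun_prop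
    exact hJ.preimage this
  have hdiff : HasFDerivAt (p.revol H) (0 : E3 →L[ℝ] ℝ) X := by
    rw [← hf]
    exact (((p.contDiffOn_revol hH).differentiableOn (by simp)).differentiableAt
      (hopen.mem_nhds hX)).hasFDerivAt
  have hline : ∀ i : Fin 3, HasDerivAt (fun t : ℝ => p.revol H (X + t • EuclideanSpace.single i 1))
      0 0 := by
    intro i
    have hg : HasDerivAt (fun t : ℝ => X + t • (EuclideanSpace.single i (1 : ℝ)))
        (EuclideanSpace.single i (1 : ℝ)) 0 := by
      simpa using ((hasDerivAt_id (0 : ℝ)).smul_const (EuclideanSpace.single i (1 : ℝ))).const_add X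
    have hd' : HasFDerivAt (p.revol H) (0 : E3 →L[ℝ] ℝ)
        (X + (0 : ℝ) • EuclideanSpace.single i (1 : ℝ)) := by simpa using hdiff
    have h := hd'.comp_hasDerivAt (0 : ℝ) hg
    rw [zero_apply] at h
    exact h
  have e1 : HasDerivAt (fun t : ℝ => p.revol H (X + t • EuclideanSpace.single 1 1))
      (2 * (X 1 - p.axis₁ (X 0))) 0 := by
    have : (fun t : ℝ => p.revol H (X + t • EuclideanSpace.single 1 1)) =
        fun t => (t + (X 1 - p.axis₁ (X 0))) ^ 2 + ((X 2 - p.axis₂ (X 0)) ^ 2 - H (X 0)) := by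
      funext t
      simp [revol]
      ring
    rw [this]
    simpa using (((hasDerivAt_id (0 : ℝ)).add_const (X 1 - p.axis₁ (X 0))).pow 2).add_const
      ((X 2 - p.axis₂ (X 0)) ^ 2 - H (X 0))
  have e2 : HasDerivAt (fun t : ℝ => p.revol H (X + t • EuclideanSpace.single 2 1))
      (2 * (X 2 - p.axis₂ (X 0))) 0 := by
    have : (fun t : ℝ => p.revol H (X + t • EuclideanSpace.single 2 1)) =
        fun t => (t + (X 2 - p.axis₂ (X 0))) ^ 2 + ((X 1 - p.axis₁ (X 0)) ^ 2 - H (X 0)) := by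
      funext t
      simp [revol]
      ring
    rw [this]
    simpa using (((hasDerivAt_id (0 : ℝ)).add_const (X 2 - p.axis₂ (X 0))).pow 2).add_const
      ((X 1 - p.axis₁ (X 0)) ^ 2 - H (X 0))
  have v1 : X 1 - p.axis₁ (X 0) = 0 := by
    have := e1.unique (hline 1); linarith
  have v2 : X 2 - p.axis₂ (X 0) = 0 := by
    have := e2.unique (hline 2); linarith
  have hH0 : H (X 0) = 0 := by
    rw [revol, v1, v2] at h0
    linarith
  have e0 : HasDerivAt (fun t : ℝ => p.revol H (X + t • EuclideanSpace.single 0 1))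
      (-deriv H (X 0)) 0 := by
    have hsh : HasDerivAt (fun t : ℝ => X 0 + t) 1 0 := by
      simpa using (hasDerivAt_id (0 : ℝ)).const_add (X 0)
    have : (fun t : ℝ => p.revol H (X + t • EuclideanSpace.single 0 1)) =
        fun t => (X 1 - p.axis₁ (X 0 + t)) ^ 2 + (X 2 - p.axis₂ (X 0 + t)) ^ 2 - H (X 0 + t) := by
      funext t
      simp [revol]
    rw [this]
    have a1 : HasDerivAt (fun t : ℝ => p.axis₁ (X 0 + t)) (deriv p.axis₁ (X 0)) 0 := by
      have h := ((p.contDiff_axis₁.differentiable (by simp)) (X 0)).hasDerivAt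
      have h' : HasDerivAt p.axis₁ (deriv p.axis₁ (X 0)) (X 0 + 0) := by simpa using h
      have h2 := h'.comp 0 hsh
      rw [mul_one] at h2
      exact h2
    have a2 : HasDerivAt (fun t : ℝ => p.axis₂ (X 0 + t)) (deriv p.axis₂ (X 0)) 0 := by
      have h := ((p.contDiff_axis₂.differentiable (by simp)) (X 0)).hasDerivAt
      have h' : HasDerivAt p.axis₂ (deriv p.axis₂ (X 0)) (X 0 + 0) := by simpa using h
      have h2 := h'.comp 0 hsh
      rw [mul_one] at h2
      exact h2
    have a3 : HasDerivAt (fun t : ℝ => H (X 0 + t)) (deriv H (X 0)) 0 := by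
      have h' : HasDerivAt H (deriv H (X 0)) (X 0 + 0) := by simpa using hHd
      have h2 := h'.comp 0 hsh
      rw [mul_one] at h2
      exact h2
    have := (((a1.const_sub (X 1)).pow 2).add ((a2.const_sub (X 2)).pow 2)).sub a3
    refine HasDerivAt.congr_deriv this ?_
    simp [v1, v2]
  have := e0.unique (hline 0)
  exact hd hH0 (by linarith)

theorem isSmoothSurface_surf : IsSmoothSurface p.surf := by
  have hρ := p.ρ_pos
  have hρ1 := p.ρ_le
  have hw := p.ρw_pos
  have hw8 := p.ρw_le
  have key : ∀ (J : Set ℝ) (H : ℝ → ℝ), IsOpen J → ContDiffOn ℝ ∞ H J →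
      (∀ x ∈ J, H x = 0 → deriv H x ≠ 0) →
      (∀ X : E3, X 0 ∈ J → (X ∈ p.surf ↔ p.revol H X = 0)) → ∀ X ∈ p.surf, X 0 ∈ J →
      ∃ (U : Set E3) (f : E3 → ℝ), IsOpen U ∧ X ∈ U ∧ ContDiffOn ℝ ∞ f U ∧
        (∀ x ∈ U, x ∈ p.surf ↔ f x = 0) ∧ ∀ x ∈ U ∩ p.surf, fderiv ℝ f x ≠ 0 := by
    intro J H hJ hH hd hS X hX hXJ
    refine ⟨{X | X 0 ∈ J}, p.revol H, ?_, hXJ, p.contDiffOn_revol hH, hS, ?_⟩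
    · have : Continuous (fun X : E3 => X 0) := by fun_prop
      exact hJ.preimage this
    · rintro Y ⟨hYJ, hY⟩
      exact p.fderiv_revol_ne_zero hJ hH hYJ ((hS Y hYJ).1 hY) (hd _ hYJ)
  intro X hX
  rcases lt_or_ge (X 0) (-(2 * (p.ρ * p.w))) with h1 | h1
  -- Three charts: the two polynomial ones contain the poles `-(2 * ρ)` and `3`, simple zeros of the
  -- squared radius; the middle one contains the transition, where the radius is positive and only
  -- nonvanishing is needed.
  · refine key (Set.Iio (-(2 * (p.ρ * p.w)))) (fun x => -x * (x + 2 * p.ρ) / 4) isOpen_Iio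
      (by fun_prop) ?_ ?_ X hX h1
    · intro x hx h0
      have hx' : x < -(2 * (p.ρ * p.w)) := hx
      have hx0 : x + 2 * p.ρ = 0 := by
        have : x * (x + 2 * p.ρ) = 0 := by linarith
        rcases mul_eq_zero.1 this with h | h
        · linarith
        · exact h
      have hder : HasDerivAt (fun x => -x * (x + 2 * p.ρ) / 4) ((-1 * (x + 2 * p.ρ) + -x * 1) / 4) x :=
        (((hasDerivAt_id x).neg).mul ((hasDerivAt_id x).add_const _)).div_const 4
      rw [hder.deriv, hx0]
      intro h
      linarith
    · intro Y hY
      have hY' : Y 0 < -(2 * (p.ρ * p.w)) := hY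
      constructor
      · intro h
        have := h.2.2
        rw [p.sq_radius_of_le h.1 hY'.le] at this
        simp only [revol]
        linarith
      · intro h
        simp only [revol] at h
        have hpos : 0 ≤ -Y 0 * (Y 0 + 2 * p.ρ) / 4 := by
          nlinarith [sq_nonneg (Y 1 - p.axis₁ (Y 0)), sq_nonneg (Y 2 - p.axis₂ (Y 0))]
        have h0 : -(2 * p.ρ) ≤ Y 0 := by
          by_contra hc
          push Not at hc
          have := mul_pos (show 0 < -Y 0 by linarith) (show 0 < -(Y 0 + 2 * p.ρ) by linarith)
          linarith
        refine ⟨h0, by linarith, ?_⟩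
        rw [p.sq_radius_of_le h0 hY'.le]
        linarith
  · rcases lt_or_ge (X 0) 0 with h2 | h2
    · refine key (Set.Ioo (-(2 * p.ρ)) 0) (fun x => p.radius x ^ 2) isOpen_Ioo ?_ ?_ ?_ X hX
        ⟨by linarith, h2⟩
      · intro x hx
        have hx1 : -(2 * p.ρ) < x := hx.1
        have hx2 : x < 0 := hx.2
        have hp : -x * (x + 2 * p.ρ) ≠ 0 := (mul_pos (by linarith) (by linarith)).ne'
        have hq : 3 - x ≠ 0 := by linarith
        have hcut : ContDiffAt ℝ ∞ p.cut x := p.contDiff_cut.contDiffAt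
        apply ContDiffAt.contDiffWithinAt
        apply ContDiffAt.pow
        have s1 : ContDiffAt ℝ ∞ (fun x => √(-x * (x + 2 * p.ρ))) x :=
          ContDiffAt.sqrt (by fun_prop) hp
        have s2 : ContDiffAt ℝ ∞ (fun x => √(3 - x)) x := ContDiffAt.sqrt (by fun_prop) hq
        exact ((contDiffAt_const.sub hcut).mul (s1.div_const 2)).add
          (hcut.mul (contDiffAt_const.mul s2))
      · intro x hx h0
        have := p.radius_pos hx.1 hx.2
        exact absurd h0 (by positivity)
      · intro Y hY
        have hy1 : -(2 * p.ρ) < Y 0 := hY.1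
        have hy2 : Y 0 < 0 := hY.2
        simp only [revol, sub_eq_zero]
        exact ⟨fun h => h.2.2, fun h => ⟨by linarith, by linarith, h⟩⟩
    · refine key (Set.Ioi (-(p.ρ * p.w))) (fun x => p.ε ^ 2 * (3 - x)) isOpen_Ioi (by fun_prop) ?_ ?_
        X hX (show -(p.ρ * p.w) < X 0 by linarith)
      · intro x hx h0
        have hder : HasDerivAt (fun x => p.ε ^ 2 * (3 - x)) (p.ε ^ 2 * (-1)) x :=
          ((hasDerivAt_id x).const_sub 3).const_mul _
        rw [hder.deriv]
        have := p.ε_pos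
        have : 0 < p.ε ^ 2 := by positivity
        linarith
      · intro Y hY
        have hY' : -(p.ρ * p.w) < Y 0 := hY
        constructor
        · intro h
          have := h.2.2
          rw [p.sq_radius_of_ge hY'.le h.2.1] at this
          simp only [revol]
          linarith
        · intro h
          simp only [revol] at h
          have hpos : 0 ≤ p.ε ^ 2 * (3 - Y 0) := by
            nlinarith [sq_nonneg (Y 1 - p.axis₁ (Y 0)), sq_nonneg (Y 2 - p.axis₂ (Y 0))]
          have h3 : Y 0 ≤ 3 := by
            have := p.ε_pos
            have : 0 < p.ε ^ 2 := by positivity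
            by_contra hc
            push Not at hc
            nlinarith
          refine ⟨by linarith, h3, ?_⟩
          rw [p.sq_radius_of_ge hY'.le h3]
          linarith

end TubeParams

end Surface

/-! ### Areas of the body, the transition and the tail -/

section SurfaceAreaBounds

namespace TubeParams

variable (p : TubeParams)

theorem ε_le_ρ : p.ε ≤ p.ρ := by
  have := p.ρw_le
  have := p.ρ_pos
  linarith [p.ε_le]

/-- The polar angle of the ellipsoid, `x = ρ (cos y - 1)` with radius `(ρ / 2) sin y`, is a
parameter in which everything is Lipschitz even at the poles. The area of a zone is thus linear in
its angular width. -/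
theorem surfaceArea_body_le {a b : ℝ} (ha : 0 ≤ a) (hab : a ≤ b) (hb : b ≤ Real.pi) :
    surfaceArea (p.surf ∩ {X | p.ρ * (Real.cos b - 1) ≤ X 0 ∧ X 0 ≤ p.ρ * (Real.cos a - 1) ∧
      X 0 ≤ -(2 * (p.ρ * p.w))}) ≤ ENNReal.ofReal (400 * (p.ρ * (b - a) * p.ρ)) := by
  have hρ := p.ρ_pos
  have hρ1 := p.ρ_le
  have hsub : p.surf ∩ {X | p.ρ * (Real.cos b - 1) ≤ X 0 ∧ X 0 ≤ p.ρ * (Real.cos a - 1) ∧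
      X 0 ≤ -(2 * (p.ρ * p.w))} ⊆ {X : E3 | ∃ y ∈ Set.Icc a b, ∃ θ : ℝ,
      X = pt (p.ρ * (Real.cos y - 1))
        (p.axis₁ (p.ρ * (Real.cos y - 1)) + (p.ρ / 2 * Real.sin y) * Real.cos θ)
        (p.axis₂ (p.ρ * (Real.cos y - 1)) + (p.ρ / 2 * Real.sin y) * Real.sin θ)} := by
    rintro X ⟨hX, h1, h2, h3⟩
    obtain ⟨θ, hθ⟩ := p.exists_param hX
    have hc : Real.cos b ≤ 1 + X 0 / p.ρ := by
      have : Real.cos b - 1 ≤ X 0 / p.ρ := by rw [le_div_iff₀ hρ]; linarith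
      linarith
    have hc' : 1 + X 0 / p.ρ ≤ Real.cos a := by
      have : X 0 / p.ρ ≤ Real.cos a - 1 := by rw [div_le_iff₀ hρ]; linarith
      linarith
    have hcos : Real.cos (Real.arccos (1 + X 0 / p.ρ)) = 1 + X 0 / p.ρ :=
      Real.cos_arccos (by linarith [Real.neg_one_le_cos b]) (by linarith [Real.cos_le_one a])
    have hx : p.ρ * (Real.cos (Real.arccos (1 + X 0 / p.ρ)) - 1) = X 0 := by
      rw [hcos]; field_simp; ring
    refine ⟨Real.arccos (1 + X 0 / p.ρ), ⟨?_, ?_⟩, θ, ?_⟩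
    · rw [← Real.arccos_cos ha (hab.trans hb)]
      exact Real.arccos_le_arccos hc'
    · rw [← Real.arccos_cos (ha.trans hab) hb]
      exact Real.arccos_le_arccos hc
    · have hr : p.radius (X 0) = p.ρ / 2 * Real.sin (Real.arccos (1 + X 0 / p.ρ)) := by
        rw [p.radius_of_le h3, Real.sin_arccos]
        have : -X 0 * (X 0 + 2 * p.ρ) = p.ρ ^ 2 * (1 - (1 + X 0 / p.ρ) ^ 2) := by
          field_simp; ring
        rw [this, Real.sqrt_mul (by positivity), Real.sqrt_sq hρ.le]
        ring
      rw [hx, ← hr]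
      exact hθ
  have hlip : ∀ y z : ℝ, |p.ρ * (Real.cos y - 1) - p.ρ * (Real.cos z - 1)| ≤ p.ρ * |y - z| := by
    intro y z
    rw [← mul_sub, abs_mul, abs_of_pos hρ]
    have := Real.lipschitzWith_cos.dist_le_mul y z
    rw [Real.dist_eq, Real.dist_eq, NNReal.coe_one, one_mul] at this
    apply mul_le_mul_of_nonneg_left _ hρ.le
    rwa [sub_sub_sub_cancel_right]
  have hdom : ∀ y : ℝ, p.ρ * (Real.cos y - 1) ∈ Set.Icc (-5 : ℝ) 5 := by
    intro y
    have h1 := Real.neg_one_le_cos y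
    have h2 := Real.cos_le_one y
    constructor <;> nlinarith
  refine (measure_mono hsub).trans (surfaceArea_tube_le (f := fun y => p.ρ * (Real.cos y - 1))
    (R := fun y => p.ρ / 2 * Real.sin y) hab hρ hρ (fun y _ z _ => hlip y z) ?_ ?_
    (fun y _ z _ => p.axis₁_lipschitz (hdom y) (hdom z))
    (fun y _ z _ => p.axis₂_lipschitz (hdom y) (hdom z)))
  · intro y _ z _
    have := Real.lipschitzWith_sin.dist_le_mul y z
    rw [Real.dist_eq, Real.dist_eq, NNReal.coe_one, one_mul] at this
    rw [← mul_sub, abs_mul, abs_of_pos (by positivity)]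
    have h0 := abs_nonneg (y - z)
    calc _ ≤ p.ρ / 2 * |y - z| := by gcongr
      _ ≤ _ := by gcongr; linarith
  · intro y _
    rw [abs_mul, abs_of_pos (by positivity)]
    have := Real.abs_sin_le_one y
    nlinarith [abs_nonneg (Real.sin y)]

/-- In the parameter `y = √(3 - x)` the radius is `ε * y`, which stays Lipschitz up to the tip `x =
3`. -/
theorem surfaceArea_tail_le {a b : ℝ} (ha : 0 ≤ a) (hab : a ≤ b) (hb : b ≤ 2) :
    surfaceArea (p.surf ∩ {X | -(p.ρ * p.w) ≤ X 0 ∧ a ≤ √(3 - X 0) ∧ √(3 - X 0) ≤ b}) ≤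
      ENNReal.ofReal (400 * (4 * (b - a) * (2 * p.ε))) := by
  have hε := p.ε_pos
  have hsub : p.surf ∩ {X | -(p.ρ * p.w) ≤ X 0 ∧ a ≤ √(3 - X 0) ∧ √(3 - X 0) ≤ b} ⊆
      {X : E3 | ∃ y ∈ Set.Icc a b, ∃ θ : ℝ,
      X = pt (3 - y ^ 2) (p.axis₁ (3 - y ^ 2) + (p.ε * y) * Real.cos θ)
        (p.axis₂ (3 - y ^ 2) + (p.ε * y) * Real.sin θ)} := by
    rintro X ⟨hX, h1, h2, h3⟩
    obtain ⟨θ, hθ⟩ := p.exists_param hX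
    refine ⟨√(3 - X 0), ⟨h2, h3⟩, θ, ?_⟩
    have : 3 - √(3 - X 0) ^ 2 = X 0 := by
      rw [Real.sq_sqrt (by linarith [hX.2.1])]; ring
    rw [this, ← p.radius_of_ge h1]
    exact hθ
  have hdom : ∀ y ∈ Set.Icc a b, 3 - y ^ 2 ∈ Set.Icc (-5 : ℝ) 5 := by
    intro y hy
    have h1 : 0 ≤ y := ha.trans hy.1
    have h2 : y ≤ 2 := hy.2.trans hb
    constructor <;> nlinarith
  refine (measure_mono hsub).trans (surfaceArea_tube_le (f := fun y => 3 - y ^ 2)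
    (R := fun y => p.ε * y) hab (by norm_num) (by positivity) ?_ ?_ ?_
    (fun y hy z hz => p.axis₁_lipschitz (hdom y hy) (hdom z hz))
    (fun y hy z hz => p.axis₂_lipschitz (hdom y hy) (hdom z hz)))
  · intro y hy z hz
    have h1 : 0 ≤ y := ha.trans hy.1
    have h2 : y ≤ 2 := hy.2.trans hb
    have h3 : 0 ≤ z := ha.trans hz.1
    have h4 : z ≤ 2 := hz.2.trans hb
    rw [show 3 - y ^ 2 - (3 - z ^ 2) = -(y + z) * (y - z) by ring, abs_mul, abs_neg,
      abs_of_nonneg (by linarith : 0 ≤ y + z)]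
    exact mul_le_mul_of_nonneg_right (by linarith) (abs_nonneg _)
  · intro y hy z hz
    rw [← mul_sub, abs_mul, abs_of_pos hε]
    refine mul_le_mul_of_nonneg_right ?_ (abs_nonneg _)
    linarith [p.ε_le_ρ, p.ρ_le]
  · intro y hy
    rw [abs_of_nonneg (mul_nonneg hε.le (ha.trans hy.1))]
    nlinarith [hy.2]

/-- In the parameter `y = √(-x / ρ)`, of size `√w`, the cutoff has slope of order `1 / √w` and
multiplies radii of order `ρ √w`, so the radius is Lipschitz with a constant of order `ρ`. The area
is of order `ρ · √w · ρ √w`. -/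
theorem surfaceArea_transition_le :
    surfaceArea (p.surf ∩ {X | -(2 * (p.ρ * p.w)) ≤ X 0 ∧ X 0 ≤ -(p.ρ * p.w)}) ≤
      ENNReal.ofReal (19200 * lipConst * (p.ρ ^ 2 * p.w)) := by
  have hρ := p.ρ_pos
  have hρ1 := p.ρ_le
  have hε := p.ε_pos
  have hw := p.w_pos
  have hw8 := p.w_le
  have hL := one_le_lipConst
  set v := √p.w with hv
  have hv2 : v ^ 2 = p.w := Real.sq_sqrt hw.le
  have hv0 : 0 < v := Real.sqrt_pos.2 hw
  have hεv : p.ε ≤ p.ρ * v ^ 2 := by rw [hv2]; exact p.ε_le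
  have hv3 : v ≤ 3 / 8 := by nlinarith
  have hb2 : √(2 * p.w) ≤ 3 / 2 * v := by
    rw [show (2 : ℝ) * p.w = 2 * v ^ 2 by rw [hv2], Real.sqrt_le_left (by positivity)]
    nlinarith
  have hab : v ≤ √(2 * p.w) := Real.sqrt_le_sqrt (by linarith)
  set aa : ℝ → ℝ := fun y => √(-(-(p.ρ * y ^ 2)) * (-(p.ρ * y ^ 2) + 2 * p.ρ)) / 2 with haa
  set bb : ℝ → ℝ := fun y => p.ε * √(3 - -(p.ρ * y ^ 2)) with hbb
  have hsub : p.surf ∩ {X | -(2 * (p.ρ * p.w)) ≤ X 0 ∧ X 0 ≤ -(p.ρ * p.w)} ⊆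
      {X : E3 | ∃ y ∈ Set.Icc v (√(2 * p.w)), ∃ θ : ℝ,
      X = pt (-(p.ρ * y ^ 2))
        (p.axis₁ (-(p.ρ * y ^ 2)) + p.radius (-(p.ρ * y ^ 2)) * Real.cos θ)
        (p.axis₂ (-(p.ρ * y ^ 2)) + p.radius (-(p.ρ * y ^ 2)) * Real.sin θ)} := by
    rintro X ⟨hX, h1, h2⟩
    obtain ⟨θ, hθ⟩ := p.exists_param hX
    have hd0 : p.w ≤ -X 0 / p.ρ := by rw [le_div_iff₀ hρ]; linarith
    have hd1 : -X 0 / p.ρ ≤ 2 * p.w := by rw [div_le_iff₀ hρ]; linarith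
    refine ⟨√(-X 0 / p.ρ), ⟨Real.sqrt_le_sqrt hd0, Real.sqrt_le_sqrt hd1⟩, θ, ?_⟩
    have : -(p.ρ * √(-X 0 / p.ρ) ^ 2) = X 0 := by
      rw [Real.sq_sqrt (by linarith)]; field_simp
    rw [this]
    exact hθ
  have hrange : ∀ y ∈ Set.Icc v (√(2 * p.w)), 0 ≤ y ∧ y ≤ 3 / 2 * v ∧ y ≤ 9 / 16 ∧
      y ^ 2 ≤ 2 * p.w ∧ p.w ≤ y ^ 2 := by
    intro y hy
    have h0 : 0 ≤ y := hv0.le.trans hy.1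
    refine ⟨h0, hy.2.trans hb2, by linarith [hy.2], ?_, ?_⟩
    · have := pow_le_pow_left₀ h0 hy.2 2
      rwa [Real.sq_sqrt (by positivity)] at this
    · rw [← hv2]; exact pow_le_pow_left₀ hv0.le hy.1 2
  have hdom : ∀ y ∈ Set.Icc v (√(2 * p.w)), -(p.ρ * y ^ 2) ∈ Set.Icc (-5 : ℝ) 5 := by
    intro y hy
    obtain ⟨h0, -, h1, -⟩ := hrange y hy
    have : y ^ 2 ≤ 1 := by nlinarith
    constructor <;> nlinarith
  have hsq : ∀ y ∈ Set.Icc v (√(2 * p.w)), ∀ z ∈ Set.Icc v (√(2 * p.w)),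
      |y ^ 2 - z ^ 2| ≤ 3 * v * |y - z| := by
    intro y hy z hz
    obtain ⟨h0, h1, -⟩ := hrange y hy
    obtain ⟨h2, h3, -⟩ := hrange z hz
    rw [show y ^ 2 - z ^ 2 = (y + z) * (y - z) by ring, abs_mul, abs_of_nonneg (by linarith)]
    exact mul_le_mul_of_nonneg_right (by linarith) (abs_nonneg _)
  have hf : ∀ y ∈ Set.Icc v (√(2 * p.w)), ∀ z ∈ Set.Icc v (√(2 * p.w)),
      |-(p.ρ * y ^ 2) - -(p.ρ * z ^ 2)| ≤ 2 * p.ρ * |y - z| := by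
    intro y hy z hz
    rw [show -(p.ρ * y ^ 2) - -(p.ρ * z ^ 2) = -(p.ρ * (y ^ 2 - z ^ 2)) by ring, abs_neg, abs_mul,
      abs_of_pos hρ]
    calc _ ≤ p.ρ * (3 * v * |y - z|) := mul_le_mul_of_nonneg_left (hsq y hy z hz) hρ.le
      _ = p.ρ * |y - z| * (3 * v) := by ring
      _ ≤ p.ρ * |y - z| * 2 := by gcongr; linarith
      _ = _ := by ring
  -- The square root is Lipschitz with constant `1 / (2 * m)` on `[m ^ 2, ∞)`.
  have hsqrt : ∀ A B m : ℝ, 0 < m → m ^ 2 ≤ A → m ^ 2 ≤ B → |√A - √B| ≤ |A - B| / (2 * m) := by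
    intro A B m hm hA hB
    have h1 : m ≤ √A := Real.le_sqrt_of_sq_le hA
    have h2 : m ≤ √B := Real.le_sqrt_of_sq_le hB
    have hA0 : 0 ≤ A := le_trans (by positivity) hA
    have hB0 : 0 ≤ B := le_trans (by positivity) hB
    rw [le_div_iff₀ (by positivity)]
    have : A - B = (√A - √B) * (√A + √B) := by
      nlinarith [Real.mul_self_sqrt hA0, Real.mul_self_sqrt hB0]
    rw [this, abs_mul, abs_of_nonneg (by positivity : 0 ≤ √A + √B)]
    exact mul_le_mul_of_nonneg_left (by linarith) (abs_nonneg _)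
  have haeq : ∀ y, 0 ≤ y → aa y = p.ρ / 2 * (y * √(2 - y ^ 2)) := by
    intro y hy
    simp only [haa]
    rw [show -(-(p.ρ * y ^ 2)) * (-(p.ρ * y ^ 2) + 2 * p.ρ) = (p.ρ * y) ^ 2 * (2 - y ^ 2) by ring,
      Real.sqrt_mul (by positivity), Real.sqrt_sq (by positivity)]
    ring
  have hs2 : ∀ y : ℝ, √(2 - y ^ 2) ≤ 3 / 2 := by
    intro y
    rw [Real.sqrt_le_left (by norm_num)]
    nlinarith [sq_nonneg y]
  have ha_bd : ∀ y ∈ Set.Icc v (√(2 * p.w)), 0 ≤ aa y ∧ aa y ≤ 9 / 8 * (p.ρ * v) := by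
    intro y hy
    obtain ⟨h0, h1, -⟩ := hrange y hy
    rw [haeq y h0]
    refine ⟨by positivity, ?_⟩
    calc _ ≤ p.ρ / 2 * (3 / 2 * v * (3 / 2)) := by gcongr; exact hs2 y
      _ = _ := by ring
  have hb_bd : ∀ y ∈ Set.Icc v (√(2 * p.w)), 0 ≤ bb y ∧ bb y ≤ 2 * p.ε := by
    intro y hy
    obtain ⟨h0, h1, h2, -⟩ := hrange y hy
    simp only [hbb]
    refine ⟨by positivity, ?_⟩
    have : √(3 - -(p.ρ * y ^ 2)) ≤ 2 := by
      rw [Real.sqrt_le_left (by norm_num)]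
      have : y ^ 2 ≤ 1 := by nlinarith
      nlinarith
    nlinarith
  have ha_lip : ∀ y ∈ Set.Icc v (√(2 * p.w)), ∀ z ∈ Set.Icc v (√(2 * p.w)),
      |aa y - aa z| ≤ p.ρ * |y - z| := by
    intro y hy z hz
    obtain ⟨h0, h1, h1', -⟩ := hrange y hy
    obtain ⟨h2, h3, h3', -⟩ := hrange z hz
    rw [haeq y h0, haeq z h2, show p.ρ / 2 * (y * √(2 - y ^ 2)) - p.ρ / 2 * (z * √(2 - z ^ 2)) =
      p.ρ / 2 * ((y - z) * √(2 - y ^ 2) + z * (√(2 - y ^ 2) - √(2 - z ^ 2))) by ring, abs_mul,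
      abs_of_pos (by positivity)]
    have h5 : |√(2 - y ^ 2) - √(2 - z ^ 2)| ≤ |2 - y ^ 2 - (2 - z ^ 2)| / (2 * 1) :=
      hsqrt _ _ 1 one_pos (by nlinarith) (by nlinarith)
    rw [show 2 - y ^ 2 - (2 - z ^ 2) = -(y ^ 2 - z ^ 2) by ring, abs_neg] at h5
    have h6 := hsq y hy z hz
    have h7 : |(y - z) * √(2 - y ^ 2)| ≤ |y - z| * (3 / 2) := by
      rw [abs_mul, abs_of_nonneg (Real.sqrt_nonneg _)]
      exact mul_le_mul_of_nonneg_left (hs2 y) (abs_nonneg _)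
    have h8 : |z * (√(2 - y ^ 2) - √(2 - z ^ 2))| ≤ 9 / 16 * (3 * (3 / 8) * |y - z| / 2) := by
      rw [abs_mul, abs_of_nonneg h2]
      have : |√(2 - y ^ 2) - √(2 - z ^ 2)| ≤ 3 * (3 / 8) * |y - z| / 2 := by
        refine h5.trans ?_
        have := mul_le_mul_of_nonneg_right hv3 (abs_nonneg (y - z))
        linarith
      exact mul_le_mul h3' this (abs_nonneg _) (by norm_num)
    have h9 := (abs_add_le ((y - z) * √(2 - y ^ 2)) (z * (√(2 - y ^ 2) - √(2 - z ^ 2)))).trans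
      (add_le_add h7 h8)
    have h10 := abs_nonneg (y - z)
    calc _ ≤ p.ρ / 2 * (2 * |y - z|) := by
          apply mul_le_mul_of_nonneg_left _ (by positivity)
          linarith
      _ = _ := by ring
  have hb_lip : ∀ y ∈ Set.Icc v (√(2 * p.w)), ∀ z ∈ Set.Icc v (√(2 * p.w)),
      |bb y - bb z| ≤ p.ρ * |y - z| := by
    intro y hy z hz
    simp only [hbb]
    rw [← mul_sub, abs_mul, abs_of_pos hε]
    have h5 : |√(3 - -(p.ρ * y ^ 2)) - √(3 - -(p.ρ * z ^ 2))| ≤ _ :=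
      hsqrt _ _ 1 one_pos (by nlinarith [mul_nonneg hρ.le (sq_nonneg y)])
        (by nlinarith [mul_nonneg hρ.le (sq_nonneg z)])
    have h6 : |3 - -(p.ρ * y ^ 2) - (3 - -(p.ρ * z ^ 2))| ≤ 2 * p.ρ * |y - z| := by
      rw [abs_sub_comm]
      refine le_trans (le_of_eq ?_) (hf y hy z hz)
      congr 1; ring
    have h7 : |√(3 - -(p.ρ * y ^ 2)) - √(3 - -(p.ρ * z ^ 2))| ≤ 1 * |y - z| := by
      refine h5.trans ?_
      rw [div_le_iff₀ (by norm_num)]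
      refine h6.trans ?_
      have := abs_nonneg (y - z)
      nlinarith
    calc _ ≤ p.ρ * (1 * |y - z|) := mul_le_mul p.ε_le_ρ h7 (abs_nonneg _) hρ.le
      _ = _ := by ring
  have hs_lip : ∀ y ∈ Set.Icc v (√(2 * p.w)), ∀ z ∈ Set.Icc v (√(2 * p.w)),
      |p.cut (-(p.ρ * y ^ 2)) - p.cut (-(p.ρ * z ^ 2))| * v ≤ lipConst * (3 * |y - z|) := by
    intro y hy z hz
    obtain ⟨-, -, -, h0, h1⟩ := hrange y hy
    obtain ⟨-, -, -, h2, h3⟩ := hrange z hz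
    have e : ∀ t : ℝ, 2 + -(p.ρ * t ^ 2) / (p.ρ * p.w) = 2 - t ^ 2 / p.w := by
      intro t; field_simp; ring
    have d : ∀ t : ℝ, t ^ 2 ≤ 2 * p.w → p.w ≤ t ^ 2 → 2 - t ^ 2 / p.w ∈ Set.Icc (-5 : ℝ) 5 := by
      intro t ht1 ht2
      have : t ^ 2 / p.w ≤ 2 := by rw [div_le_iff₀ hw]; linarith
      have : 1 ≤ t ^ 2 / p.w := by rw [le_div_iff₀ hw]; linarith
      constructor <;> linarith
    have h := (exists_lipschitz_const.choose_spec.2 _ (d y h0 h1) _ (d z h2 h3)).1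
    simp only [cut, e]
    have h4 : |2 - y ^ 2 / p.w - (2 - z ^ 2 / p.w)| * v ≤ 3 * |y - z| := by
      rw [show 2 - y ^ 2 / p.w - (2 - z ^ 2 / p.w) = -(y ^ 2 - z ^ 2) / p.w by ring, abs_div, abs_neg,
        abs_of_pos hw, ← hv2]
      calc _ ≤ 3 * v * |y - z| / v ^ 2 * v := by gcongr; exact hsq y hy z hz
        _ = _ := by field_simp
    calc _ ≤ lipConst * |2 - y ^ 2 / p.w - (2 - z ^ 2 / p.w)| * v :=
          mul_le_mul_of_nonneg_right h hv0.le
      _ = lipConst * (|2 - y ^ 2 / p.w - (2 - z ^ 2 / p.w)| * v) := by ring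
      _ ≤ _ := mul_le_mul_of_nonneg_left h4 (by linarith)
  have hεv' : p.ε ≤ 3 / 8 * (p.ρ * v) := by
    have : p.ρ * v ^ 2 = p.ρ * v * v := by ring
    have h2 : p.ρ * v * v ≤ p.ρ * v * (3 / 8) := mul_le_mul_of_nonneg_left hv3 (by positivity)
    linarith
  refine (measure_mono hsub).trans ((surfaceArea_tube_le (f := fun y => -(p.ρ * y ^ 2))
    (R := fun y => p.radius (-(p.ρ * y ^ 2))) (l := 12 * lipConst * p.ρ) (M := 4 * (p.ρ * v))
    hab (by positivity) (by positivity) ?_ ?_ ?_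
    (fun y hy z hz => p.axis₁_lipschitz (hdom y hy) (hdom z hz))
    (fun y hy z hz => p.axis₂_lipschitz (hdom y hy) (hdom z hz))).trans ?_)
  · intro y hy z hz
    refine (hf y hy z hz).trans ?_
    apply mul_le_mul_of_nonneg_right _ (abs_nonneg _)
    nlinarith
  · intro y hy z hz
    set s := p.cut (-(p.ρ * y ^ 2)) with hs
    set t := p.cut (-(p.ρ * z ^ 2)) with ht
    have hs0 : 0 ≤ s := p.cut_nonneg _
    have hs1 : s ≤ 1 := p.cut_le_one _
    -- Product rule in finite differences: the variation of each profile, plus the variation of the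
    -- cutoff times the difference of the profiles.
    have : p.radius (-(p.ρ * y ^ 2)) - p.radius (-(p.ρ * z ^ 2)) =
        (1 - s) * (aa y - aa z) + s * (bb y - bb z) + (s - t) * (bb z - aa z) := by
      simp only [radius, haa, hbb, ← hs, ← ht]
      ring
    rw [this]
    have k1 : |(1 - s) * (aa y - aa z) + s * (bb y - bb z)| ≤ p.ρ * |y - z| := by
      refine (abs_add_le _ _).trans ?_
      rw [abs_mul, abs_mul, abs_of_nonneg hs0, abs_of_nonneg (by linarith : 0 ≤ 1 - s)]
      have := mul_le_mul_of_nonneg_left (ha_lip y hy z hz) (by linarith : 0 ≤ 1 - s)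
      have := mul_le_mul_of_nonneg_left (hb_lip y hy z hz) hs0
      linarith
    have k2 : |(s - t) * (bb z - aa z)| ≤ 9 / 8 * p.ρ * (lipConst * (3 * |y - z|)) := by
      obtain ⟨ha0, ha1⟩ := ha_bd z hz
      obtain ⟨hb0, hb1⟩ := hb_bd z hz
      have hba : |bb z - aa z| ≤ 9 / 8 * (p.ρ * v) := by
        rw [abs_le]; constructor <;> linarith
      rw [abs_mul]
      calc _ ≤ |s - t| * (9 / 8 * (p.ρ * v)) := mul_le_mul_of_nonneg_left hba (abs_nonneg _)
        _ = 9 / 8 * p.ρ * (|s - t| * v) := by ring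
        _ ≤ _ := mul_le_mul_of_nonneg_left (hs_lip y hy z hz) (by positivity)
    refine (abs_add_le _ _).trans ((add_le_add k1 k2).trans ?_)
    have h0 : 0 ≤ p.ρ * |y - z| := mul_nonneg hρ.le (abs_nonneg _)
    nlinarith
  · intro y hy
    have hs0 := p.cut_nonneg (-(p.ρ * y ^ 2))
    have hs1 := p.cut_le_one (-(p.ρ * y ^ 2))
    rw [abs_of_nonneg (p.radius_nonneg _)]
    have : p.radius (-(p.ρ * y ^ 2)) =
        (1 - p.cut (-(p.ρ * y ^ 2))) * aa y + p.cut (-(p.ρ * y ^ 2)) * bb y := rfl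
    rw [this]
    obtain ⟨ha0, ha1⟩ := ha_bd y hy
    obtain ⟨hb0, hb1⟩ := hb_bd y hy
    have h1 := mul_le_mul_of_nonneg_right hs1 hb0
    have h2 := mul_le_mul_of_nonneg_right (by linarith : 1 - p.cut (-(p.ρ * y ^ 2)) ≤ 1) ha0
    have := mul_pos hρ hv0
    linarith
  · apply ENNReal.ofReal_le_ofReal
    rw [← hv2]
    have h1 : √(2 * v ^ 2) - v ≤ v := by
      rw [hv2]; linarith
    have : 0 ≤ lipConst * p.ρ * (p.ρ * v) := by positivity
    calc _ = 19200 * (lipConst * p.ρ * (p.ρ * v)) * (√(2 * v ^ 2) - v) := by ring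
      _ ≤ 19200 * (lipConst * p.ρ * (p.ρ * v)) * v := by gcongr
      _ = _ := by ring

/-- The part of the surface with abscissa in `[a, b]` and angle in `[θ, θ + δ]`. -/
def cell (a b θ δ : ℝ) : Set E3 :=
  (fun q : ℝ × ℝ => p.param q.1 q.2) '' (Set.Icc a b ×ˢ Set.Icc θ (θ + δ))

theorem measurableSet_cell (a b θ δ : ℝ) : MeasurableSet (p.cell a b θ δ) :=
  ((isCompact_Icc.prod isCompact_Icc).image p.continuous_param).isClosed.measurableSet

theorem cell_subset_surf {a b θ δ : ℝ} (ha : -(2 * p.ρ) ≤ a) (hb : b ≤ 3) :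
    p.cell a b θ δ ⊆ p.surf := by
  rintro X ⟨⟨x, t⟩, ⟨hx, -⟩, rfl⟩
  exact p.param_mem ⟨ha.trans hx.1, hx.2.trans hb⟩ t

/-- Projecting on the lateral direction `(-sin θ, cos θ)` turns the angle `θ + t` into `radius * sin
t`, which sweeps `[0, radius * sin δ]` for `t` in `[0, δ]`. -/
theorem le_surfaceArea_cell {a b θ δ m : ℝ} (ha : -(2 * p.ρ) ≤ a) (hab : a ≤ b) (hb : b ≤ 3)
    (hδ : 0 ≤ δ) (hδ' : δ ≤ Real.pi / 2) (hm : ∀ x ∈ Set.Icc a b, m ≤ p.radius x * Real.sin δ) :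
    ENNReal.ofReal ((b - a) * m / 16) ≤ surfaceArea (p.cell a b θ δ) := by
  have hρ := p.ρ_pos
  have hρ1 := p.ρ_le
  have hdom : ∀ X ∈ p.cell a b θ δ, X 0 ∈ Set.Icc (-5 : ℝ) 5 := by
    intro X hX
    have := p.cell_subset_surf ha hb hX
    constructor <;> linarith [this.1, this.2.1]
  refine le_surfaceArea_of_rectangle (φ₁ := p.axis₁) (φ₂ := p.axis₂) (e₁ := -Real.sin θ)
    (e₂ := Real.cos θ) hab (by rw [abs_neg]; exact Real.abs_sin_le_one θ) (Real.abs_cos_le_one θ)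
    (fun X hX Y hY => p.axis₁_lipschitz (hdom X hX) (hdom Y hY))
    (fun X hX Y hY => p.axis₂_lipschitz (hdom X hX) (hdom Y hY)) ?_
  intro x hx y hy
  have hR := p.radius_nonneg x
  have hs1 := Real.sin_le_one δ
  have hs0 : 0 ≤ Real.sin δ := Real.sin_nonneg_of_nonneg_of_le_pi hδ (by linarith [Real.pi_pos])
  have hyR : y ≤ p.radius x * Real.sin δ := hy.2.trans (hm x hx)
  have hq0 : 0 ≤ y / p.radius x := div_nonneg hy.1 hR
  have hq1 : y / p.radius x ≤ Real.sin δ := div_le_of_le_mul₀ hR hs0 (by linarith)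
  have hyq : p.radius x * (y / p.radius x) = y := by
    rcases hR.eq_or_lt with h | h
    · have hy2 := hy.1
      rw [← h, zero_mul] at hyR
      rw [← h]; linarith
    · field_simp
  refine ⟨p.param x (θ + Real.arcsin (y / p.radius x)), ⟨(x, θ + Real.arcsin (y / p.radius x)),
    ⟨hx, ?_, ?_⟩, rfl⟩, rfl, ?_⟩
  · have := Real.arcsin_nonneg.2 hq0
    simp only; linarith
  · have h1 := Real.arcsin_le_arcsin hq1
    rw [Real.arcsin_sin (by linarith) hδ'] at h1
    simp only; linarith
  · simp only [param, pt_zero, pt_one, pt_two, add_sub_cancel_left]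
    have h1 : Real.sin (Real.arcsin (y / p.radius x)) = y / p.radius x :=
      Real.sin_arcsin (by linarith) (by linarith)
    have h2 := Real.sin_sub (θ + Real.arcsin (y / p.radius x)) θ
    rw [add_sub_cancel_left, h1] at h2
    calc _ = p.radius x * (Real.sin (θ + Real.arcsin (y / p.radius x)) * Real.cos θ -
          Real.cos (θ + Real.arcsin (y / p.radius x)) * Real.sin θ) := by ring
      _ = p.radius x * (y / p.radius x) := by rw [← h2]
      _ = y := hyq

theorem le_surfaceArea_surf : ENNReal.ofReal (p.ρ ^ 2 / 64) ≤ surfaceArea p.surf := by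
  have hρ := p.ρ_pos
  have hw8 := p.ρw_le
  have h := p.le_surfaceArea_cell (a := -(3 / 2 * p.ρ)) (b := -(p.ρ / 2)) (θ := 0)
    (δ := Real.pi / 2) (m := p.ρ / 4) (by linarith) (by linarith) (by linarith)
    (by positivity) le_rfl ?_
  · refine le_trans (ENNReal.ofReal_le_ofReal (le_of_eq ?_)) (h.trans (measure_mono
      (p.cell_subset_surf (by linarith) (by linarith))))
    ring
  · intro x hx
    have h1 := hx.1
    have h2 := hx.2
    rw [Real.sin_pi_div_two, mul_one]
    refine abs_le_of_sq_le_sq (a := p.ρ / 4) ?_ (p.radius_nonneg x) |> fun h => (abs_le.1 h).2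
    rw [p.sq_radius_of_le (by linarith) (by linarith)]
    nlinarith [mul_nonneg (sub_nonneg.2 h1) (sub_nonneg.2 h2)]

theorem le_surfaceArea_middle :
    ENNReal.ofReal (p.ε / 16) ≤ surfaceArea (p.surf ∩ {X | 1 ≤ X 0 ∧ X 0 ≤ 2}) := by
  have hρ := p.ρ_pos
  have hw := p.ρw_pos
  have h := p.le_surfaceArea_cell (a := 1) (b := 2) (θ := 0)
    (δ := Real.pi / 2) (m := p.ε) (by linarith) (by linarith) (by linarith)
    (by positivity) le_rfl ?_
  · refine le_trans (ENNReal.ofReal_le_ofReal (le_of_eq ?_)) (h.trans (measure_mono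
      (Set.subset_inter (p.cell_subset_surf (by linarith) (by linarith)) ?_)))
    · ring
    · rintro X ⟨⟨x, t⟩, ⟨hx, -⟩, rfl⟩
      exact hx
  · intro x hx
    have h2 := hx.2
    rw [Real.sin_pi_div_two, mul_one, p.radius_of_ge (by linarith [hx.1])]
    have : 1 ≤ √(3 - x) := by
      rw [Real.one_le_sqrt]; linarith
    nlinarith [p.ε_pos]

theorem surfaceArea_surf_lt_top : surfaceArea p.surf < ⊤ := by
  have hρ := p.ρ_pos
  have hw := p.ρw_pos
  have hsub : p.surf ⊆
      (p.surf ∩ {X | p.ρ * (Real.cos Real.pi - 1) ≤ X 0 ∧ X 0 ≤ p.ρ * (Real.cos 0 - 1) ∧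
      X 0 ≤ -(2 * (p.ρ * p.w))}) ∪
      (p.surf ∩ {X | -(2 * (p.ρ * p.w)) ≤ X 0 ∧ X 0 ≤ -(p.ρ * p.w)}) ∪
      (p.surf ∩ {X | -(p.ρ * p.w) ≤ X 0 ∧ 0 ≤ √(3 - X 0) ∧ √(3 - X 0) ≤ 2}) := by
    intro X hX
    rcases le_total (X 0) (-(2 * (p.ρ * p.w))) with h1 | h1
    · refine Or.inl (Or.inl ⟨hX, ?_, ?_, h1⟩)
      · rw [Real.cos_pi]; linarith [hX.1]
      · rw [Real.cos_zero]; linarith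
    · rcases le_total (X 0) (-(p.ρ * p.w)) with h2 | h2
      · exact Or.inl (Or.inr ⟨hX, h1, h2⟩)
      · refine Or.inr ⟨hX, h2, Real.sqrt_nonneg _, ?_⟩
        rw [Real.sqrt_le_left (by norm_num)]
        linarith [p.ρ_le, p.ρw_le]
  refine (measure_mono hsub).trans_lt ((measure_union_le _ _).trans_lt (ENNReal.add_lt_top.2
    ⟨(measure_union_le _ _).trans_lt (ENNReal.add_lt_top.2 ⟨?_, ?_⟩), ?_⟩))
  · exact (p.surfaceArea_body_le le_rfl Real.pi_pos.le le_rfl).trans_lt ENNReal.ofReal_lt_top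
  · exact p.surfaceArea_transition_le.trans_lt ENNReal.ofReal_lt_top
  · exact (p.surfaceArea_tail_le le_rfl (by norm_num) le_rfl).trans_lt ENNReal.ofReal_lt_top

theorem surfaceArea_surf_pos : 0 < surfaceArea p.surf :=
  lt_of_lt_of_le (ENNReal.ofReal_pos.2 (by have := p.ρ_pos; positivity)) p.le_surfaceArea_surf

end TubeParams

end SurfaceAreaBounds

/-! ### Probabilities of the regions under the uniform distribution -/

section UniformMeasure

theorem isProbabilityMeasure_uniformOnSurface {S : Set E3} (h0 : 0 < surfaceArea S)
    (h1 : surfaceArea S < ⊤) : IsProbabilityMeasure (uniformOnSurface S) := by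
  refine ⟨?_⟩
  rw [uniformOnSurface, Measure.smul_apply, Measure.restrict_apply MeasurableSet.univ,
    Set.univ_inter, smul_eq_mul, ENNReal.inv_mul_cancel h0.ne' h1.ne]

theorem nullSingletonClass_uniformOnSurface (S : Set E3) :
    NullSingletonClass (uniformOnSurface S) := by
  have : NullSingletonClass surfaceArea :=
    Measure.nullSingletonClass_hausdorff E3 (by norm_num : (0 : ℝ) < 2)
  refine ⟨fun x => ?_⟩
  rw [uniformOnSurface, Measure.smul_apply,
    Measure.restrict_apply (measurableSet_singleton x), smul_eq_mul]
  have : surfaceArea ({x} ∩ S) = 0 := measure_mono_null Set.inter_subset_left (measure_singleton x)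
  rw [this, mul_zero]

theorem uniformOnSurface_compl {S : Set E3} (hS : MeasurableSet S) :
    uniformOnSurface S Sᶜ = 0 := by
  rw [uniformOnSurface, Measure.smul_apply, Measure.restrict_apply hS.compl]
  simp

theorem uniformOnSurface_real {S R : Set E3} (hR : MeasurableSet R) :
    (uniformOnSurface S).real R = (surfaceArea (S ∩ R)).toReal / (surfaceArea S).toReal := by
  rw [measureReal_def, uniformOnSurface, Measure.smul_apply, Measure.restrict_apply hR, smul_eq_mul,
    ENNReal.toReal_mul, ENNReal.toReal_inv, Set.inter_comm]
  field_simp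

namespace TubeParams

variable (p : TubeParams)

instance isProbabilityMeasure : IsProbabilityMeasure (uniformOnSurface p.surf) :=
  isProbabilityMeasure_uniformOnSurface p.surfaceArea_surf_pos p.surfaceArea_surf_lt_top

theorem real_le_of_surfaceArea_le {R : Set E3} (hR : MeasurableSet R) {A : ℝ} (hA : 0 ≤ A)
    (h : surfaceArea (p.surf ∩ R) ≤ ENNReal.ofReal A) :
    (uniformOnSurface p.surf).real R ≤ 64 * A / p.ρ ^ 2 := by
  have hρ := p.ρ_pos
  rw [uniformOnSurface_real hR]
  have h1 : (surfaceArea (p.surf ∩ R)).toReal ≤ A := ENNReal.toReal_le_of_le_ofReal hA h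
  have h2 : p.ρ ^ 2 / 64 ≤ (surfaceArea p.surf).toReal :=
    (ENNReal.ofReal_le_iff_le_toReal p.surfaceArea_surf_lt_top.ne).1 p.le_surfaceArea_surf
  calc _ ≤ A / (p.ρ ^ 2 / 64) := by gcongr
    _ = _ := by field_simp

/-- With `ε ≤ ρ ^ 2` the tail has no more area than the body, up to a constant; then the total area
has order exactly `ρ ^ 2` and areas convert to probabilities both ways. -/
theorem surfaceArea_surf_le (hε : p.ε ≤ p.ρ ^ 2) :
    surfaceArea p.surf ≤ ENNReal.ofReal (12000 * lipConst * p.ρ ^ 2) := by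
  have hρ := p.ρ_pos
  have hε0 := p.ε_pos
  have hw := p.ρw_pos
  have hL := one_le_lipConst
  have hsub : p.surf ⊆
      (p.surf ∩ {X | p.ρ * (Real.cos Real.pi - 1) ≤ X 0 ∧ X 0 ≤ p.ρ * (Real.cos 0 - 1) ∧
      X 0 ≤ -(2 * (p.ρ * p.w))}) ∪
      (p.surf ∩ {X | -(2 * (p.ρ * p.w)) ≤ X 0 ∧ X 0 ≤ -(p.ρ * p.w)}) ∪
      (p.surf ∩ {X | -(p.ρ * p.w) ≤ X 0 ∧ 0 ≤ √(3 - X 0) ∧ √(3 - X 0) ≤ 2}) := by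
    intro X hX
    rcases le_total (X 0) (-(2 * (p.ρ * p.w))) with h1 | h1
    · refine Or.inl (Or.inl ⟨hX, ?_, ?_, h1⟩)
      · rw [Real.cos_pi]; linarith [hX.1]
      · rw [Real.cos_zero]; linarith
    · rcases le_total (X 0) (-(p.ρ * p.w)) with h2 | h2
      · exact Or.inl (Or.inr ⟨hX, h1, h2⟩)
      · refine Or.inr ⟨hX, h2, Real.sqrt_nonneg _, ?_⟩
        rw [Real.sqrt_le_left (by norm_num)]
        linarith [p.ρ_le, p.ρw_le]
  refine (measure_mono hsub).trans ((measure_union_le _ _).trans ((add_le_add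
    ((measure_union_le _ _).trans (add_le_add
    (p.surfaceArea_body_le le_rfl Real.pi_pos.le le_rfl) p.surfaceArea_transition_le))
    (p.surfaceArea_tail_le le_rfl (by norm_num) le_rfl)).trans ?_))
  have hpi := Real.pi_pos
  have hw0 := p.w_pos
  rw [← ENNReal.ofReal_add (by simp; positivity) (by positivity),
    ← ENNReal.ofReal_add (by simp; positivity) (by positivity)]
  apply ENNReal.ofReal_le_ofReal
  have h1 : p.ρ ^ 2 * Real.pi ≤ p.ρ ^ 2 * 3.15 := by
    gcongr; exact Real.pi_lt_d2.le
  have h2 : lipConst * p.ρ ^ 2 * p.w ≤ lipConst * p.ρ ^ 2 * (1 / 8) := by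
    gcongr; exact p.w_le
  have h3 : 1 * p.ρ ^ 2 ≤ lipConst * p.ρ ^ 2 := by gcongr
  nlinarith

theorem le_real_of_le_surfaceArea (hε : p.ε ≤ p.ρ ^ 2) {R : Set E3} (hR : MeasurableSet R) {A : ℝ}
    (h : ENNReal.ofReal A ≤ surfaceArea (p.surf ∩ R)) :
    A / (12000 * lipConst * p.ρ ^ 2) ≤ (uniformOnSurface p.surf).real R := by
  have hρ := p.ρ_pos
  have hL := one_le_lipConst
  rw [uniformOnSurface_real hR]
  have hne : surfaceArea (p.surf ∩ R) ≠ ⊤ :=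
    ((measure_mono Set.inter_subset_left).trans_lt p.surfaceArea_surf_lt_top).ne
  have h1 : A ≤ (surfaceArea (p.surf ∩ R)).toReal := (ENNReal.ofReal_le_iff_le_toReal hne).1 h
  have h2 : (surfaceArea p.surf).toReal ≤ 12000 * lipConst * p.ρ ^ 2 :=
    ENNReal.toReal_le_of_le_ofReal (by positivity) (p.surfaceArea_surf_le hε)
  have h3 : 0 < (surfaceArea p.surf).toReal :=
    ENNReal.toReal_pos p.surfaceArea_surf_pos.ne' p.surfaceArea_surf_lt_top.ne
  gcongr

theorem measurable_coord (i : Fin 3) : Measurable (fun X : E3 => X i) := by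
  have : Continuous (fun X : E3 => X i) := by fun_prop
  exact this.measurable

/-- The part of the body with polar angle in `[a, b]`. -/
def zone (a b : ℝ) : Set E3 :=
  {X | p.ρ * (Real.cos b - 1) ≤ X 0 ∧ X 0 ≤ p.ρ * (Real.cos a - 1) ∧ X 0 ≤ -(2 * (p.ρ * p.w))}

theorem measurableSet_zone (a b : ℝ) : MeasurableSet (p.zone a b) := by
  have h := measurable_coord 0
  exact (measurableSet_le measurable_const h).inter
    ((measurableSet_le h measurable_const).inter (measurableSet_le h measurable_const))

theorem real_zone_le {a b : ℝ} (ha : 0 ≤ a) (hab : a ≤ b) (hb : b ≤ Real.pi) :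
    (uniformOnSurface p.surf).real (p.zone a b) ≤ 25600 * (b - a) := by
  have hρ := p.ρ_pos
  have h0 : 0 ≤ b - a := by linarith
  refine (p.real_le_of_surfaceArea_le (p.measurableSet_zone a b) (by positivity)
    (p.surfaceArea_body_le ha hab hb)).trans (le_of_eq ?_)
  field_simp
  ring

/-- The part of the tail with abscissa at least `τ` and parameter `√(3 - x)` in `[a, b]`. -/
def tailPart (τ a b : ℝ) : Set E3 :=
  {X | τ ≤ X 0 ∧ a ≤ √(3 - X 0) ∧ √(3 - X 0) ≤ b}

theorem measurableSet_tailPart (τ a b : ℝ) : MeasurableSet (tailPart τ a b) := by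
  have h := measurable_coord 0
  have h2 : Measurable (fun X : E3 => √(3 - X 0)) := (h.const_sub 3).sqrt
  exact (measurableSet_le measurable_const h).inter
    ((measurableSet_le measurable_const h2).inter (measurableSet_le h2 measurable_const))

theorem real_tailPart_le {τ a b : ℝ} (hτ : -(p.ρ * p.w) ≤ τ) (ha : 0 ≤ a) (hab : a ≤ b)
    (hb : b ≤ 2) :
    (uniformOnSurface p.surf).real (tailPart τ a b) ≤ 204800 * (b - a) * (p.ε / p.ρ ^ 2) := by
  have hρ := p.ρ_pos
  have hε := p.ε_pos
  have h0 : 0 ≤ b - a := by linarith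
  have hsub : p.surf ∩ tailPart τ a b ⊆
      p.surf ∩ {X | -(p.ρ * p.w) ≤ X 0 ∧ a ≤ √(3 - X 0) ∧ √(3 - X 0) ≤ b} :=
    fun X hX => ⟨hX.1, hτ.trans hX.2.1, hX.2.2⟩
  refine (p.real_le_of_surfaceArea_le (measurableSet_tailPart τ a b) (by positivity)
    ((measure_mono hsub).trans (p.surfaceArea_tail_le ha hab hb))).trans (le_of_eq ?_)
  field_simp
  ring

/-- The part of the surface between the body and the tail. -/
def joint (τ : ℝ) : Set E3 := {X | -(2 * (p.ρ * p.w)) < X 0 ∧ X 0 < τ}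

theorem measurableSet_joint (τ : ℝ) : MeasurableSet (p.joint τ) := by
  have h := measurable_coord 0
  exact (measurableSet_lt measurable_const h).inter (measurableSet_lt h measurable_const)

/-- The joint consists of the transition and an initial stretch of the tail of length `ρ * w + τ`.
It matters that this is small, since nothing limits the edges at its points. -/
theorem real_joint_le {τ : ℝ} (hτ : 0 ≤ τ) (hτ1 : τ ≤ 1) :
    (uniformOnSurface p.surf).real (p.joint τ) ≤
      1228800 * lipConst * p.w + 204800 * (p.ρ * p.w + τ) * (p.ε / p.ρ ^ 2) := by
  have hρ := p.ρ_pos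
  have hρ1 := p.ρ_le
  have hε := p.ε_pos
  have hw := p.w_pos
  have hρw := p.ρw_pos
  have hρw8 := p.ρw_le
  have hL := one_le_lipConst
  have hab : √(3 - τ) ≤ √(3 + p.ρ * p.w) := Real.sqrt_le_sqrt (by linarith)
  have hab2 : √(3 + p.ρ * p.w) - √(3 - τ) ≤ p.ρ * p.w + τ := by
    have h1 : 1 ≤ √(3 - τ) := by rw [Real.one_le_sqrt]; linarith
    have h2 := Real.mul_self_sqrt (by linarith : 0 ≤ 3 - τ)
    have h3 := Real.mul_self_sqrt (by linarith : 0 ≤ 3 + p.ρ * p.w)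
    nlinarith
  have hsub : p.surf ∩ p.joint τ ⊆
      (p.surf ∩ {X | -(2 * (p.ρ * p.w)) ≤ X 0 ∧ X 0 ≤ -(p.ρ * p.w)}) ∪
      (p.surf ∩ {X | -(p.ρ * p.w) ≤ X 0 ∧ √(3 - τ) ≤ √(3 - X 0) ∧
        √(3 - X 0) ≤ √(3 + p.ρ * p.w)}) := by
    rintro X ⟨hX, h1, h2⟩
    rcases le_total (X 0) (-(p.ρ * p.w)) with h | h
    · exact Or.inl ⟨hX, h1.le, h⟩
    · exact Or.inr ⟨hX, h, Real.sqrt_le_sqrt (by linarith), Real.sqrt_le_sqrt (by linarith)⟩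
  have harea : surfaceArea (p.surf ∩ p.joint τ) ≤ ENNReal.ofReal
      (19200 * lipConst * (p.ρ ^ 2 * p.w) + 400 * (4 * (p.ρ * p.w + τ) * (2 * p.ε))) := by
    refine (measure_mono hsub).trans ((measure_union_le _ _).trans ((add_le_add
      p.surfaceArea_transition_le (p.surfaceArea_tail_le (Real.sqrt_nonneg _) hab ?_)).trans ?_))
    · rw [Real.sqrt_le_left (by norm_num)]; linarith
    · have : 0 ≤ √(3 + p.ρ * p.w) - √(3 - τ) := by linarith
      rw [← ENNReal.ofReal_add (by positivity) (by positivity)]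
      apply ENNReal.ofReal_le_ofReal
      gcongr
  refine (p.real_le_of_surfaceArea_le (p.measurableSet_joint τ) (by positivity) harea).trans
    (le_of_eq ?_)
  field_simp
  ring

/-- The points with abscissa in `[1, 2]`. -/
def middle : Set E3 := {X | 1 ≤ X 0 ∧ X 0 ≤ 2}

theorem measurableSet_middle : MeasurableSet middle := by
  have h := measurable_coord 0
  exact (measurableSet_le measurable_const h).inter (measurableSet_le h measurable_const)

theorem le_real_middle (hε : p.ε ≤ p.ρ ^ 2) :
    p.ε / p.ρ ^ 2 / (192000 * lipConst) ≤ (uniformOnSurface p.surf).real middle := by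
  have hρ := p.ρ_pos
  have hε0 := p.ε_pos
  refine le_trans (le_of_eq ?_) (p.le_real_of_le_surfaceArea hε measurableSet_middle
    p.le_surfaceArea_middle)
  have := one_le_lipConst
  field_simp
  norm_num

end TubeParams

end UniformMeasure

/-! ### Spheres as zero sets of quadratic functions -/

section EmptySpheres

/-- A quadratic function vanishing on a sphere (for `κ > 0`). -/
def sphereFun (κ α β γ c : ℝ) (X : E3) : ℝ :=
  κ * (X 0 ^ 2 + X 1 ^ 2 + X 2 ^ 2) + α * X 0 + β * X 1 + γ * X 2 + c

theorem exists_sphereFun_of_adj {P : Set E3} {p q : E3} (h : (delaunayGraph P).Adj p q) :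
    ∃ α β γ c, sphereFun 1 α β γ c p = 0 ∧ sphereFun 1 α β γ c q = 0 ∧
      ∀ s ∈ P, 0 ≤ sphereFun 1 α β γ c s := by
  obtain ⟨-, -, -, z, r, hp, hq, hP⟩ := h
  have hr : 0 ≤ r := by rw [← Metric.mem_sphere.1 hp]; exact dist_nonneg
  have key : ∀ X : E3, sphereFun 1 (-2 * z 0) (-2 * z 1) (-2 * z 2)
      (z 0 ^ 2 + z 1 ^ 2 + z 2 ^ 2 - r ^ 2) X = dist X z ^ 2 - r ^ 2 := by
    intro X
    rw [sq_dist_E3, sphereFun]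
    ring
  refine ⟨_, _, _, _, (key p).trans ?_, (key q).trans ?_, fun s hs => ?_⟩
  · rw [Metric.mem_sphere.1 hp, sub_self]
  · rw [Metric.mem_sphere.1 hq, sub_self]
  · rw [key]
    have := hP s hs
    rw [Metric.mem_ball, not_lt] at this
    have := pow_le_pow_left₀ hr this 2
    linarith

/-- Complete the square and divide by `κ`. A free leading coefficient lets the equation be matched
with a prescribed quartic on the axis. -/
theorem adj_of_sphereFun {P : Set E3} {p q : E3} (hpq : p ≠ q) (hp : p ∈ P) (hq : q ∈ P)
    {κ α β γ c : ℝ} (hκ : 0 < κ) (h1 : sphereFun κ α β γ c p = 0)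
    (h2 : sphereFun κ α β γ c q = 0) (h3 : ∀ s ∈ P, 0 ≤ sphereFun κ α β γ c s) :
    (delaunayGraph P).Adj p q := by
  set z : E3 := pt (-α / (2 * κ)) (-β / (2 * κ)) (-γ / (2 * κ)) with hz
  have key : ∀ X : E3, dist X z ^ 2 - dist p z ^ 2 =
      (sphereFun κ α β γ c X - sphereFun κ α β γ c p) / κ := by
    intro X
    rw [sq_dist_E3, sq_dist_E3, sphereFun, sphereFun, hz, pt_zero, pt_one, pt_two]
    field_simp
    ring
  refine ⟨hpq, hp, hq, z, dist p z, rfl, ?_, fun s hs => ?_⟩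
  · have := key q
    rw [h1, h2, sub_zero, zero_div, sub_eq_zero] at this
    exact (pow_left_inj₀ dist_nonneg dist_nonneg two_ne_zero).1 this
  · rw [Metric.mem_ball, not_lt]
    have := key s
    rw [h1, sub_zero] at this
    have h4 : 0 ≤ sphereFun κ α β γ c s / κ := div_nonneg (h3 s hs) hκ.le
    exact (pow_le_pow_iff_left₀ dist_nonneg dist_nonneg two_ne_zero).1 (by linarith)

/-- Two nearest distinct points of a finite set are Delaunay neighbours. -/
theorem exists_adj_of_finite {P : Set E3} (hP : P.Finite) {a b : E3} (ha : a ∈ P) (hb : b ∈ P)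
    (hab : a ≠ b) : ∃ p q, (delaunayGraph P).Adj p q := by
  obtain ⟨⟨p, q⟩, ⟨⟨hp, hq⟩, hpq⟩, hmin⟩ := Set.exists_min_image
    ((P ×ˢ P) ∩ {x | x.1 ≠ x.2}) (fun x => dist x.1 x.2)
    ((hP.prod hP).subset Set.inter_subset_left) ⟨(a, b), ⟨ha, hb⟩, hab⟩
  refine ⟨p, q, hpq, hp, hq, midpoint ℝ p q, dist p q / 2, ?_, ?_, fun s hs hsb => ?_⟩
  · rw [Metric.mem_sphere, dist_left_midpoint, Real.norm_ofNat]; ring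
  · rw [Metric.mem_sphere, dist_right_midpoint, Real.norm_ofNat]; ring
  · rw [Metric.mem_ball] at hsb
    have hd : dist p (midpoint ℝ p q) = dist p q / 2 := by
      rw [dist_left_midpoint, Real.norm_ofNat]; ring
    by_cases hsp : s = p
    · rw [hsp, hd] at hsb
      exact lt_irrefl _ hsb
    · have h1 : dist p q ≤ dist s p := hmin (s, p) ⟨⟨hs, hp⟩, hsp⟩
      have h2 := dist_triangle s (midpoint ℝ p q) p
      rw [dist_comm (midpoint ℝ p q) p, hd] at h2
      linarith

/-- Among `J` equal sectors, one contains the direction of `-(β, γ)`, and every angle of that sector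
differs from it by at most `2π / J`. The sector can thus be selected after the sphere, although the
sectors themselves are fixed. -/
theorem exists_direction (β γ : ℝ) {J : ℕ} (hJ : 2 ≤ J) :
    ∃ j < J, ∀ θ ∈ Set.Icc (2 * Real.pi / J * j) (2 * Real.pi / J * j + 2 * Real.pi / J),
      β * Real.cos θ + γ * Real.sin θ ≤ -(√(β ^ 2 + γ ^ 2) * Real.cos (2 * Real.pi / J)) := by
  have hJ0 : (0 : ℝ) < J := by
    have : 0 < J := by omega
    exact_mod_cast this
  have hpi := Real.pi_pos
  set z : ℂ := ⟨-β, -γ⟩ with hz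
  have hn : ‖z‖ = √(β ^ 2 + γ ^ 2) := by
    rw [Complex.norm_def, Complex.normSq_apply]
    congr 1
    simp only [hz]
    ring
  obtain ⟨φ, ⟨hφ0, hφ1⟩, hc, hs⟩ := exists_mem_Ico_cos_sin z.arg
  have h1 : √(β ^ 2 + γ ^ 2) * Real.cos φ = -β := by
    rw [hc, ← hn, Complex.norm_mul_cos_arg]
  have h2 : √(β ^ 2 + γ ^ 2) * Real.sin φ = -γ := by
    rw [hs, ← hn, Complex.norm_mul_sin_arg]
  have hd : 0 < 2 * Real.pi / J := by positivity
  have hq0 : 0 ≤ φ / (2 * Real.pi / J) := div_nonneg hφ0 hd.le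
  refine ⟨⌊φ / (2 * Real.pi / J)⌋₊, ?_, fun θ hθ => ?_⟩
  · rw [Nat.floor_lt hq0, div_lt_iff₀ hd]
    calc φ < 2 * Real.pi := hφ1
      _ = _ := by field_simp
  · have k1 := Nat.floor_le hq0
    have k2 := Nat.lt_floor_add_one (φ / (2 * Real.pi / J))
    rw [le_div_iff₀ hd] at k1
    rw [div_lt_iff₀ hd] at k2
    have hle : |θ - φ| ≤ 2 * Real.pi / J := by
      rw [abs_le]
      constructor <;> nlinarith [hθ.1, hθ.2]
    have hpi2 : 2 * Real.pi / J ≤ Real.pi := by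
      rw [div_le_iff₀ hJ0]
      have : (2 : ℝ) ≤ J := by exact_mod_cast hJ
      nlinarith
    have hcos : Real.cos (2 * Real.pi / J) ≤ Real.cos (θ - φ) := by
      rw [← Real.cos_abs (θ - φ)]
      exact Real.cos_le_cos_of_nonneg_of_le_pi (abs_nonneg _) hpi2 hle
    rw [Real.cos_sub] at hcos
    have := mul_le_mul_of_nonneg_left hcos (Real.sqrt_nonneg (β ^ 2 + γ ^ 2))
    linear_combination this + Real.cos θ * h1 + Real.sin θ * h2

theorem abs_mul_add_mul_le (β γ u v : ℝ) :
    |β * u + γ * v| ≤ √(β ^ 2 + γ ^ 2) * √(u ^ 2 + v ^ 2) := by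
  rw [← Real.sqrt_mul (by positivity)]
  apply Real.abs_le_sqrt
  nlinarith [sq_nonneg (β * v - γ * u)]

end EmptySpheres

/-! ### Which pairs of points of the surface lie on empty spheres -/

namespace TubeParams

variable (p : TubeParams)

theorem radius_le (x : ℝ) (h0 : -(2 * p.ρ) ≤ x) : p.radius x ≤ p.ρ := by
  have hρ := p.ρ_pos
  have hρ1 := p.ρ_le
  have hε := p.ε_pos
  have hw := p.ρw_le
  have hε1 := p.ε_le
  have hs0 := p.cut_nonneg x
  have hs1 := p.cut_le_one x
  have h1 : √(-x * (x + 2 * p.ρ)) / 2 ≤ p.ρ := by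
    have : √(-x * (x + 2 * p.ρ)) ≤ p.ρ := by
      rw [Real.sqrt_le_left hρ.le]; nlinarith [sq_nonneg (x + p.ρ)]
    linarith
  have h2 : p.ε * √(3 - x) ≤ p.ρ := by
    have : √(3 - x) ≤ 2 := by
      rw [Real.sqrt_le_left (by norm_num)]; linarith
    nlinarith
  unfold radius
  nlinarith

theorem abs_sub_axis_le {X : E3} (hX : X ∈ p.surf) :
    |X 1 - p.axis₁ (X 0)| ≤ p.ρ ∧ |X 2 - p.axis₂ (X 0)| ≤ p.ρ := by
  have h1 := p.radius_le (X 0) hX.1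
  have h2 := p.radius_nonneg (X 0)
  have h3 := hX.2.2
  constructor
  · refine (abs_le_of_sq_le_sq ?_ h2).trans h1
    rw [← h3]; nlinarith [sq_nonneg (X 2 - p.axis₂ (X 0))]
  · refine (abs_le_of_sq_le_sq ?_ h2).trans h1
    rw [← h3]; nlinarith [sq_nonneg (X 1 - p.axis₁ (X 0))]

theorem abs_axis_le {x : ℝ} (hx : x ∈ Set.Icc (-1 : ℝ) 3) :
    |p.axis₁ x| ≤ 81 * p.η ∧ |p.axis₂ x| ≤ 81 * p.η := by
  have hη := p.η_pos
  have hs0 := Real.smoothTransition.nonneg x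
  have hs1 := Real.smoothTransition.le_one x
  have hx3 : |x| ≤ 3 := by rw [abs_le]; constructor <;> linarith [hx.1, hx.2]
  have key : ∀ k : ℕ, k ≤ 4 → |p.η * (Real.smoothTransition x * x ^ k)| ≤ 81 * p.η := by
    intro k hk
    rw [abs_mul, abs_mul, abs_of_pos hη, abs_of_nonneg hs0, abs_pow]
    have h1 : |x| ^ k ≤ 81 := calc
      |x| ^ k ≤ 3 ^ k := pow_le_pow_left₀ (abs_nonneg _) hx3 k
      _ ≤ 3 ^ 4 := pow_le_pow_right₀ (by norm_num) hk
      _ = 81 := by norm_num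
    have h2 : Real.smoothTransition x * |x| ^ k ≤ 1 * 81 :=
      mul_le_mul hs1 h1 (by positivity) zero_le_one
    nlinarith
  exact ⟨key 3 (by norm_num), key 4 (by norm_num)⟩

theorem coord_mem_Icc {X : E3} (hX : X ∈ p.surf) : X 0 ∈ Set.Icc (-1 : ℝ) 3 :=
  ⟨by linarith [hX.1, p.ρ_le], hX.2.1⟩

theorem abs_coord_le {X : E3} (hX : X ∈ p.surf) :
    |X 1| ≤ 81 * p.η + p.ρ ∧ |X 2| ≤ 81 * p.η + p.ρ := by
  obtain ⟨h1, h2⟩ := p.abs_sub_axis_le hX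
  obtain ⟨h3, h4⟩ := p.abs_axis_le (p.coord_mem_Icc hX)
  constructor
  · have := abs_add_le (X 1 - p.axis₁ (X 0)) (p.axis₁ (X 0))
    rw [sub_add_cancel] at this
    linarith
  · have := abs_add_le (X 2 - p.axis₂ (X 0)) (p.axis₂ (X 0))
    rw [sub_add_cancel] at this
    linarith

theorem sq_add_sq_of_body {X : E3} (hX : X ∈ p.surf) (h : X 0 ≤ -(2 * (p.ρ * p.w))) :
    X 1 ^ 2 + X 2 ^ 2 = -X 0 * (X 0 + 2 * p.ρ) / 4 := by
  have hw := p.ρw_pos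
  have := hX.2.2
  rw [p.sq_radius_of_le hX.1 h, p.axis₁_of_nonpos (by linarith), p.axis₂_of_nonpos (by linarith),
    sub_zero, sub_zero] at this
  exact this

set_option maxHeartbeats 1000000 in
/-- A sphere through two points of the body contains the points of the body that lie between
them and in the right direction. -/
theorem sphereFun_neg_of_body {P Q : E3} (hP : P ∈ p.surf) (hQ : Q ∈ p.surf)
    (hQ0 : Q 0 ≤ -(2 * (p.ρ * p.w))) {x θ : ℝ} (hPx : P 0 < x) (hxQ : x < Q 0) {α β γ c k : ℝ}
    (h1 : sphereFun 1 α β γ c P = 0) (h2 : sphereFun 1 α β γ c Q = 0) (hk : 0 ≤ k)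
    (hD : p.ρ ^ 2 * (1 - k ^ 2) ≤ (x - P 0) * (Q 0 - x))
    (hdir : β * Real.cos θ + γ * Real.sin θ ≤ -(√(β ^ 2 + γ ^ 2) * k)) :
    sphereFun 1 α β γ c (p.param x θ) < 0 := by
  have hρ := p.ρ_pos
  have hw := p.ρw_pos
  have hxl : x ≤ -(2 * (p.ρ * p.w)) := by linarith
  have hx0 : -(2 * p.ρ) ≤ x := by linarith [hP.1]
  have eP := p.sq_add_sq_of_body hP (by linarith)
  have eQ := p.sq_add_sq_of_body hQ hQ0
  set r := p.radius x with hr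
  have hr0 : 0 ≤ r := p.radius_nonneg x
  have er : r ^ 2 = -x * (x + 2 * p.ρ) / 4 := p.sq_radius_of_le hx0 hxl
  set B := √(β ^ 2 + γ ^ 2) with hB
  have hB0 : 0 ≤ B := Real.sqrt_nonneg _
  set u := Q 0 - x with hu
  set t := x - P 0 with ht
  have hu0 : 0 < u := by linarith
  have ht0 : 0 < t := by linarith
  have eS : sphereFun 1 α β γ c (p.param x θ) =
      x ^ 2 + r ^ 2 + α * x + r * (β * Real.cos θ + γ * Real.sin θ) + c := by
    simp only [sphereFun, param, pt_zero, pt_one, pt_two, p.axis₁_of_nonpos (by linarith : x ≤ 0),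
      p.axis₂_of_nonpos (by linarith : x ≤ 0), ← hr]
    linear_combination r ^ 2 * Real.sin_sq_add_cos_sq θ
  -- Compare with the point of the chord `PQ` at abscissa `x`: up to the factor `u + t`, its lateral
  -- part is this combination with weights `u` and `t`.
  have hCS := abs_mul_add_mul_le β γ (u * P 1 + t * Q 1) (u * P 2 + t * Q 2)
  rw [← hB] at hCS
  have hroot : √((u * P 1 + t * Q 1) ^ 2 + (u * P 2 + t * Q 2) ^ 2) ≤ (u + t) * (r * k) := by
    rw [Real.sqrt_le_left (by positivity)]
    have e1 : (u * P 1 + t * Q 1) ^ 2 + (u * P 2 + t * Q 2) ^ 2 =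
        (u + t) * (u * (P 1 ^ 2 + P 2 ^ 2) + t * (Q 1 ^ 2 + Q 2 ^ 2)) -
        u * t * ((P 1 - Q 1) ^ 2 + (P 2 - Q 2) ^ 2) := by ring
    -- The squared radius of the ellipsoid is quadratic in the abscissa with leading coefficient `-1
    -- / 4`; interpolating it loses exactly `u * t / 4`, which pays for the angular factor `k`
    -- through `hD`.
    have e2 : u * (P 1 ^ 2 + P 2 ^ 2) + t * (Q 1 ^ 2 + Q 2 ^ 2) = (u + t) * (r ^ 2 - u * t / 4) := by
      rw [eP, eQ, er, hu, ht]; ring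
    have e3 : 0 ≤ u * t * ((P 1 - Q 1) ^ 2 + (P 2 - Q 2) ^ 2) := by positivity
    have e4 : r ^ 2 * (1 - k ^ 2) ≤ u * t / 4 := by
      rcases le_total 0 (1 - k ^ 2) with h | h
      · have h3 : r ^ 2 ≤ p.ρ ^ 2 / 4 := by rw [er]; linarith [sq_nonneg (x + p.ρ)]
        have h4 := mul_le_mul_of_nonneg_right h3 h
        linarith
      · have h3 := mul_pos hu0 ht0
        have h4 := mul_nonpos_of_nonneg_of_nonpos (sq_nonneg r) h
        linarith
    have e5 : (u + t) ^ 2 * (r ^ 2 - u * t / 4) ≤ (u + t) ^ 2 * (r ^ 2 * k ^ 2) := by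
      gcongr; linarith
    rw [e1, e2]
    linear_combination e5 + e3
  have hlin : -(B * ((u + t) * (r * k))) ≤ u * (β * P 1 + γ * P 2) + t * (β * Q 1 + γ * Q 2) := by
    have h3 := (abs_le.1 (hCS.trans (mul_le_mul_of_nonneg_left hroot hB0))).1
    linarith
  have hS : r * (β * Real.cos θ + γ * Real.sin θ) ≤ -(r * (B * k)) := by
    have := mul_le_mul_of_nonneg_left hdir hr0
    linarith
  -- On the ellipsoid `x² + y² + z²` equals `3 / 4 * x²` plus a linear term. The factor `3 / 4` is
  -- the strict convexity due to the elongation; on a round sphere it would be zero.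
  have hsum : (u + t) * sphereFun 1 α β γ c (p.param x θ) =
      (u + t) * (r * (β * Real.cos θ + γ * Real.sin θ)) -
      (u * (β * P 1 + γ * P 2) + t * (β * Q 1 + γ * Q 2)) - 3 / 4 * ((u + t) * (u * t)) := by
    have hP' : sphereFun 1 α β γ c P = 1 * (P 0 ^ 2 + P 1 ^ 2 + P 2 ^ 2) + α * P 0 + β * P 1 +
      γ * P 2 + c := rfl
    have hQ' : sphereFun 1 α β γ c Q = 1 * (Q 0 ^ 2 + Q 1 ^ 2 + Q 2 ^ 2) + α * Q 0 + β * Q 1 +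
      γ * Q 2 + c := rfl
    rw [hP'] at h1
    rw [hQ'] at h2
    rw [eS, er]
    simp only [hu, ht]
    linear_combination (Q 0 - x) * h1 + (x - P 0) * h2 - (Q 0 - x) * eP - (x - P 0) * eQ
  have hneg : (u + t) * sphereFun 1 α β γ c (p.param x θ) < 0 := by
    rw [hsum]
    have h4 := mul_le_mul_of_nonneg_left hS (by linarith : 0 ≤ u + t)
    have h5 : 0 < (u + t) * (u * t) := by positivity
    linarith
  by_contra hcon
  push Not at hcon
  have := mul_nonneg (by linarith : 0 ≤ u + t) hcon
  linarith

/-- Tail and body lie within `e = 81 η + ρ` of the straight axis in each lateral coordinate. There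
`x² + α x + c`, nearly zero at `P` and `Q`, would be below `-τ g` at `S` unless the lateral gradient
`B` compensates through terms of size `B e`. This forces `B` to be large, while subtracting the
equations at `P` and `Q` bounds `α`. -/
theorem gradient_bounds_of_tail {P S Q : E3} (hP : P ∈ p.surf) (hS : S ∈ p.surf)
    (hQ : Q ∈ p.surf) (hP0 : P 0 ≤ 0) {τ g : ℝ} (hτ : 0 < τ)
    (hg : 0 < g) (hS0 : τ ≤ S 0) (hSQ : S 0 + g ≤ Q 0) {α β γ c : ℝ}
    (h1 : sphereFun 1 α β γ c P = 0) (h2 : sphereFun 1 α β γ c Q = 0)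
    (h3 : 0 ≤ sphereFun 1 α β γ c S) :
    τ * g ≤ 2 * (81 * p.η + p.ρ) ^ 2 + 4 * (√(β ^ 2 + γ ^ 2) * (81 * p.η + p.ρ)) ∧
    |α| * τ ≤ 10 + 2 * (81 * p.η + p.ρ) ^ 2 + 4 * (√(β ^ 2 + γ ^ 2) * (81 * p.η + p.ρ)) := by
  have hρ := p.ρ_pos
  have hρ1 := p.ρ_le
  have hη := p.η_pos
  set B := √(β ^ 2 + γ ^ 2) with hB
  have hB0 : 0 ≤ B := Real.sqrt_nonneg _
  set e := 81 * p.η + p.ρ with he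
  have he0 : 0 < e := by positivity
  have hβ : |β| ≤ B := Real.abs_le_sqrt (by linarith [sq_nonneg γ])
  have hγ : |γ| ≤ B := Real.abs_le_sqrt (by linarith [sq_nonneg β])
  have hlat : ∀ X ∈ p.surf, |β * X 1 + γ * X 2| ≤ 2 * (B * e) ∧ X 1 ^ 2 + X 2 ^ 2 ≤ 2 * e ^ 2 := by
    intro X hX
    obtain ⟨a1, a2⟩ := p.abs_coord_le hX
    constructor
    · refine (abs_add_le _ _).trans ?_
      rw [abs_mul, abs_mul]
      have b1 := mul_le_mul hβ a1 (abs_nonneg _) hB0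
      have b2 := mul_le_mul hγ a2 (abs_nonneg _) hB0
      linarith
    · have b1 := sq_le_sq' (by linarith [(abs_le.1 a1).1]) (abs_le.1 a1).2
      have b2 := sq_le_sq' (by linarith [(abs_le.1 a2).1]) (abs_le.1 a2).2
      linarith
  obtain ⟨lP, sP⟩ := hlat P hP
  obtain ⟨lS, sS⟩ := hlat S hS
  obtain ⟨lQ, sQ⟩ := hlat Q hQ
  have hP' : 1 * (P 0 ^ 2 + P 1 ^ 2 + P 2 ^ 2) + α * P 0 + β * P 1 + γ * P 2 + c = 0 := h1
  have hQ' : 1 * (Q 0 ^ 2 + Q 1 ^ 2 + Q 2 ^ 2) + α * Q 0 + β * Q 1 + γ * Q 2 + c = 0 := h2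
  have hS' : 0 ≤ 1 * (S 0 ^ 2 + S 1 ^ 2 + S 2 ^ 2) + α * S 0 + β * S 1 + γ * S 2 + c := h3
  have hQ3 := hQ.2.1
  have hPm : -1 ≤ P 0 := by linarith [hP.1]
  obtain ⟨u, hu⟩ : ∃ u, u = Q 0 - S 0 := ⟨_, rfl⟩
  obtain ⟨t, ht⟩ : ∃ t, t = S 0 - P 0 := ⟨_, rfl⟩
  have hu0 : g ≤ u := by linarith
  have ht0 : τ ≤ t := by linarith
  constructor
  · have hid : (u + t) * (1 * (S 0 ^ 2 + S 1 ^ 2 + S 2 ^ 2) + α * S 0 + β * S 1 + γ * S 2 + c) =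
        -((u + t) * (u * t)) + (u + t) * (S 1 ^ 2 + S 2 ^ 2) - u * (P 1 ^ 2 + P 2 ^ 2) -
        t * (Q 1 ^ 2 + Q 2 ^ 2) + (u + t) * (β * S 1 + γ * S 2) - u * (β * P 1 + γ * P 2) -
        t * (β * Q 1 + γ * Q 2) := by
      rw [hu, ht]
      linear_combination (Q 0 - S 0) * hP' + (S 0 - P 0) * hQ'
    have hge := mul_nonneg (by linarith : 0 ≤ u + t) hS'
    rw [hid] at hge
    have c1 := mul_le_mul_of_nonneg_left sS (by linarith : 0 ≤ u + t)
    have c2 := mul_nonneg (by linarith : 0 ≤ u) (by positivity : 0 ≤ P 1 ^ 2 + P 2 ^ 2)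
    have c3 := mul_nonneg (by linarith : 0 ≤ t) (by positivity : 0 ≤ Q 1 ^ 2 + Q 2 ^ 2)
    have c4 := mul_le_mul_of_nonneg_left (abs_le.1 lS).2 (by linarith : 0 ≤ u + t)
    have c5 := mul_le_mul_of_nonneg_left (abs_le.1 lP).1 (by linarith : 0 ≤ u)
    have c6 := mul_le_mul_of_nonneg_left (abs_le.1 lQ).1 (by linarith : 0 ≤ t)
    have c7 : (u + t) * (u * t) ≤ (u + t) * (2 * e ^ 2 + 4 * (B * e)) := by
      linear_combination hge + c1 + c2 + c3 + c4 + c5 + c6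
    have c8 : u * t ≤ 2 * e ^ 2 + 4 * (B * e) := le_of_mul_le_mul_left c7 (by linarith)
    have c9 : τ * g ≤ t * u := mul_le_mul ht0 hu0 hg.le (by linarith)
    linarith
  · have hid : (Q 0 - P 0) * α = -(Q 0 ^ 2 - P 0 ^ 2 + (Q 1 ^ 2 + Q 2 ^ 2) - (P 1 ^ 2 + P 2 ^ 2) +
        (β * Q 1 + γ * Q 2) - (β * P 1 + γ * P 2)) := by
      linear_combination hQ' - hP'
    have hQP : τ ≤ Q 0 - P 0 := by linarith
    have hQ0 : 0 ≤ Q 0 := by linarith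
    have d1 : (Q 0) ^ 2 ≤ 3 ^ 2 := pow_le_pow_left₀ hQ0 hQ3 2
    have d2 : (P 0) ^ 2 ≤ 1 ^ 2 := sq_le_sq' hPm (by linarith)
    have d3 := sq_nonneg (Q 0)
    have d4 := sq_nonneg (P 0)
    have d5 : 0 ≤ P 1 ^ 2 + P 2 ^ 2 := by positivity
    have d6 : 0 ≤ Q 1 ^ 2 + Q 2 ^ 2 := by positivity
    obtain ⟨lP1, lP2⟩ := abs_le.1 lP
    obtain ⟨lQ1, lQ2⟩ := abs_le.1 lQ
    have : |(Q 0 - P 0) * α| ≤ 10 + 2 * e ^ 2 + 4 * (B * e) := by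
      rw [hid, abs_neg, abs_le]
      constructor <;> linarith
    rw [abs_mul, abs_of_nonneg (by linarith : 0 ≤ Q 0 - P 0)] at this
    have := mul_le_mul_of_nonneg_right hQP (abs_nonneg α)
    linarith

/-- The radius is maximal, with value `ρ / 2`, at the equator and has only a quadratic loss nearby;
`10` bounds `π ^ 2`. -/
theorem le_radius_of_equator {x K : ℝ} (hK : 10 ≤ K) (hx : |x + p.ρ| ≤ p.ρ * Real.pi / K) :
    -(3 / 2 * p.ρ) ≤ x ∧ x ≤ -(2 * (p.ρ * p.w)) ∧ p.ρ / 2 * (1 - 10 / K ^ 2) ≤ p.radius x := by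
  have hρ := p.ρ_pos
  have hw8 := p.ρw_le
  have hpi : Real.pi ≤ 3.15 := Real.pi_lt_d2.le
  have hpi0 := Real.pi_pos
  have hKρ : p.ρ * Real.pi / K ≤ p.ρ / 2 := by
    rw [div_le_iff₀ (by linarith)]
    nlinarith
  have hxρ := abs_le.1 (hx.trans hKρ)
  have hxl : x ≤ -(2 * (p.ρ * p.w)) := by linarith [hxρ.2]
  have hx1 : -(3 / 2 * p.ρ) ≤ x := by linarith [hxρ.1]
  refine ⟨hx1, hxl, ?_⟩
  have er := p.sq_radius_of_le (by linarith) hxl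
  have hK2 : 0 < K ^ 2 := by positivity
  apply abs_le_of_sq_le_sq _ (p.radius_nonneg x) |> fun h => (abs_le.1 h).2
  have hxx : (x + p.ρ) ^ 2 ≤ p.ρ ^ 2 * (10 / K ^ 2) := by
    have := sq_le_sq' (by linarith [(abs_le.1 hx).1]) (abs_le.1 hx).2
    refine this.trans ?_
    rw [div_pow, mul_pow, mul_div_assoc]
    gcongr
    nlinarith
  have h10 : 10 / K ^ 2 ≤ 1 := by rw [div_le_one hK2]; nlinarith
  have h100 : 0 ≤ 10 / K ^ 2 := by positivity
  have : (1 - 10 / K ^ 2) ^ 2 ≤ 1 - 10 / K ^ 2 := by nlinarith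
  rw [er, mul_pow]
  have h11 := mul_le_mul_of_nonneg_left this (sq_nonneg (p.ρ / 2))
  linarith

/-- Away from the equator `P` is closer to the axis than `ρ / 2` by a relative amount of order `1 /
L ^ 2`. Moving from `P` to the equator against the lateral gradient therefore lowers the sphere
function by a multiple of `B ρ / L ^ 2`. If it stays nonnegative, the other terms, of sizes `ρ ^ 2`
and `|α| ρ`, must make up for this. -/
theorem gradient_bound_of_equator {P : E3} (hP : P ∈ p.surf)
    (hP0 : P 0 ≤ -(2 * (p.ρ * p.w))) {L : ℝ} (hL : 1 ≤ L) (hPL : p.ρ / L ≤ |P 0 + p.ρ|)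
    {x θ K : ℝ} (hK : 10 * L ≤ K)
    (hx : |x + p.ρ| ≤ p.ρ * Real.pi / K) {α β γ c k : ℝ}
    (h1 : sphereFun 1 α β γ c P = 0) (hk : 1 - 2 / K ^ 4 ≤ k)
    (hdir : β * Real.cos θ + γ * Real.sin θ ≤ -(√(β ^ 2 + γ ^ 2) * k))
    (hcon : 0 ≤ sphereFun 1 α β γ c (p.param x θ)) :
    √(β ^ 2 + γ ^ 2) * (1 / (4 * L ^ 2)) ≤ 10 * p.ρ + 4 * |α| := by
  have hρ := p.ρ_pos
  have hw := p.ρw_pos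
  have hK10 : 10 ≤ K := by linarith
  obtain ⟨hx1, hxl, hrlow⟩ := p.le_radius_of_equator hK10 hx
  set B := √(β ^ 2 + γ ^ 2) with hB
  have hB0 : 0 ≤ B := Real.sqrt_nonneg _
  have hL2 : 1 ≤ L ^ 2 := one_le_pow₀ hL
  have hP' : 1 * (P 0 ^ 2 + P 1 ^ 2 + P 2 ^ 2) + α * P 0 + β * P 1 + γ * P 2 + c = 0 := h1
  obtain ⟨r, hr⟩ : ∃ r, r = p.radius x := ⟨_, rfl⟩
  have hr0 : 0 ≤ r := by rw [hr]; exact p.radius_nonneg x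
  have hr1 : r ≤ p.ρ := by rw [hr]; exact p.radius_le x (by linarith)
  rw [← hr] at hrlow
  have eS : sphereFun 1 α β γ c (p.param x θ) =
      x ^ 2 + r ^ 2 + α * x + r * (β * Real.cos θ + γ * Real.sin θ) + c := by
    simp only [sphereFun, param, pt_zero, pt_one, pt_two, p.axis₁_of_nonpos (by linarith : x ≤ 0),
      p.axis₂_of_nonpos (by linarith : x ≤ 0), ← hr]
    linear_combination r ^ 2 * Real.sin_sq_add_cos_sq θ
  rw [eS] at hcon
  have eP := p.sq_add_sq_of_body hP hP0
  have hK2 : 0 < K ^ 2 := by positivity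
  have hPup : P 1 ^ 2 + P 2 ^ 2 ≤ (p.ρ / 2 * (1 - 1 / (2 * L ^ 2))) ^ 2 := by
    have hPP : (p.ρ / L) ^ 2 ≤ (P 0 + p.ρ) ^ 2 := by
      rw [← sq_abs (P 0 + p.ρ)]
      exact pow_le_pow_left₀ (by positivity) hPL 2
    have e1 : (p.ρ / 2 * (1 - 1 / (2 * L ^ 2))) ^ 2 =
        p.ρ ^ 2 / 4 - (p.ρ / L) ^ 2 / 4 + p.ρ ^ 2 / 4 * (1 / (2 * L ^ 2)) ^ 2 := by
      field_simp; ring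
    rw [e1, eP]
    have : 0 ≤ p.ρ ^ 2 / 4 * (1 / (2 * L ^ 2)) ^ 2 := by positivity
    linarith
  have hL22 : 1 / (2 * L ^ 2) ≤ 1 / 2 := by
    apply one_div_le_one_div_of_le (by norm_num); linarith
  have hPlin : -(B * (p.ρ / 2 * (1 - 1 / (2 * L ^ 2)))) ≤ β * P 1 + γ * P 2 := by
    have h5 : √(P 1 ^ 2 + P 2 ^ 2) ≤ p.ρ / 2 * (1 - 1 / (2 * L ^ 2)) := by
      rw [Real.sqrt_le_left (mul_nonneg (by positivity) (by linarith))]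
      exact hPup
    exact (abs_le.1 ((abs_mul_add_mul_le β γ (P 1) (P 2)).trans
      (mul_le_mul_of_nonneg_left h5 hB0))).1
  -- The loss `12` is `10` for the radius near the equator and `2` for the angular error; `K ≥ 10 L`
  -- keeps it below half of the gain `1 / (2 * L ^ 2)`.
  have hKL : 12 / K ^ 2 ≤ 1 / (4 * L ^ 2) := by
    rw [div_le_div_iff₀ hK2 (by positivity)]
    have := pow_le_pow_left₀ (by linarith) hK 2
    linarith
  have hK1 : 1 ≤ K ^ 2 := one_le_pow₀ (by linarith)
  have hK42 : 2 / K ^ 4 ≤ 2 / K ^ 2 := by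
    gcongr
    · linarith
    · norm_num
  have hrk : p.ρ / 2 * (1 - 12 / K ^ 2) ≤ r * k := by
    have hk0 : 0 ≤ 1 - 2 / K ^ 2 := by
      have hK100 := pow_le_pow_left₀ (by norm_num) hK10 2
      have : 2 / K ^ 2 ≤ 1 := by rw [div_le_one hK2]; linarith
      linarith
    have h6 : r * (1 - 2 / K ^ 2) ≤ r * k := mul_le_mul_of_nonneg_left (by linarith) hr0
    have h7 := mul_le_mul_of_nonneg_right hrlow hk0
    have h8 : 0 ≤ p.ρ / 2 * ((10 / K ^ 2) * (2 / K ^ 2)) := by positivity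
    have h9 : p.ρ / 2 * (1 - 10 / K ^ 2) * (1 - 2 / K ^ 2) =
      p.ρ / 2 * (1 - 12 / K ^ 2) + p.ρ / 2 * ((10 / K ^ 2) * (2 / K ^ 2)) := by ring
    linarith
  have hS1 : r * (β * Real.cos θ + γ * Real.sin θ) ≤ -(B * (p.ρ / 2 * (1 - 12 / K ^ 2))) := by
    have i1 := mul_le_mul_of_nonneg_left hdir hr0
    have i2 := mul_le_mul_of_nonneg_left hrk hB0
    linarith
  have hα : α * (x - P 0) ≤ |α| * (2 * p.ρ) := by
    refine (le_abs_self _).trans ?_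
    rw [abs_mul]
    apply mul_le_mul_of_nonneg_left _ (abs_nonneg _)
    rw [abs_le]
    constructor <;> linarith [hP.1]
  have hx2 : x ^ 2 ≤ (2 * p.ρ) ^ 2 := sq_le_sq' (by linarith) (by linarith)
  have hr2 : r ^ 2 ≤ p.ρ ^ 2 := pow_le_pow_left₀ hr0 hr1 2
  have e4 : 1 / (2 * L ^ 2) = 2 * (1 / (4 * L ^ 2)) := by field_simp; norm_num
  have hsum : B * (p.ρ / 2 * (1 / (2 * L ^ 2) - 12 / K ^ 2)) ≤ 5 * p.ρ ^ 2 + |α| * (2 * p.ρ) := by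
    have n0 := sq_nonneg (P 0)
    have n1 := sq_nonneg (P 1)
    have n2 := sq_nonneg (P 2)
    linear_combination hcon + hP' + hS1 + hα + hx2 + hr2 + hPlin + n0 + n1 + n2
  have hge : B * (p.ρ / 2 * (1 / (4 * L ^ 2))) ≤
      B * (p.ρ / 2 * (1 / (2 * L ^ 2) - 12 / K ^ 2)) := by
    gcongr
    linarith
  have h12 : p.ρ / 2 * (B * (1 / (4 * L ^ 2))) ≤ p.ρ / 2 * (10 * p.ρ + 4 * |α|) := by
    linear_combination hge + hsum
  exact le_of_mul_le_mul_left h12 (by positivity)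

/-- Eliminating `a` from the last two inequalities, the terms `B e` are absorbed by the smallness of
`e` and `B τ` is at most a multiple of `L ^ 2`. The first inequality times `τ` then makes `τ ^ 2 *
g` at most about `1858 * L ^ 2 * e`, against `hsmall`. -/
theorem gradient_bounds_absurd {B a e L τ g ρ : ℝ} (hB : 0 ≤ B) (he : 0 < e) (hL : 1 ≤ L)
    (hτ : 0 < τ) (hτ1 : τ ≤ 1) (hg1 : g ≤ 1) (hρ1 : ρ ≤ 1 / 2)
    (hsmall : 2000 * L ^ 2 * e < τ ^ 2 * g) (step1 : τ * g ≤ 2 * e ^ 2 + 4 * (B * e))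
    (step2 : a * τ ≤ 10 + 2 * e ^ 2 + 4 * (B * e))
    (step3 : B * (1 / (4 * L ^ 2)) ≤ 10 * ρ + 4 * a) : False := by
  have hL2 : 1 ≤ L ^ 2 := one_le_pow₀ hL
  have hτ2 : τ ^ 2 ≤ τ := by nlinarith
  have hτg : τ ^ 2 * g ≤ τ := by nlinarith [sq_nonneg τ]
  have hLe : e ≤ L ^ 2 * e := le_mul_of_one_le_left he.le hL2
  have he1 : 2000 * e ≤ 1 := by linarith
  have step4 : B ≤ 40 * L ^ 2 * ρ + 16 * L ^ 2 * a := by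
    have h : B = 4 * L ^ 2 * (B * (1 / (4 * L ^ 2))) := by field_simp
    have h2 := mul_le_mul_of_nonneg_left step3 (by positivity : 0 ≤ 4 * L ^ 2)
    rw [← h] at h2
    linarith
  have step5 : B * τ ≤ 464 * L ^ 2 := by
    have j1 := mul_le_mul_of_nonneg_right step4 hτ.le
    have j2 := mul_le_mul_of_nonneg_left step2 (by positivity : 0 ≤ 16 * L ^ 2)
    have j3 : 64 * (L ^ 2 * e) ≤ τ / 2 := by linarith
    have j4 := mul_le_mul_of_nonneg_right j3 hB
    have j5 : e ^ 2 ≤ 1 := pow_le_one₀ he.le (by linarith)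
    have j6 : ρ * τ ≤ 1 / 2 := by nlinarith
    have j7 := mul_le_mul_of_nonneg_left j5 (by positivity : 0 ≤ 32 * L ^ 2)
    have j8 := mul_le_mul_of_nonneg_left j6 (by positivity : 0 ≤ 40 * L ^ 2)
    linarith
  have m1 := mul_le_mul_of_nonneg_right step1 hτ.le
  have m2 := mul_le_mul_of_nonneg_right step5 he.le
  have m3 : e ^ 2 * τ ≤ L ^ 2 * e := by
    have : e * τ ≤ L ^ 2 := by nlinarith
    have := mul_le_mul_of_nonneg_left this he.le
    linarith
  have m4 : 0 < L ^ 2 * e := by positivity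
  linarith

/-- A sphere through a point of the body away from its equator and a point of the tail which is
not the first one contains points of the tail or of the equator of the body. -/
theorem sphereFun_neg_of_body_of_tail {P S Q : E3} (hP : P ∈ p.surf) (hS : S ∈ p.surf)
    (hQ : Q ∈ p.surf) (hP0 : P 0 ≤ -(2 * (p.ρ * p.w))) {L τ g : ℝ} (hL : 1 ≤ L) (hτ : 0 < τ)
    (hτ1 : τ ≤ 1) (hg : 0 < g) (hg1 : g ≤ 1) (hPL : p.ρ / L ≤ |P 0 + p.ρ|) (hS0 : τ ≤ S 0)
    (hSQ : S 0 + g ≤ Q 0)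
    (hsmall : 2000 * L ^ 2 * (81 * p.η + p.ρ) < τ ^ 2 * g) {x θ K : ℝ} (hK : 10 * L ≤ K)
    (hx : |x + p.ρ| ≤ p.ρ * Real.pi / K) {α β γ c k : ℝ}
    (h1 : sphereFun 1 α β γ c P = 0) (h2 : sphereFun 1 α β γ c Q = 0)
    (h3 : 0 ≤ sphereFun 1 α β γ c S) (hk : 1 - 2 / K ^ 4 ≤ k)
    (hdir : β * Real.cos θ + γ * Real.sin θ ≤ -(√(β ^ 2 + γ ^ 2) * k)) :
    sphereFun 1 α β γ c (p.param x θ) < 0 := by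
  have hρ := p.ρ_pos
  have hη := p.η_pos
  have hw := p.ρw_pos
  by_contra hcon
  push Not at hcon
  obtain ⟨s1, s2⟩ := p.gradient_bounds_of_tail hP hS hQ (by linarith) hτ hg hS0 hSQ h1 h2 h3
  exact gradient_bounds_absurd (Real.sqrt_nonneg _) (by positivity) hL hτ hτ1 hg1 p.ρ_le
    hsmall s1 s2 (p.gradient_bound_of_equator hP hP0 hL hPL hK hx h1 hk hdir hcon)

set_option maxHeartbeats 1000000 in
/-- The points of the surface with abscissa in `[1, 2]` are joined to each other. -/
theorem adj_of_middle {S : Set E3} (hS : S ⊆ p.surf) {P Q : E3} (hPS : P ∈ S) (hQS : Q ∈ S)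
    (hP : P ∈ middle) (hQ : Q ∈ middle) {g : ℝ} (hg : 0 < g) (hg1 : g ≤ 1)
    (hPQ : g ≤ |P 0 - Q 0|)
    (hgap : ∀ X ∈ S, 1 / 2 < X 0 → X ≠ P → X ≠ Q → g ≤ |X 0 - P 0| ∧ g ≤ |X 0 - Q 0|)
    (hρη : p.ρ ≤ p.η) (hsmall : 322752 * p.η ^ 2 + 9 * (p.ρ / p.η) ≤ g ^ 5 / 192) :
    (delaunayGraph S).Adj P Q := by
  have hρ := p.ρ_pos
  have hη := p.η_pos
  set e := 322752 * p.η ^ 2 + 9 * (p.ρ / p.η) with he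
  have he0 : 0 < e := by positivity
  set a := P 0 with ha
  set b := Q 0 with hb
  have ha1 : 1 ≤ a := hP.1
  have ha2 : a ≤ 2 := hP.2
  have hb1 : 1 ≤ b := hQ.1
  have hb2 : b ≤ 2 := hQ.2
  set s := a + b with hs
  set m := a * b with hm
  have hm1 : 1 ≤ m := one_le_mul_of_one_le_of_one_le ha1 hb1
  have hm4 : m ≤ 2 * 2 := mul_le_mul ha2 hb2 (by linarith) (by norm_num)
  -- The coefficient of `t ^ 2` in `(t - a)² (t - b)² = t⁴ - 2 s t³ + κ t² - 2 s m t + m²`.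
  set κ := s ^ 2 + 2 * m with hκ
  have hκ0 : 0 < κ := by positivity
  have hκ24 : κ ≤ 24 := by
    have := pow_le_pow_left₀ (by linarith) (by linarith : s ≤ 4) 2
    linarith
  -- the sphere function, up to a correction depending on the abscissa only
  set F : E3 → ℝ := sphereFun κ (-2 * s * m) (-2 * s / p.η) (1 / p.η) (m ^ 2) with hF
  -- Where the axis is straight only the quadratic part of the quartic is seen, where it is fully
  -- bent the whole quartic; the cutoff of the axis interpolates between the two.
  set main : ℝ → ℝ := fun t => (1 - Real.smoothTransition t) * (κ * t ^ 2 - 2 * s * m * t + m ^ 2) +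
    Real.smoothTransition t * ((t - a) ^ 2 * (t - b) ^ 2) with hmain
  have hFe : ∀ X ∈ p.surf, |F X - main (X 0)| ≤ e := by
    intro X hX
    obtain ⟨v1, v2⟩ := p.abs_sub_axis_le hX
    obtain ⟨c1, c2⟩ := p.abs_coord_le hX
    have hid : F X - main (X 0) = κ * (X 1 ^ 2 + X 2 ^ 2) +
        (-2 * s * (X 1 - p.axis₁ (X 0)) + (X 2 - p.axis₂ (X 0))) / p.η := by
      simp only [hF, hmain, sphereFun, axis₁, axis₂]
      rw [hκ, hs, hm]
      field_simp
      ring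
    rw [hid]
    have hc : ∀ i, |X i| ≤ 81 * p.η + p.ρ → X i ^ 2 ≤ 6724 * p.η ^ 2 := by
      intro i hi
      have h82 : |X i| ≤ 82 * p.η := by linarith
      have := pow_le_pow_left₀ (abs_nonneg _) h82 2
      rw [sq_abs] at this
      linarith
    have k1 := hc 1 c1
    have k2 := hc 2 c2
    have k3 : |κ * (X 1 ^ 2 + X 2 ^ 2)| ≤ 322752 * p.η ^ 2 := by
      rw [abs_of_nonneg (by positivity)]
      calc κ * (X 1 ^ 2 + X 2 ^ 2) ≤ 24 * (6724 * p.η ^ 2 + 6724 * p.η ^ 2) := by gcongr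
        _ = _ := by ring
    have k4 : |(-2 * s * (X 1 - p.axis₁ (X 0)) + (X 2 - p.axis₂ (X 0))) / p.η| ≤
        9 * (p.ρ / p.η) := by
      rw [abs_div, abs_of_pos hη, ← mul_div_assoc]
      gcongr
      refine (abs_add_le _ _).trans ?_
      rw [abs_mul, abs_mul, abs_neg, abs_of_pos (by norm_num : (0 : ℝ) < 2),
        abs_of_nonneg (by linarith : 0 ≤ s)]
      have : s * |X 1 - p.axis₁ (X 0)| ≤ 4 * p.ρ :=
        mul_le_mul (by linarith) v1 (abs_nonneg _) (by norm_num)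
      linarith
    exact (abs_add_le _ _).trans (add_le_add k3 k4)
  have hst1 : ∀ t : ℝ, 1 ≤ t → Real.smoothTransition t = 1 := fun t ht =>
    Real.smoothTransition.one_of_one_le ht
  have hmP : main a = 0 := by simp [hmain, hst1 a ha1]
  have hmQ : main b = 0 := by simp [hmain, hst1 b hb1]
  have hab : a - b ≠ 0 := by
    intro h
    rw [h, abs_zero] at hPQ
    linarith
  have hFP : |F P| ≤ e := by
    have := hFe P (hS hPS)
    rwa [← ha, hmP, sub_zero] at this
  have hFQ : |F Q| ≤ e := by
    have := hFe Q (hS hQS)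
    rwa [← hb, hmQ, sub_zero] at this
  -- Subtracting an affine function of the abscissa makes the values at `P` and `Q` exactly zero.
  -- Both values are at most `e`, so its slope is at most `2 * e / g`.
  set d := (F P - F Q) / (a - b) with hd
  have hdle : |d| ≤ 2 * e / g := by
    rw [hd, abs_div]
    have : |F P - F Q| ≤ 2 * e := (abs_sub _ _).trans (by linarith)
    gcongr
  have hcorr : ∀ X : E3, sphereFun κ (-2 * s * m - d) (-2 * s / p.η) (1 / p.η)
      (m ^ 2 - F P + d * a) X = F X - F P - d * (X 0 - a) := by
    intro X
    simp only [hF, sphereFun]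
    ring
  have hPQne : P ≠ Q := by
    rintro rfl
    exact hab (sub_self _)
  refine adj_of_sphereFun hPQne hPS hQS (κ := κ) (α := -2 * s * m - d) (β := -2 * s / p.η)
    (γ := 1 / p.η) (c := m ^ 2 - F P + d * a) hκ0 ?_ ?_ fun X hX => ?_
  · rw [hcorr, ← ha]; ring
  · rw [hcorr, ← hb, hd]
    field_simp
    ring
  · by_cases hXP : X = P
    · rw [hXP, hcorr, ← ha]
      apply le_of_eq; ring
    by_cases hXQ : X = Q
    · rw [hXQ, hcorr, ← hb, hd]
      apply le_of_eq
      field_simp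
      ring
    rw [hcorr]
    have hXs := hS hX
    have hX0 := p.coord_mem_Icc hXs
    have h1 := hFe X hXs
    have hdx : |d * (X 0 - a)| ≤ 6 * e / g := by
      rw [abs_mul]
      have h3 : |X 0 - a| ≤ 3 := by
        rw [abs_le]; constructor <;> linarith [hX0.1, hX0.2]
      calc _ ≤ 2 * e / g * 3 := by gcongr
        _ = _ := by ring
    -- The discriminant of the quadratic part is `-8 * m ^ 3 < 0`, so it is bounded below by a
    -- positive constant.
    have hq0 : g ^ 4 / 16 ≤ κ * X 0 ^ 2 - 2 * s * m * X 0 + m ^ 2 := by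
      have hg4 : g ^ 4 ≤ 1 := pow_le_one₀ hg.le hg1
      have e1 : κ * (κ * X 0 ^ 2 - 2 * s * m * X 0 + m ^ 2) =
          (κ * X 0 - s * m) ^ 2 + 2 * m ^ 3 := by rw [hκ]; ring
      have e2 : 1 ≤ m ^ 3 := one_le_pow₀ hm1
      have e3 : 2 ≤ κ * (κ * X 0 ^ 2 - 2 * s * m * X 0 + m ^ 2) := by
        rw [e1]; linarith [sq_nonneg (κ * X 0 - s * m)]
      by_contra hlt
      push Not at hlt
      have : κ * (κ * X 0 ^ 2 - 2 * s * m * X 0 + m ^ 2) ≤ κ * (1 / 16) := by gcongr; linarith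
      linarith
    have hQ0 : g ^ 4 / 16 ≤ (X 0 - a) ^ 2 * (X 0 - b) ^ 2 := by
      rcases le_or_gt (X 0) (1 / 2) with h | h
      · have i1 := pow_le_pow_left₀ (by norm_num) (by linarith : 1 / 2 ≤ a - X 0) 2
        have i2 := pow_le_pow_left₀ (by norm_num) (by linarith : 1 / 2 ≤ b - X 0) 2
        have i3 := mul_le_mul i1 i2 (by norm_num) (sq_nonneg _)
        have hg4 : g ^ 4 ≤ 1 := pow_le_one₀ hg.le hg1
        linarith
      · obtain ⟨i1, i2⟩ := hgap X hX h hXP hXQ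
        have i3 := pow_le_pow_left₀ hg.le i1 2
        have i4 := pow_le_pow_left₀ hg.le i2 2
        rw [sq_abs] at i3 i4
        have i5 : g ^ 2 * g ^ 2 ≤ (X 0 - a) ^ 2 * (X 0 - b) ^ 2 :=
          mul_le_mul i3 i4 (by positivity) (by positivity)
        have i6 : 0 ≤ g ^ 4 := by positivity
        calc g ^ 4 / 16 ≤ g ^ 2 * g ^ 2 := by linarith
          _ ≤ _ := i5
    have hmainX : g ^ 4 / 16 ≤ main (X 0) := by
      have j1 := Real.smoothTransition.nonneg (X 0)
      have j2 := Real.smoothTransition.le_one (X 0)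
      have j3 := mul_le_mul_of_nonneg_left hq0 (by linarith : 0 ≤ 1 - Real.smoothTransition (X 0))
      have j4 := mul_le_mul_of_nonneg_left hQ0 j1
      simp only [hmain]
      linarith
    have heg : e ≤ e / g := le_div_self he0.le hg hg1
    have hfin : 8 * (e / g) ≤ g ^ 4 / 16 := by
      have : e / g ≤ g ^ 4 / 192 := by
        rw [div_le_iff₀ hg]
        calc e ≤ g ^ 5 / 192 := hsmall
          _ = _ := by ring
      have i6 : 0 ≤ g ^ 4 := by positivity
      linarith
    have l1 := (abs_le.1 h1).1
    have l2 := (abs_le.1 hFP).2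
    have l3 := (abs_le.1 hdx).2
    have l4 : 6 * e / g = 6 * (e / g) := by ring
    linarith

end TubeParams

/-! ### Slabs and cells of the body, and the pairs they separate -/

namespace TubeParams

variable (p : TubeParams)

/-- Abscissa of the point of the body with polar angle `kπ/K`. -/
noncomputable def node (K k : ℕ) : ℝ := p.ρ * (Real.cos (k * (Real.pi / K)) - 1)

/-- A cell of the subdivision of the body by polar angle and angle of rotation. -/
noncomputable def cellAt (K k j : ℕ) : Set E3 :=
  p.cell (p.node K (k + 1)) (p.node K k) (2 * Real.pi / (4 * K ^ 2 : ℕ) * j)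
    (2 * Real.pi / (4 * K ^ 2 : ℕ))

/-- A slab of the subdivision of the body by polar angle. -/
noncomputable def slabAt (K k : ℕ) : Set E3 :=
  p.zone (k * (Real.pi / K)) ((k + 1 : ℕ) * (Real.pi / K))

theorem mul_pi_div_le {K k : ℕ} (hk : k ≤ K) : (k : ℝ) * (Real.pi / K) ≤ Real.pi := by
  rcases Nat.eq_zero_or_pos K with h | h
  · subst h
    simp [Real.pi_pos.le]
  · have hK : (0 : ℝ) < K := by exact_mod_cast h
    have hk' : (k : ℝ) ≤ K := by exact_mod_cast hk
    rw [← mul_div_assoc, div_le_iff₀ hK]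
    nlinarith [Real.pi_pos]

theorem node_antitone {K k l : ℕ} (hkl : k ≤ l) (hl : l ≤ K) : p.node K l ≤ p.node K k := by
  have hρ := p.ρ_pos
  have hkl' : (k : ℝ) ≤ l := by exact_mod_cast hkl
  have hpi := Real.pi_pos
  unfold node
  apply mul_le_mul_of_nonneg_left _ hρ.le
  have := Real.cos_le_cos_of_nonneg_of_le_pi (x := k * (Real.pi / K)) (y := l * (Real.pi / K))
    (by positivity) (mul_pi_div_le hl) (by gcongr)
  linarith

/-- The difference of cosines is a product of two sines, each at least `1 / K` by Jordan's
inequality. Slabs are thinnest at the poles, hence the order `1 / K ^ 2`. -/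
theorem node_gap {K k : ℕ} (hk : k + 1 ≤ K) :
    2 * p.ρ / K ^ 2 ≤ p.node K k - p.node K (k + 1) := by
  have hρ := p.ρ_pos
  have hpi := Real.pi_pos
  have hK : (1 : ℝ) ≤ K := by exact_mod_cast (by omega : 1 ≤ K)
  set d := Real.pi / K with hd
  have hd0 : 0 < d := by positivity
  have hdpi : d ≤ Real.pi := div_le_self hpi.le hK
  have hend : ((k + 1 : ℕ) : ℝ) * d ≤ Real.pi := mul_pi_div_le hk
  push_cast at hend
  have hk0 : 0 ≤ (k : ℝ) * d := by positivity
  have hs0 : 0 ≤ Real.sin (d / 2) :=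
    Real.sin_nonneg_of_nonneg_of_le_pi (by positivity) (by linarith)
  have hs : Real.sin (d / 2) ≤ Real.sin (k * d + d / 2) := by
    rcases le_total (k * d + d / 2) (Real.pi / 2) with h | h
    · exact Real.sin_le_sin_of_le_of_le_pi_div_two (by linarith) h (by linarith)
    · rw [← Real.sin_pi_sub (k * d + d / 2)]
      exact Real.sin_le_sin_of_le_of_le_pi_div_two (by linarith) (by linarith) (by linarith)
  have hl : 2 / Real.pi * (d / 2) ≤ Real.sin (d / 2) :=
    Real.mul_le_sin (by positivity) (by linarith)
  have hl2 : 1 / (K : ℝ) ≤ Real.sin (d / 2) := by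
    refine le_trans (le_of_eq ?_) hl
    rw [hd]; field_simp
  have hid : p.node K k - p.node K (k + 1) =
      2 * p.ρ * (Real.sin (k * d + d / 2) * Real.sin (d / 2)) := by
    simp only [node, ← hd]
    push_cast
    have := Real.cos_sub_cos (k * d) ((k + 1) * d)
    rw [show (k * d + (k + 1) * d) / 2 = k * d + d / 2 by ring,
      show (k * d - (k + 1) * d) / 2 = -(d / 2) by ring, Real.sin_neg] at this
    linear_combination p.ρ * this
  rw [hid]
  calc 2 * p.ρ / K ^ 2 = 2 * p.ρ * (1 / K * (1 / K)) := by field_simp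
    _ ≤ 2 * p.ρ * (Real.sin (k * d + d / 2) * Real.sin (d / 2)) := by
      apply mul_le_mul_of_nonneg_left _ (by positivity)
      exact mul_le_mul (hl2.trans hs) hl2 (by positivity) (hs0.trans hs)

/-- The number `4 * K ^ 2` of sectors is chosen so that the angular loss `4 / K ^ 4` is the square
of the relative thickness `2 / K ^ 2` of a slab. -/
theorem cos_step_bounds {K : ℕ} (hK : 1 ≤ K) :
    1 - 2 / (K : ℝ) ^ 4 ≤ Real.cos (2 * Real.pi / (4 * K ^ 2 : ℕ)) ∧
    1 - Real.cos (2 * Real.pi / (4 * K ^ 2 : ℕ)) ^ 2 ≤ 4 / (K : ℝ) ^ 4 ∧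
    0 ≤ Real.cos (2 * Real.pi / (4 * K ^ 2 : ℕ)) := by
  have hK0 : (1 : ℝ) ≤ K := by exact_mod_cast hK
  have hpi := Real.pi_pos
  have hpi2 := Real.pi_lt_d2
  push_cast
  set d := 2 * Real.pi / (4 * (K : ℝ) ^ 2) with hd
  have hd0 : 0 < d := by positivity
  have hd2 : d ^ 2 ≤ 4 / (K : ℝ) ^ 4 := by
    rw [hd, div_pow, div_le_div_iff₀ (by positivity) (by positivity)]
    have h1 : Real.pi ^ 2 ≤ 16 := by nlinarith
    have h2 : 0 ≤ (K : ℝ) ^ 4 := by positivity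
    nlinarith
  have hdle : d ≤ Real.pi / 2 := by
    rw [hd, div_le_iff₀ (by positivity)]
    have : 1 ≤ (K : ℝ) ^ 2 := one_le_pow₀ hK0
    nlinarith
  refine ⟨?_, ?_, Real.cos_nonneg_of_neg_pi_div_two_le_of_le (by linarith) hdle⟩
  · have := Real.one_sub_sq_div_two_le_cos (x := d)
    have e : 2 / (K : ℝ) ^ 4 = (4 / (K : ℝ) ^ 4) / 2 := by ring
    linarith
  · rw [← Real.sin_sq]
    have h1 := Real.sin_le hd0.le
    have h2 : 0 ≤ Real.sin d := Real.sin_nonneg_of_nonneg_of_le_pi hd0.le (by linarith)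
    exact (pow_le_pow_left₀ h2 h1 2).trans hd2

theorem exists_slabAt {K : ℕ} (hK : 1 ≤ K) {X : E3} (hX : X ∈ p.surf)
    (hX0 : X 0 ≤ -(2 * (p.ρ * p.w))) : ∃ k < K, X ∈ p.slabAt K k := by
  have hρ := p.ρ_pos
  have hw := p.ρw_pos
  have hpi := Real.pi_pos
  have hK0 : (1 : ℝ) ≤ K := by exact_mod_cast hK
  have h1 : -1 ≤ 1 + X 0 / p.ρ := by
    have : -2 ≤ X 0 / p.ρ := by rw [le_div_iff₀ hρ]; linarith [hX.1]
    linarith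
  have h2 : 1 + X 0 / p.ρ ≤ 1 := by
    have : X 0 / p.ρ ≤ 0 := by rw [div_le_iff₀ hρ]; linarith
    linarith
  set t := Real.arccos (1 + X 0 / p.ρ) with ht
  have ht0 : 0 ≤ t := Real.arccos_nonneg _
  have ht1 : t ≤ Real.pi := Real.arccos_le_pi _
  have hx : X 0 = p.ρ * (Real.cos t - 1) := by
    rw [ht, Real.cos_arccos h1 h2]; field_simp; ring
  have key : ∀ k : ℕ, k + 1 ≤ K → (k : ℝ) * (Real.pi / K) ≤ t →
      t ≤ ((k + 1 : ℕ) : ℝ) * (Real.pi / K) → X ∈ p.slabAt K k := by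
    intro k hk ha hb
    refine ⟨?_, ?_, hX0⟩
    · rw [hx]
      have := Real.cos_le_cos_of_nonneg_of_le_pi ht0 (mul_pi_div_le hk) hb
      apply mul_le_mul_of_nonneg_left _ hρ.le
      linarith
    · rw [hx]
      have := Real.cos_le_cos_of_nonneg_of_le_pi (by positivity) ht1 ha
      apply mul_le_mul_of_nonneg_left _ hρ.le
      linarith
  rcases ht1.eq_or_lt with h | h
  · refine ⟨K - 1, by omega, key (K - 1) (by omega) ?_ ?_⟩
    · rw [h]; exact mul_pi_div_le (by omega)
    · rw [h, Nat.sub_add_cancel hK]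
      apply le_of_eq; field_simp
  · have hd : 0 < Real.pi / K := by positivity
    have hlt : ⌊t / (Real.pi / K)⌋₊ < K := by
      rw [Nat.floor_lt (by positivity), div_lt_iff₀ hd]
      calc t < Real.pi := h
        _ = _ := by field_simp
    refine ⟨_, hlt, key _ hlt ?_ ?_⟩
    · have := Nat.floor_le (a := t / (Real.pi / K)) (by positivity)
      rwa [le_div_iff₀ hd] at this
    · have := (Nat.lt_floor_add_one (t / (Real.pi / K))).le
      rw [div_le_iff₀ hd] at this
      exact_mod_cast this

/-- If every cell contains a sample point, only samples in almost adjacent slabs of the body are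
joined. -/
theorem slab_le_of_adj {S : Set E3} {K : ℕ} (hK : 1 ≤ K)
    (hcell : ∀ k j, 2 ≤ k → k + 3 ≤ K → j < 4 * K ^ 2 → ∃ X ∈ S, X ∈ p.cellAt K k j)
    {P Q : E3} (hP : P ∈ p.surf) (hQ : Q ∈ p.surf) {k l : ℕ} (hl : l < K)
    (hPl : P ∈ p.slabAt K l) (hQk : Q ∈ p.slabAt K k)
    (hadj : (delaunayGraph S).Adj P Q) : l ≤ k + 3 := by
  by_contra hlt
  push Not at hlt
  have hρ := p.ρ_pos
  have hK0 : (1 : ℝ) ≤ K := by exact_mod_cast hK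
  obtain ⟨α, β, γ, c, h1, h2, h3⟩ := exists_sphereFun_of_adj hadj
  have hJ : 2 ≤ 4 * K ^ 2 := by have := Nat.one_le_pow 2 K hK; omega
  obtain ⟨j, hj, hdir⟩ := exists_direction β γ hJ
  -- Slab `k + 2` leaves a full slab free on either side, `k + 1` towards `Q` and `k + 3` towards
  -- `P`, since `l ≥ k + 4`. Both abscissa gaps are thus at least `2ρ / K ^ 2`.
  obtain ⟨X, hXS, ⟨x, θ⟩, ⟨hx, hθ⟩, rfl⟩ := hcell (k + 2) j (by omega) (by omega) hj
  obtain ⟨hc1, hc2, hc0⟩ := cos_step_bounds hK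
  have hxa : p.node K (k + 3) ≤ x := hx.1
  have hxb : x ≤ p.node K (k + 2) := hx.2
  have g1 := p.node_gap (show k + 1 + 1 ≤ K by omega)
  have g2 := p.node_gap (show k + 3 + 1 ≤ K by omega)
  have hQ1 : p.node K (k + 1) ≤ Q 0 := hQk.1
  have hP1 : P 0 ≤ p.node K l := hPl.2.1
  have hP2 := p.node_antitone (show k + 4 ≤ l by omega) hl.le
  have hgpos : 0 < 2 * p.ρ / (K : ℝ) ^ 2 := by positivity
  have d1 : 2 * p.ρ / (K : ℝ) ^ 2 ≤ x - P 0 := by linarith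
  have d2 : 2 * p.ρ / (K : ℝ) ^ 2 ≤ Q 0 - x := by linarith
  have hneg := p.sphereFun_neg_of_body hP hQ hQk.2.2 (x := x) (θ := θ) (by linarith) (by linarith)
    h1 h2 hc0 ?_ (hdir θ hθ)
  · exact absurd (h3 _ hXS) (not_le.2 hneg)
  · calc _ ≤ p.ρ ^ 2 * (4 / (K : ℝ) ^ 4) := mul_le_mul_of_nonneg_left hc2 (sq_nonneg _)
      _ = (2 * p.ρ / (K : ℝ) ^ 2) * (2 * p.ρ / (K : ℝ) ^ 2) := by field_simp; norm_num
      _ ≤ _ := mul_le_mul d1 d2 hgpos.le (by linarith)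

/-- If every cell contains a sample point, then a sample point in the tail which has another
sample point of the tail on its left is joined to no point of the body outside the equatorial
belt. -/
theorem mem_belt_of_adj {S : Set E3} {H : ℕ} (hH : 3 ≤ H)
    (hcell : ∀ k j, 2 ≤ k → k + 3 ≤ 2 * H → j < 4 * (2 * H) ^ 2 →
      ∃ X ∈ S, X ∈ p.cellAt (2 * H) k j)
    {P Q R : E3} (hP : P ∈ p.surf) (hQ : Q ∈ p.surf) (hR : R ∈ p.surf) (hRS : R ∈ S)
    (hP0 : P 0 ≤ -(2 * (p.ρ * p.w))) {L τ g : ℝ} (hL : 1 ≤ L) (hLH : 10 * L ≤ (2 * H : ℕ))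
    (hτ : 0 < τ) (hτ1 : τ ≤ 1) (hg : 0 < g) (hg1 : g ≤ 1) (hR0 : τ ≤ R 0) (hRQ : R 0 + g ≤ Q 0)
    (hsmall : 2000 * L ^ 2 * (81 * p.η + p.ρ) < τ ^ 2 * g)
    (hadj : (delaunayGraph S).Adj P Q) : |P 0 + p.ρ| < p.ρ / L := by
  by_contra hlt
  push Not at hlt
  have hρ := p.ρ_pos
  have hH0 : (3 : ℝ) ≤ H := by exact_mod_cast hH
  have hpi := Real.pi_pos
  obtain ⟨α, β, γ, c, h1, h2, h3⟩ := exists_sphereFun_of_adj hadj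
  have hJ : 2 ≤ 4 * (2 * H) ^ 2 := by have := Nat.one_le_pow 2 (2 * H) (by omega); omega
  obtain ⟨j, hj, hdir⟩ := exists_direction β γ hJ
  -- The number of slabs is even, so slab `H` starts exactly at the equator, polar angle `π / 2`.
  obtain ⟨X, hXS, ⟨x, θ⟩, ⟨hx, hθ⟩, rfl⟩ := hcell H j (by omega) (by omega) hj
  obtain ⟨hc1, hc2, hc0⟩ := cos_step_bounds (show 1 ≤ 2 * H by omega)
  have hxa : p.node (2 * H) (H + 1) ≤ x := hx.1
  have hxb : x ≤ p.node (2 * H) H := hx.2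
  have e0 : (H : ℝ) * (Real.pi / (2 * H : ℕ)) = Real.pi / 2 := by
    push_cast; field_simp
  have e1 : ((H + 1 : ℕ) : ℝ) * (Real.pi / (2 * H : ℕ)) = Real.pi / (2 * H : ℕ) + Real.pi / 2 := by
    rw [← e0]; push_cast; ring
  have hxabs : |x + p.ρ| ≤ p.ρ * Real.pi / (2 * H : ℕ) := by
    simp only [node, e0, e1, Real.cos_pi_div_two, Real.cos_add_pi_div_two] at hxa hxb
    have hs : Real.sin (Real.pi / (2 * H : ℕ)) ≤ Real.pi / (2 * H : ℕ) :=
      Real.sin_le (by positivity)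
    have := mul_le_mul_of_nonneg_left hs hρ.le
    have hnn : 0 ≤ p.ρ * (Real.pi / (2 * H : ℕ)) := by positivity
    rw [mul_div_assoc, abs_le]
    constructor <;> linarith
  have hneg := p.sphereFun_neg_of_body_of_tail hP hR hQ hP0 hL hτ hτ1 hg hg1 hlt hR0 hRQ hsmall
    hLH hxabs h1 h2 (h3 R hRS) hc1 (hdir θ hθ)
  exact absurd (h3 _ hXS) (not_le.2 hneg)

end TubeParams

/-! ### Counting edges for a typical sample -/

section Counting

theorem delaunayComplexity_range_le {n : ℕ} {x : Fin n → E3} (s : Finset (Fin n × Fin n))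
    (h : ∀ i j, (delaunayGraph (Set.range x)).Adj (x i) (x j) → (i, j) ∈ s) :
    delaunayComplexity (Set.range x) ≤ s.card := by
  classical
  have hsub : (delaunayGraph (Set.range x)).edgeSet ⊆
      ((s.image fun q => s(x q.1, x q.2) : Finset (Sym2 E3)) : Set (Sym2 E3)) := by
    intro e
    induction e using Sym2.ind with
    | _ P Q =>
      intro he
      have he' : (delaunayGraph (Set.range x)).Adj P Q := he
      obtain ⟨i, rfl⟩ := he'.2.1
      obtain ⟨j, rfl⟩ := he'.2.2.1
      simp only [Finset.coe_image, Set.mem_image, Finset.mem_coe]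
      exact ⟨(i, j), h i j he', rfl⟩
  refine (Set.ncard_le_ncard hsub (Finset.finite_toSet _)).trans ?_
  rw [Set.ncard_coe_finset]
  exact Finset.card_image_le

theorem choose_two_le_delaunayComplexity {n : ℕ} {x : Fin n → E3} (s : Finset (Fin n))
    (h : ∀ i ∈ s, ∀ j ∈ s, i ≠ j → (delaunayGraph (Set.range x)).Adj (x i) (x j)) :
    s.card.choose 2 ≤ delaunayComplexity (Set.range x) := by
  classical
  have hinj : Set.InjOn x s := by
    intro i hi j hj hij
    by_contra hne
    exact (h i hi j hj hne).1 hij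
  rw [← Finset.card_image_of_injOn hinj, ← Sym2.card_image_offDiag, ← Set.ncard_coe_finset]
  refine Set.ncard_le_ncard ?_ (delaunayGraph_edgeSet_finite (Set.finite_range x))
  intro e he
  simp only [Finset.coe_image, Set.mem_image, Finset.mem_coe, Finset.mem_offDiag,
    Finset.mem_image, Prod.exists] at he
  obtain ⟨P, Q, ⟨⟨i, hi, rfl⟩, ⟨j, hj, rfl⟩, hne⟩, rfl⟩ := he
  exact h i hi j hj fun hij => hne (hij ▸ rfl)

theorem exists_mem_of_hits_pos {E : Type*} {n : ℕ} {R : Set E} {x : Fin n → E}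
    (h : 0 < hits R x) : ∃ X ∈ Set.range x, X ∈ R := by
  classical
  obtain ⟨i, hi⟩ := Finset.card_pos.1 h
  exact ⟨x i, ⟨i, rfl⟩, by simpa using hi⟩

namespace TubeParams

variable (p : TubeParams)

/-- The part of the body around its equator to which the tail can be joined by edges. -/
def belt (L : ℝ) : Set E3 := {X | X 0 ≤ -(2 * (p.ρ * p.w)) ∧ |X 0 + p.ρ| < p.ρ / L}

/-- The samples with typical position: every cell of the body is hit, no region contains
many more points than expected, and the points on the tail are separated. -/
structure Typical (H : ℕ) (L τ g s z t b m : ℝ) {n : ℕ} (x : Fin n → E3) : Prop where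
  mem_surf : ∀ i, x i ∈ p.surf
  hits_cell : ∀ k j, 2 ≤ k → k + 3 ≤ 2 * H → j < 4 * (2 * H) ^ 2 →
    0 < hits (p.cellAt (2 * H) k j) x
  hits_slab : ∀ k < 2 * H, (hits (p.slabAt (2 * H) k) x : ℝ) ≤ s
  hits_joint : (hits (p.joint τ) x : ℝ) ≤ z
  hits_tail : (hits (tailPart τ 0 2) x : ℝ) ≤ t
  hits_belt : (hits (p.belt L) x : ℝ) ≤ b
  le_hits_middle : m ≤ hits middle x
  gap : ∀ i j, i ≠ j → τ ≤ x i 0 → τ ≤ x j 0 → g ≤ |x i 0 - x j 0|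

variable {p}

theorem mem_tailPart_iff {τ : ℝ} (hτ : 0 ≤ τ) (X : E3) : X ∈ tailPart τ 0 2 ↔ τ ≤ X 0 := by
  refine ⟨fun h => h.1, fun h => ⟨h, Real.sqrt_nonneg _, ?_⟩⟩
  rw [Real.sqrt_le_left (by norm_num)]
  linarith

theorem Typical.le_delaunayComplexity {H : ℕ} {L τ g s z t b m : ℝ} {n : ℕ} {x : Fin n → E3}
    (h : p.Typical H L τ g s z t b m x) (hτ : τ ≤ 1 / 2) (hg : 0 < g) (hg1 : g ≤ 1)
    (hρη : p.ρ ≤ p.η) (hsmall : 322752 * p.η ^ 2 + 9 * (p.ρ / p.η) ≤ g ^ 5 / 192) (hm : 2 ≤ m) :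
    m ^ 2 / 4 ≤ delaunayComplexity (Set.range x) := by
  classical
  have h1 : (hits middle x).choose 2 ≤ delaunayComplexity (Set.range x) := by
    refine choose_two_le_delaunayComplexity _ fun i hi j hj hij => ?_
    have hi' : x i ∈ middle := by simpa using hi
    have hj' : x j ∈ middle := by simpa using hj
    refine p.adj_of_middle (by rintro _ ⟨k, rfl⟩; exact h.mem_surf k) ⟨i, rfl⟩ ⟨j, rfl⟩ hi' hj' hg
      hg1 (h.gap i j hij (by linarith [hi'.1]) (by linarith [hj'.1])) ?_ hρη hsmall
    rintro _ ⟨k, rfl⟩ hk hki hkj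
    exact ⟨h.gap k i (fun e => hki (e ▸ rfl)) (by linarith) (by linarith [hi'.1]),
      h.gap k j (fun e => hkj (e ▸ rfl)) (by linarith) (by linarith [hj'.1])⟩
  have h2 : ((hits middle x).choose 2 : ℝ) ≤ delaunayComplexity (Set.range x) := by
    exact_mod_cast h1
  rw [Nat.cast_choose_two] at h2
  have h3 := h.le_hits_middle
  -- Since `m ≥ 2`, `m * (m - 1) / 2 ≥ m ^ 2 / 4`.
  nlinarith

theorem Typical.delaunayComplexity_le {H : ℕ} {L τ g s z t b m : ℝ} {n : ℕ} {x : Fin n → E3}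
    (h : p.Typical H L τ g s z t b m x) (hH : 3 ≤ H) (hL : 1 ≤ L) (hLH : 10 * L ≤ (2 * H : ℕ))
    (hτ : 0 < τ) (hτ1 : τ ≤ 1) (hg : 0 < g) (hg1 : g ≤ 1)
    (hsmall : 2000 * L ^ 2 * (81 * p.η + p.ρ) < τ ^ 2 * g) :
    (delaunayComplexity (Set.range x) : ℝ) ≤
      2 * (n * z) + t ^ 2 + 14 * (H * s ^ 2) + 2 * (b * t) + 2 * n := by
  classical
  set U : Finset (Fin n) := Finset.univ
  set Z := Finset.univ.filter (fun i => x i ∈ p.joint τ) with hZ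
  set T := Finset.univ.filter (fun i => x i ∈ tailPart τ 0 2) with hT
  set B := Finset.univ.filter (fun i => x i ∈ p.belt L) with hB
  set A : ℕ → Finset (Fin n) := fun k => Finset.univ.filter (fun i => x i ∈ p.slabAt (2 * H) k)
    with hA
  have hcell : ∀ k j, 2 ≤ k → k + 3 ≤ 2 * H → j < 4 * (2 * H) ^ 2 →
      ∃ X ∈ Set.range x, X ∈ p.cellAt (2 * H) k j :=
    fun k j h1 h2 h3 => exists_mem_of_hits_pos (h.hits_cell k j h1 h2 h3)
  -- `F` contains at most the leftmost tail point. Every other tail point has a predecessor at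
  -- distance at least `g`, which excludes edges to the body outside the belt.
  obtain ⟨F, hF, hF'⟩ : ∃ F : Finset (Fin n), F.card ≤ 1 ∧
      ∀ i ∈ T, i ∉ F → ∃ j ∈ T, x j 0 + g ≤ x i 0 := by
    rcases T.eq_empty_or_nonempty with hT0 | hT0
    · exact ⟨∅, by simp, by simp [hT0]⟩
    · obtain ⟨j, hj, hmin⟩ := T.exists_min_image (fun i => x i 0) hT0
      refine ⟨{j}, by simp, fun i hi hij => ⟨j, hj, ?_⟩⟩
      have hij' : i ≠ j := by simpa using hij
      have h1 : x i ∈ tailPart τ 0 2 := by simpa [hT] using hi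
      have h2 : x j ∈ tailPart τ 0 2 := by simpa [hT] using hj
      have h3 := h.gap i j hij' h1.1 h2.1
      have h4 := hmin i hi
      rw [abs_of_nonneg (by linarith)] at h3
      linarith
  have hbelt : ∀ i j, (delaunayGraph (Set.range x)).Adj (x i) (x j) →
      x i 0 ≤ -(2 * (p.ρ * p.w)) → j ∈ T → j ∉ F → i ∈ B := by
    intro i j hij hi hj hjF
    obtain ⟨r, hr, hrj⟩ := hF' j hj hjF
    have h2 : x r ∈ tailPart τ 0 2 := by simpa [hT] using hr
    have := p.mem_belt_of_adj hH hcell (h.mem_surf i) (h.mem_surf j) (h.mem_surf r) ⟨r, rfl⟩ hi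
      hL hLH hτ hτ1 hg hg1 h2.1 hrj hsmall hij
    exact Finset.mem_filter.2 ⟨Finset.mem_univ i, hi, this⟩
  -- Pairs of slabs with indices differing by at most 3: seven neighbours for each of `2 * H` slabs,
  -- hence at most `14 * H` pairs.
  set W : Finset (ℕ × ℕ) := (Finset.range (2 * H) ×ˢ Finset.range (2 * H)).filter
    (fun q => q.1 ≤ q.2 + 3 ∧ q.2 ≤ q.1 + 3) with hW
  have hWcard : W.card ≤ 14 * H := by
    have : W ⊆ (Finset.range (2 * H) ×ˢ Finset.range 7).image
        (fun q => (q.1, q.1 + q.2 - 3)) := by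
      rintro ⟨k, l⟩ hkl
      simp only [hW, Finset.mem_filter, Finset.mem_product, Finset.mem_range] at hkl
      simp only [Finset.mem_image, Finset.mem_product, Finset.mem_range, Prod.exists,
        Prod.mk.injEq]
      exact ⟨k, l + 3 - k, ⟨by omega, by omega⟩, rfl, by omega⟩
    refine (Finset.card_le_card this).trans (Finset.card_image_le.trans ?_)
    simp only [Finset.card_product, Finset.card_range]
    omega
  -- Every sample point is in the joint, the tail or the body. Edges meeting the joint or `F` are
  -- counted trivially, tail-body edges through the belt, body-body edges through `W`.
  have hcover := delaunayComplexity_range_le (x := x)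
    (Z ×ˢ U ∪ U ×ˢ Z ∪ T ×ˢ T ∪ W.biUnion (fun q => A q.1 ×ˢ A q.2) ∪ B ×ˢ T ∪ T ×ˢ B ∪
      F ×ˢ U ∪ U ×ˢ F) (by
    intro i j hij
    have hclass : ∀ i, i ∈ Z ∨ i ∈ T ∨ x i 0 ≤ -(2 * (p.ρ * p.w)) := by
      intro i
      rcases le_or_gt (x i 0) (-(2 * (p.ρ * p.w))) with h1 | h1
      · exact Or.inr (Or.inr h1)
      rcases lt_or_ge (x i 0) τ with h2 | h2
      · left
        exact Finset.mem_filter.2 ⟨Finset.mem_univ i, h1, h2⟩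
      · right; left
        simpa [hT] using (mem_tailPart_iff hτ.le (x i)).2 h2
    simp only [Finset.mem_union, Finset.mem_product, Finset.mem_biUnion, U, Finset.mem_univ,
      and_true, true_and]
    rcases hclass i with hi | hi | hi
    · simp [hi]
    · rcases hclass j with hj | hj | hj
      · simp [hj]
      · simp [hi, hj]
      · by_cases hiF : i ∈ F
        · simp [hiF]
        · have := hbelt j i hij.symm hj hi hiF
          simp [this, hi]
    · rcases hclass j with hj | hj | hj
      · simp [hj]
      · by_cases hjF : j ∈ F
        · simp [hjF]
        · have := hbelt i j hij hi hj hjF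
          simp [this, hj]
      · obtain ⟨k, hk, hik⟩ := p.exists_slabAt (by omega : 1 ≤ 2 * H) (h.mem_surf i) hi
        obtain ⟨l, hl, hjl⟩ := p.exists_slabAt (by omega : 1 ≤ 2 * H) (h.mem_surf j) hj
        have h1 := p.slab_le_of_adj (by omega) hcell (h.mem_surf i) (h.mem_surf j) hk hik hjl hij
        have h2 := p.slab_le_of_adj (by omega) hcell (h.mem_surf j) (h.mem_surf i) hl hjl hik
          hij.symm
        have h3 : (k, l) ∈ W := by
          simp only [hW, Finset.mem_filter, Finset.mem_product, Finset.mem_range]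
          exact ⟨⟨hk, hl⟩, h1, h2⟩
        have h4 : ∃ q ∈ W, i ∈ A q.1 ∧ j ∈ A q.2 :=
          ⟨(k, l), h3, by simpa [hA] using hik, by simpa [hA] using hjl⟩
        simp [h4])
  have hZc : (Z.card : ℝ) ≤ z := h.hits_joint
  have hTc : (T.card : ℝ) ≤ t := h.hits_tail
  have hBc : (B.card : ℝ) ≤ b := h.hits_belt
  have hFc : (F.card : ℝ) ≤ 1 := by exact_mod_cast hF
  have hAc : ((W.biUnion (fun q => A q.1 ×ˢ A q.2)).card : ℝ) ≤ 14 * H * s ^ 2 := by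
    have h1 : ((W.biUnion (fun q => A q.1 ×ˢ A q.2)).card : ℝ) ≤
        ∑ q ∈ W, ((A q.1 ×ˢ A q.2).card : ℝ) := by exact_mod_cast Finset.card_biUnion_le
    refine h1.trans ((Finset.sum_le_card_nsmul W _ (s ^ 2) ?_).trans ?_)
    · intro q hq
      simp only [hW, Finset.mem_filter, Finset.mem_product, Finset.mem_range] at hq
      rw [Finset.card_product]
      push_cast
      have e1 : ((A q.1).card : ℝ) ≤ s := h.hits_slab q.1 hq.1.1
      have e2 : ((A q.2).card : ℝ) ≤ s := h.hits_slab q.2 hq.1.2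
      rw [sq]
      exact mul_le_mul e1 e2 (Nat.cast_nonneg _) ((Nat.cast_nonneg _).trans e1)
    · rw [nsmul_eq_mul]
      gcongr
      exact_mod_cast hWcard
  have hU : U.card = n := by simp [U]
  have hcard : (delaunayComplexity (Set.range x) : ℝ) ≤
      Z.card * n + n * Z.card + T.card * T.card +
      ((W.biUnion (fun q => A q.1 ×ˢ A q.2)).card : ℝ) + B.card * T.card + T.card * B.card +
      F.card * n + n * F.card := by
    refine le_trans (Nat.cast_le.2 hcover) ?_
    have h1 := (Finset.card_union_le (Z ×ˢ U ∪ U ×ˢ Z ∪ T ×ˢ T ∪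
      W.biUnion (fun q => A q.1 ×ˢ A q.2) ∪ B ×ˢ T ∪ T ×ˢ B ∪ F ×ˢ U) (U ×ˢ F)).trans
      (Nat.add_le_add_right ((Finset.card_union_le _ _).trans
      (Nat.add_le_add_right ((Finset.card_union_le _ _).trans
      (Nat.add_le_add_right ((Finset.card_union_le _ _).trans
      (Nat.add_le_add_right ((Finset.card_union_le _ _).trans
      (Nat.add_le_add_right ((Finset.card_union_le _ _).trans
      (Nat.add_le_add_right (Finset.card_union_le _ _) _)) _)) _)) _)) _)) _)
    simp only [Finset.card_product, hU] at h1
    exact_mod_cast h1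
  have hn : (0 : ℝ) ≤ n := Nat.cast_nonneg n
  have hT0 : (0 : ℝ) ≤ T.card := Nat.cast_nonneg _
  have ht0 : 0 ≤ t := hT0.trans hTc
  have hb0 : 0 ≤ b := (Nat.cast_nonneg _).trans hBc
  have e1 : (Z.card : ℝ) * n ≤ n * z := by rw [mul_comm]; gcongr
  have e2 : (T.card : ℝ) * T.card ≤ t ^ 2 := by rw [sq]; gcongr
  have e3 : (B.card : ℝ) * T.card ≤ b * t := by gcongr
  have e4 : (F.card : ℝ) * n ≤ n := by nlinarith
  linarith

end TubeParams

end Counting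

/-! ### Choice of the parameters and the resulting probabilities -/

section Masses

namespace TubeParams

/-- The gap `g` comes first, which is legitimate because the probability of a small gap is bounded
independently of `η` and `ρ`. Then `η` is of order `g ^ 3`, so `η ^ 2` is far below `g ^ 5` and `L ^
2 * η` below `g / K ^ 2`. Last comes `ρ`, with `ρ / η` of order `g ^ 5`. -/
theorem exists_of_small {K : ℕ} (hK : 3 ≤ K) {L g : ℝ} (hL : 1 ≤ L) (hg : 0 < g)
    (hsmall : 3 * (L * K * g) ≤ 1) :
    ∃ p : TubeParams, p.w = 1 / (K : ℝ) ^ 2 ∧ p.ε = p.ρ ^ 2 / L ∧ p.ρ ≤ p.η ∧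
      322752 * p.η ^ 2 + 9 * (p.ρ / p.η) ≤ g ^ 5 / 192 ∧
      2000 * L ^ 2 * (81 * p.η + p.ρ) < (1 / (K : ℝ)) ^ 2 * g := by
  have hK0 : (3 : ℝ) ≤ K := by exact_mod_cast hK
  have hl := one_le_lipConst
  have hKg : (K : ℝ) * g ≤ 1 / 3 := by
    have : 1 * (K * g) ≤ L * (K * g) := by gcongr
    linarith
  have hg1 : g ≤ 1 / 3 := by
    have : 1 * g ≤ K * g := by gcongr; linarith
    linarith
  have hg2 : ∀ m : ℕ, g ^ m ≤ 1 := fun m => pow_le_one₀ hg.le (by linarith)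
  set η := g ^ 3 / (20000 * lipConst) with hη
  have hη0 : 0 < η := by positivity
  have hηg : η ≤ g ^ 3 / 20000 := by
    rw [hη]
    gcongr
    linarith
  set ρ := η * g ^ 5 / 3600 with hρ
  have hρ0 : 0 < ρ := by positivity
  have hρη : ρ ≤ η := by
    have : η * g ^ 5 ≤ η * 1 := by gcongr; exact hg2 5
    rw [hρ]; linarith
  have hη1 : η ≤ 1 / 20000 := by linarith [hg2 3]
  have hρg : ρ ≤ g ^ 2 := by
    have : g ^ 3 ≤ g ^ 2 := pow_le_pow_of_le_one hg.le (by linarith) (by norm_num)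
    have := pow_pos hg 2
    linarith
  refine ⟨⟨ρ, ρ ^ 2 / L, 1 / (K : ℝ) ^ 2, η, hρ0, by linarith, by positivity, ?_, by positivity, ?_,
    hη0, ?_⟩, rfl, rfl, hρη, ?_, ?_⟩
  · rw [div_le_iff₀ (by linarith), mul_one_div, div_mul_eq_mul_div, le_div_iff₀ (by positivity)]
    have h1 : ρ * K ^ 2 ≤ 1 := by
      calc ρ * K ^ 2 ≤ g ^ 2 * K ^ 2 := by gcongr
        _ = (K * g) ^ 2 := by ring
        _ ≤ 1 := pow_le_one₀ (by positivity) (by linarith)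
    calc ρ ^ 2 * K ^ 2 = ρ * (ρ * K ^ 2) := by ring
      _ ≤ ρ * L := by gcongr; linarith
  · rw [div_le_div_iff₀ (by positivity) (by norm_num)]
    have : (3 : ℝ) ^ 2 ≤ (K : ℝ) ^ 2 := by gcongr
    linarith
  · have : η * lipConst = g ^ 3 / 20000 := by rw [hη]; field_simp
    rw [this]
    linarith [hg2 3]
  · change 322752 * η ^ 2 + 9 * (ρ / η) ≤ g ^ 5 / 192
    have h1 : ρ / η = g ^ 5 / 3600 := by rw [hρ]; field_simp
    have h2 : η ^ 2 ≤ (g ^ 3 / 20000) ^ 2 := by gcongr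
    have h3 : (g ^ 3 / 20000) ^ 2 = g ^ 6 / 400000000 := by ring
    have h4 : g ^ 6 ≤ g ^ 5 := pow_le_pow_of_le_one hg.le (by linarith) (by norm_num)
    have h5 := pow_pos hg 5
    rw [h1]
    rw [h3] at h2
    linarith
  · change 2000 * L ^ 2 * (81 * η + ρ) < (1 / (K : ℝ)) ^ 2 * g
    have h1 : 2000 * L ^ 2 * (81 * η + ρ) ≤ 2000 * L ^ 2 * (82 * (g ^ 3 / 20000)) := by
      gcongr
      linarith
    refine h1.trans_lt ?_
    have h2 : (L * K * g) ^ 2 ≤ (1 / 3) ^ 2 := by gcongr; linarith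
    rw [div_pow, one_pow, div_mul_eq_mul_div, one_mul, lt_div_iff₀ (by positivity)]
    calc _ = 8.2 * (L * K * g) ^ 2 * g := by ring
      _ ≤ 8.2 * (1 / 3) ^ 2 * g := by gcongr
      _ < g := by norm_num; linarith

variable (p : TubeParams)

/-- A cell has height at least `2ρ / K ^ 2`, radius at least `ρ / (2 * K)` and angular width with
sine at least `1 / K ^ 2`; the product has order `ρ ^ 2 / K ^ 5`. Omitting two slabs at each pole
gives the bound on the radius and, with `w = 1 / K ^ 2`, avoids the transition. -/
theorem le_real_cellAt {K k j : ℕ} (hk : 2 ≤ k) (hkK : k + 3 ≤ K) (hw : p.w = 1 / (K : ℝ) ^ 2)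
    (hε : p.ε ≤ p.ρ ^ 2) :
    1 / (192000 * lipConst * (K : ℝ) ^ 5) ≤ (uniformOnSurface p.surf).real (p.cellAt K k j) := by
  have hρ := p.ρ_pos
  have hpi := Real.pi_pos
  have hK0 : (5 : ℝ) ≤ K := by exact_mod_cast (by omega : 5 ≤ K)
  have hl := one_le_lipConst
  have h0 : p.node K 0 = 0 := by simp [node]
  have hend : p.node K K = -(2 * p.ρ) := by
    rw [node, show (K : ℝ) * (Real.pi / K) = Real.pi by field_simp, Real.cos_pi]
    ring
  have hgap : ∀ i, i + 1 ≤ K → 2 * p.ρ / K ^ 2 ≤ p.node K i - p.node K (i + 1) :=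
    fun i hi => p.node_gap hi
  set d := 2 * p.ρ / (K : ℝ) ^ 2 with hd
  have hd0 : 0 < d := by positivity
  have hdρ : d ≤ p.ρ := by
    rw [hd, div_le_iff₀ (by positivity), mul_comm]
    gcongr
    nlinarith
  have hb : p.node K k ≤ -(2 * d) := by
    have e1 := hgap 0 (by omega)
    have e2 := hgap 1 (by omega)
    have e3 := p.node_antitone hk (by omega : k ≤ K)
    norm_num at e1 e2
    linarith
  have ha : -(2 * p.ρ) + d ≤ p.node K (k + 1) := by
    have e1 := hgap (K - 1) (by omega)
    rw [Nat.sub_add_cancel (by omega), hend] at e1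
    have e3 := p.node_antitone (by omega : k + 1 ≤ K - 1) (by omega : K - 1 ≤ K)
    linarith
  set δ := 2 * Real.pi / (4 * K ^ 2 : ℕ) with hδ
  have hδe : δ = Real.pi / (2 * K ^ 2) := by rw [hδ]; push_cast; field_simp; ring
  have hδ0 : 0 < δ := by rw [hδe]; positivity
  have hδ1 : δ ≤ Real.pi / 2 := by
    rw [hδe]
    gcongr
    nlinarith
  have hsin : 1 / (K : ℝ) ^ 2 ≤ Real.sin δ := by
    refine le_trans (le_of_eq ?_) (Real.mul_le_sin hδ0.le hδ1)
    rw [hδe]; field_simp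
  have hm : ∀ x ∈ Set.Icc (p.node K (k + 1)) (p.node K k),
      p.ρ / K ^ 3 / 2 ≤ p.radius x * Real.sin δ := by
    intro x hx
    have hx1 : -(2 * p.ρ) + d ≤ x := ha.trans hx.1
    have hx2 : x ≤ -(2 * d) := hx.2.trans hb
    have hwd : p.ρ * p.w = d / 2 := by rw [hw, hd]; ring
    have hr : p.ρ / K / 2 ≤ p.radius x := by
      rw [p.radius_of_le (by rw [hwd]; linarith)]
      gcongr
      apply Real.le_sqrt_of_sq_le
      have hsq : (p.ρ / K) ^ 2 = d * p.ρ / 2 := by rw [hd]; field_simp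
      rw [hsq]
      rcases le_total x (-p.ρ) with h | h
      · nlinarith
      · nlinarith
    calc p.ρ / K ^ 3 / 2 = p.ρ / K / 2 * (1 / K ^ 2) := by field_simp
      _ ≤ p.radius x * Real.sin δ := by
        apply mul_le_mul hr hsin (by positivity) (p.radius_nonneg x)
  have hgk := hgap k (by omega)
  have harea := p.le_surfaceArea_cell (θ := 2 * Real.pi / (4 * K ^ 2 : ℕ) * j) (by linarith)
    (by linarith) (by linarith) hδ0.le hδ1 hm
  have hsub : p.cellAt K k j ⊆ p.surf := p.cell_subset_surf (by linarith) (by linarith)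
  have harea' : ENNReal.ofReal (p.ρ ^ 2 / (16 * K ^ 5)) ≤
      surfaceArea (p.surf ∩ p.cellAt K k j) := by
    rw [Set.inter_eq_right.2 hsub]
    refine le_trans (ENNReal.ofReal_le_ofReal ?_) harea
    calc p.ρ ^ 2 / (16 * K ^ 5) = d * (p.ρ / K ^ 3 / 2) / 16 := by rw [hd]; field_simp
      _ ≤ _ := by gcongr
  refine le_trans (le_of_eq ?_) ((p.le_real_of_le_surfaceArea hε (p.measurableSet_cell _ _ _ _)
    harea'))
  field_simp
  norm_num

theorem real_slabAt_le {K k : ℕ} (hk : k < K) :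
    (uniformOnSurface p.surf).real (p.slabAt K k) ≤ 102400 / K := by
  have hpi := Real.pi_pos
  have hK0 : (0 : ℝ) < K := by exact_mod_cast (by omega : 0 < K)
  refine (p.real_zone_le (by positivity) ?_ (mul_pi_div_le hk)).trans ?_
  · gcongr; linarith
  · push_cast
    rw [show 25600 * (((k : ℝ) + 1) * (Real.pi / K) - k * (Real.pi / K)) = 25600 * Real.pi / K by
      ring]
    gcongr
    linarith [Real.pi_lt_four]

theorem measurableSet_belt (L : ℝ) : MeasurableSet (p.belt L) := by
  have h := measurable_coord 0
  exact (measurableSet_le h measurable_const).inter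
    (measurableSet_lt (continuous_abs.measurable.comp (h.add_const p.ρ)) measurable_const)

theorem real_belt_le {L : ℝ} (hL : 2 ≤ L) :
    (uniformOnSurface p.surf).real (p.belt L) ≤ 102400 / L := by
  have hρ := p.ρ_pos
  have hpi := Real.pi_gt_three
  have h1 : 2 / L ≤ 1 := by rw [div_le_one (by linarith)]; exact hL
  have h2 : 0 < 2 / L := by positivity
  -- Abscissa `ρ / L` from the centre corresponds to polar angle at most `2 / L` from the equator.
  have hsin : 1 / L ≤ Real.sin (2 / L) := by
    have := Real.mul_le_sin h2.le (by linarith)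
    refine le_trans ?_ this
    rw [div_mul_div_comm, div_le_div_iff₀ (by linarith) (by positivity)]
    nlinarith [Real.pi_lt_four]
  have hsub : p.belt L ⊆ p.zone (Real.pi / 2 - 2 / L) (Real.pi / 2 + 2 / L) := by
    rintro X ⟨hX, habs⟩
    rw [abs_lt] at habs
    have h3 : p.ρ * (1 / L) ≤ p.ρ * Real.sin (2 / L) := by gcongr
    rw [mul_one_div] at h3
    refine ⟨?_, ?_, hX⟩
    · rw [add_comm, Real.cos_add_pi_div_two]
      linarith
    · rw [Real.cos_pi_div_two_sub]
      linarith
  refine (measureReal_mono hsub).trans ((p.real_zone_le (by linarith) (by linarith)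
    (by linarith)).trans (le_of_eq ?_))
  ring

variable {p}

theorem real_tail_le {L τ : ℝ} (hL : 0 < L) (hτ : 0 ≤ τ) (hε : p.ε = p.ρ ^ 2 / L) :
    (uniformOnSurface p.surf).real (tailPart τ 0 2) ≤ 409600 / L := by
  have hρ := p.ρ_pos
  have hw := p.ρw_pos
  refine (p.real_tailPart_le (by linarith) le_rfl (by norm_num) le_rfl).trans (le_of_eq ?_)
  rw [hε]
  field_simp
  norm_num

/-- Because `ε / ρ ^ 2 = 1 / L ≤ 1`, the bound is the same for all admissible parameters; this
avoids circularity in the choice of `g`. -/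
theorem real_tailPart_le_of_eq {L τ a b : ℝ} (hL : 1 ≤ L) (hτ : 0 ≤ τ) (hε : p.ε = p.ρ ^ 2 / L)
    (ha : 0 ≤ a) (hab : a ≤ b) (hb : b ≤ 2) :
    (uniformOnSurface p.surf).real (tailPart τ a b) ≤ 204800 * (b - a) := by
  have hρ := p.ρ_pos
  have hw := p.ρw_pos
  refine (p.real_tailPart_le (by linarith) ha hab hb).trans ?_
  have h1 : p.ε / p.ρ ^ 2 = 1 / L := by rw [hε]; field_simp
  rw [h1]
  have h2 : 0 ≤ 204800 * (b - a) := by linarith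
  exact mul_le_of_le_one_right h2 (by rw [div_le_one (by linarith)]; exact hL)

theorem real_joint_le_of_eq {K : ℕ} {L : ℝ} (hK : 1 ≤ K) (hL : 1 ≤ L)
    (hw : p.w = 1 / (K : ℝ) ^ 2) (hε : p.ε = p.ρ ^ 2 / L) :
    (uniformOnSurface p.surf).real (p.joint (1 / K)) ≤ 1638400 * lipConst / K := by
  have hρ := p.ρ_pos
  have hρ1 := p.ρ_le
  have hl := one_le_lipConst
  have hK0 : (1 : ℝ) ≤ K := by exact_mod_cast hK
  have hK2 : 1 / (K : ℝ) ^ 2 ≤ 1 / K := by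
    apply one_div_le_one_div_of_le (by linarith)
    nlinarith
  have hKle : 1 / (K : ℝ) ≤ 1 := by rw [div_le_one (by linarith)]; exact hK0
  have hKpos : 0 < 1 / (K : ℝ) := by positivity
  refine (p.real_joint_le hKpos.le hKle).trans ?_
  have h1 : p.ε / p.ρ ^ 2 = 1 / L := by rw [hε]; field_simp
  have h2 : 1 / L ≤ 1 := by rw [div_le_one (by linarith)]; exact hL
  rw [h1, hw]
  calc 1228800 * lipConst * (1 / (K : ℝ) ^ 2) + 204800 * (p.ρ * (1 / (K : ℝ) ^ 2) + 1 / K) * (1 / L)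
      ≤ 1228800 * lipConst * (1 / (K : ℝ)) + 204800 * (1 * (1 / (K : ℝ)) + 1 / K) * 1 := by
        gcongr
        linarith
    _ = 1228800 * lipConst * (1 / (K : ℝ)) + 409600 * 1 * (1 / K) := by ring
    _ ≤ 1228800 * lipConst * (1 / (K : ℝ)) + 409600 * lipConst * (1 / K) := by gcongr
    _ = _ := by ring

theorem le_real_middle_of_eq {L : ℝ} (hL : 1 ≤ L) (hε : p.ε = p.ρ ^ 2 / L) :
    1 / (192000 * lipConst * L) ≤ (uniformOnSurface p.surf).real middle := by
  have hρ := p.ρ_pos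
  have hl := one_le_lipConst
  refine le_trans (le_of_eq ?_) (p.le_real_middle ?_)
  · rw [hε]; field_simp
  · rw [hε]
    exact div_le_self (by positivity) hL

end TubeParams

end Masses

/-! ### A random sample is typical with high probability -/

section TypicalSamples

namespace TubeParams

variable {p : TubeParams}

/-- A birthday estimate in the parameter `√(3 - x)`, whose distribution has bounded density: `n ^ 2`
pairs, `2 * G` windows, and probability of order `1 / G ^ 2` that both points fall in a given
window. -/
theorem measure_exists_close_le {L τ : ℝ} (hL : 1 ≤ L) (hτ : 0 ≤ τ) (hε : p.ε = p.ρ ^ 2 / L)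
    {n G : ℕ} (hG : 10 ≤ G) :
    (Measure.pi (fun _ : Fin n => uniformOnSurface p.surf)).real
      {x | ∃ i j, i ≠ j ∧ τ ≤ x i 0 ∧ τ ≤ x j 0 ∧ |√(3 - x i 0) - √(3 - x j 0)| < 1 / G} ≤
      2 * 409600 ^ 2 * (n : ℝ) ^ 2 / G := by
  classical
  have hG0 : (10 : ℝ) ≤ G := by exact_mod_cast hG
  set I := (Finset.univ : Finset (Fin n)).offDiag ×ˢ Finset.range (2 * G - 1) with hI
  -- Windows of length `2 / G` in steps of `1 / G`: two parameters closer than `1 / G` always share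
  -- one.
  set R : ℕ → Set E3 := fun k => tailPart τ (k / G) ((k + 2 : ℕ) / G) with hR
  have hsub : {x : Fin n → E3 | ∃ i j, i ≠ j ∧ τ ≤ x i 0 ∧ τ ≤ x j 0 ∧
      |√(3 - x i 0) - √(3 - x j 0)| < 1 / G} ⊆
      ⋃ q ∈ I, {x | x q.1.1 ∈ R q.2 ∧ x q.1.2 ∈ R q.2} := by
    have hle : ∀ (x : Fin n → E3) (i j : Fin n), i ≠ j → τ ≤ x i 0 → τ ≤ x j 0 →
        √(3 - x i 0) ≤ √(3 - x j 0) → √(3 - x j 0) < √(3 - x i 0) + 1 / G →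
        x ∈ ⋃ q ∈ I, {x : Fin n → E3 | x q.1.1 ∈ R q.2 ∧ x q.1.2 ∈ R q.2} := by
      intro x i j hij hi hj h1 h2
      set r := √(3 - x i 0)
      have hr0 : 0 ≤ r := Real.sqrt_nonneg _
      -- Here `√3 < 1.8`, and with `G ≥ 10` the window of the smaller parameter ends before `2`.
      have hr : r ≤ 1.8 := by
        rw [Real.sqrt_le_left (by norm_num)]
        norm_num; linarith
      set k := ⌊r * G⌋₊ with hk
      have hk1 : (k : ℝ) ≤ r * G := Nat.floor_le (by positivity)
      have hk2 : r * G < k + 1 := Nat.lt_floor_add_one _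
      have hkG : (k : ℝ) + 2 ≤ 2 * G := by nlinarith
      have hkG' : k + 2 ≤ 2 * G := by exact_mod_cast hkG
      simp only [Set.mem_iUnion]
      refine ⟨((i, j), k), ?_, ⟨hi, ?_, ?_⟩, ⟨hj, ?_, ?_⟩⟩
      · simp only [hI, Finset.mem_product, Finset.mem_offDiag, Finset.mem_univ, Finset.mem_range,
          true_and]
        exact ⟨hij, by omega⟩
      · change (k : ℝ) / G ≤ r
        rwa [div_le_iff₀ (by linarith)]
      · change r ≤ ((k + 2 : ℕ) : ℝ) / G
        rw [le_div_iff₀ (by linarith)]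
        push_cast; linarith
      · change (k : ℝ) / G ≤ _
        refine le_trans ?_ h1
        rwa [div_le_iff₀ (by linarith)]
      · change _ ≤ ((k + 2 : ℕ) : ℝ) / G
        refine h2.le.trans ?_
        rw [le_div_iff₀ (by linarith), add_mul, one_div, inv_mul_cancel₀ (by linarith)]
        push_cast; linarith
    rintro x ⟨i, j, hij, hi, hj, hlt⟩
    rw [abs_lt] at hlt
    rcases le_total (√(3 - x i 0)) (√(3 - x j 0)) with h | h
    · exact hle x i j hij hi hj h (by linarith)
    · exact hle x j i hij.symm hj hi h (by linarith)
  refine (measureReal_mono hsub (measure_ne_top _ _)).trans ((measureReal_biUnion_finset_le _ _).trans ?_)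
  have hterm : ∀ q ∈ I, (Measure.pi (fun _ : Fin n => uniformOnSurface p.surf)).real
      {x | x q.1.1 ∈ R q.2 ∧ x q.1.2 ∈ R q.2} ≤ (409600 / G) ^ 2 := by
    intro q hq
    simp only [hI, Finset.mem_product, Finset.mem_offDiag, Finset.mem_univ, Finset.mem_range,
      true_and] at hq
    rw [measure_two_mem_eq _ _ hq.1]
    have hk : ((q.2 + 2 : ℕ) : ℝ) ≤ 2 * G := by exact_mod_cast (by omega : q.2 + 2 ≤ 2 * G)
    have h := real_tailPart_le_of_eq (p := p) (a := q.2 / G) (b := ((q.2 + 2 : ℕ) : ℝ) / G) hL hτ hε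
      (by positivity) (by gcongr; simp) (by rw [div_le_iff₀ (by linarith)]; exact hk)
    gcongr
    refine h.trans (le_of_eq ?_)
    push_cast
    ring
  refine (Finset.sum_le_card_nsmul I _ _ hterm).trans ?_
  have hcard : (I.card : ℝ) ≤ n ^ 2 * (2 * G) := by
    have h1 : I.card ≤ n ^ 2 * (2 * G) := by
      simp only [hI, Finset.card_product, Finset.offDiag_card, Finset.card_univ, Fintype.card_fin,
        Finset.card_range]
      exact Nat.mul_le_mul (by rw [sq]; omega) (by omega)
    exact_mod_cast h1
  rw [nsmul_eq_mul]
  calc (I.card : ℝ) * (409600 / G) ^ 2 ≤ n ^ 2 * (2 * G) * (409600 / G) ^ 2 := by gcongr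
    _ = _ := by field_simp

/-- A union bound. Thresholds are four times the upper bounds for expected counts, or a quarter of
the lower bound for the middle. The rarest regions, the cells with mass of order `1 / K ^ 5`,
dictate the condition on `u`. -/
theorem measure_not_typical_le {n H G : ℕ} {L u : ℝ} (hH : 1 ≤ H) (hL : 2 ≤ L)
    (hLK : L ≤ (2 * H : ℕ)) (hG : 10 ≤ G) (hw : p.w = 1 / ((2 * H : ℕ) : ℝ) ^ 2)
    (hε : p.ε = p.ρ ^ 2 / L) (hu0 : 0 ≤ u)
    (hu : u * (768000 * lipConst * ((2 * H : ℕ) : ℝ) ^ 5) ≤ n) :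
    (Measure.pi (fun _ : Fin n => uniformOnSurface p.surf)).real
      {x | ¬ p.Typical H L (1 / (2 * H : ℕ)) ((1 / G) ^ 2) (409600 * n / (2 * H : ℕ))
        (6553600 * lipConst * n / (2 * H : ℕ)) (1638400 * n / L) (409600 * n / L)
        (n / (768000 * lipConst * L)) x} ≤
      9 * ((2 * H : ℕ) : ℝ) ^ 3 * Real.exp (-u) + 2 * 409600 ^ 2 * (n : ℝ) ^ 2 / G := by
  classical
  set K := 2 * H with hK
  have hK2 : 2 ≤ K := by omega
  have hK0 : (2 : ℝ) ≤ K := by exact_mod_cast hK2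
  have hG0 : (10 : ℝ) ≤ G := by exact_mod_cast hG
  have hl := one_le_lipConst
  have hn : (0 : ℝ) ≤ n := Nat.cast_nonneg n
  have hL0 : 0 < L := by linarith
  have hρ := p.ρ_pos
  have hε' : p.ε ≤ p.ρ ^ 2 := by
    rw [hε]; exact div_le_self (by positivity) (by linarith)
  have hτ : 0 ≤ 1 / (K : ℝ) := by positivity
  set μ := uniformOnSurface p.surf with hμ
  set P := Measure.pi (fun _ : Fin n => μ) with hP
  have hnull : P.real {x | ∃ i, x i ∉ p.surf} = 0 := by
    rw [measureReal_def, measure_exists_notMem_eq_zero μ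
      (uniformOnSurface_compl p.isCompact_surf.isClosed.measurableSet), ENNReal.toReal_zero]
  have huK : u * K ≤ n := by
    refine le_trans ?_ hu
    have h1 : (K : ℝ) ≤ K ^ 5 := le_self_pow₀ (by linarith) (by norm_num)
    have h2 : 1 * (K : ℝ) ^ 5 ≤ 768000 * lipConst * K ^ 5 := by gcongr; linarith
    gcongr
    linarith
  have hmany : ∀ {R : Set E3} {C D : ℝ}, MeasurableSet R → 1 ≤ C → 0 < D → D ≤ K →
      μ.real R ≤ C / D →
      P.real {x | 4 * C * n / D ≤ hits R x} ≤ Real.exp (-u) := by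
    intro R C D hR hC hD hDK hRC
    refine (measure_le_hits_le μ hR (b := 4 * C * n / D) ?_).trans ?_
    · calc n * μ.real R ≤ n * (C / D) := by gcongr
        _ = _ := by ring
    · apply Real.exp_le_exp.2
      rw [neg_le_neg_iff, show 4 * C * n / D / 4 = C * n / D by ring, le_div_iff₀ hD]
      calc u * D ≤ u * K := by gcongr
        _ ≤ 1 * n := by linarith
        _ ≤ C * n := by gcongr
  have hcell : ∀ q ∈ Finset.range K ×ˢ Finset.range (4 * K ^ 2),
      P.real {x | (2 ≤ q.1 ∧ q.1 + 3 ≤ K) ∧ (hits (p.cellAt K q.1 q.2) x : ℝ) ≤ u} ≤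
        Real.exp (-u) := by
    intro q _
    by_cases hq : 2 ≤ q.1 ∧ q.1 + 3 ≤ K
    · refine (measureReal_mono fun x hx => hx.2).trans (measure_hits_le_le μ
        (p.measurableSet_cell _ _ _ _ : MeasurableSet (p.cellAt K q.1 q.2)) hu0 ?_)
      have h1 := p.le_real_cellAt (j := q.2) hq.1 hq.2 hw hε'
      calc 4 * u = u * (768000 * lipConst * (K : ℝ) ^ 5) *
            (1 / (192000 * lipConst * (K : ℝ) ^ 5)) := by field_simp; ring
        _ ≤ n * μ.real (p.cellAt K q.1 q.2) := by gcongr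
    · have : {x : Fin n → E3 | (2 ≤ q.1 ∧ q.1 + 3 ≤ K) ∧
          (hits (p.cellAt K q.1 q.2) x : ℝ) ≤ u} = ∅ := by
        ext x; simp only [Set.mem_ofPred_eq, Set.mem_empty_iff_false, iff_false]
        exact fun h => hq h.1
      rw [this, measureReal_empty]
      positivity
  have hslab : ∀ k ∈ Finset.range K,
      P.real {x | 4 * 102400 * n / K ≤ (hits (p.slabAt K k) x : ℝ)} ≤ Real.exp (-u) :=
    fun k hk => hmany (p.measurableSet_zone _ _) (by norm_num) (by linarith) le_rfl
      (p.real_slabAt_le (Finset.mem_range.1 hk))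
  have hjoint : P.real {x | 4 * (1638400 * lipConst) * n / K ≤ (hits (p.joint (1 / K)) x : ℝ)} ≤
      Real.exp (-u) :=
    hmany (p.measurableSet_joint _) (by linarith) (by linarith) le_rfl
      (real_joint_le_of_eq (by omega) (by linarith) hw hε)
  have htail : P.real {x | 4 * 409600 * n / L ≤ (hits (tailPart (1 / K) 0 2) x : ℝ)} ≤
      Real.exp (-u) :=
    hmany (measurableSet_tailPart _ _ _) (by norm_num) hL0 hLK (real_tail_le hL0 hτ hε)
  have hbelt : P.real {x | 4 * 102400 * n / L ≤ (hits (p.belt L) x : ℝ)} ≤ Real.exp (-u) :=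
    hmany (p.measurableSet_belt _) (by norm_num) hL0 hLK (p.real_belt_le hL)
  have hmiddle : P.real {x | (hits middle x : ℝ) ≤ n / (768000 * lipConst * L)} ≤
      Real.exp (-u) := by
    refine (measure_hits_le_le μ measurableSet_middle (by positivity) ?_).trans ?_
    · have h1 := le_real_middle_of_eq (p := p) (by linarith : 1 ≤ L) hε
      calc 4 * (n / (768000 * lipConst * L)) = n * (1 / (192000 * lipConst * L)) := by
            field_simp; ring
        _ ≤ _ := by gcongr
    · apply Real.exp_le_exp.2
      rw [neg_le_neg_iff, le_div_iff₀ (by positivity)]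
      refine le_trans ?_ hu
      gcongr
      exact hLK.trans (le_self_pow₀ (by linarith) (by norm_num))
  have hclose := measure_exists_close_le (p := p) (n := n) (by linarith : 1 ≤ L) hτ hε hG
  have hsub : {x : Fin n → E3 | ¬ p.Typical H L (1 / K) ((1 / G) ^ 2) (409600 * n / K)
        (6553600 * lipConst * n / K) (1638400 * n / L) (409600 * n / L)
        (n / (768000 * lipConst * L)) x} ⊆
      {x | ∃ i, x i ∉ p.surf} ∪
      (⋃ q ∈ Finset.range K ×ˢ Finset.range (4 * K ^ 2),
        {x | (2 ≤ q.1 ∧ q.1 + 3 ≤ K) ∧ (hits (p.cellAt K q.1 q.2) x : ℝ) ≤ u}) ∪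
      (⋃ k ∈ Finset.range K, {x | 4 * 102400 * n / K ≤ (hits (p.slabAt K k) x : ℝ)}) ∪
      {x | 4 * (1638400 * lipConst) * n / K ≤ (hits (p.joint (1 / K)) x : ℝ)} ∪
      {x | 4 * 409600 * n / L ≤ (hits (tailPart (1 / K) 0 2) x : ℝ)} ∪
      {x | 4 * 102400 * n / L ≤ (hits (p.belt L) x : ℝ)} ∪
      {x | (hits middle x : ℝ) ≤ n / (768000 * lipConst * L)} ∪
      {x | ∃ i j, i ≠ j ∧ 1 / (K : ℝ) ≤ x i 0 ∧ 1 / (K : ℝ) ≤ x j 0 ∧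
        |√(3 - x i 0) - √(3 - x j 0)| < 1 / G} := by
    intro x hx
    by_contra hnot
    apply hx
    simp only [Set.mem_union, Set.mem_ofPred_eq, Set.mem_iUnion, not_or, not_exists, not_and,
      not_not, not_le, not_lt] at hnot
    obtain ⟨⟨⟨⟨⟨⟨⟨h1, h2⟩, h3⟩, h4⟩, h5⟩, h6⟩, h7⟩, h8⟩ := hnot
    refine ⟨h1, ?_, ?_, ?_, ?_, ?_, h7.le, ?_⟩
    · intro k j hk hkK hj
      have := h2 (k, j) (Finset.mem_product.2
        ⟨Finset.mem_range.2 (by omega), Finset.mem_range.2 hj⟩) ⟨hk, hkK⟩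
      exact_mod_cast hu0.trans_lt this
    · intro k hk
      exact (h3 k (Finset.mem_range.2 hk)).le.trans (le_of_eq (by ring))
    · exact h4.le.trans (le_of_eq (by ring))
    · exact h5.le.trans (le_of_eq (by ring))
    · exact h6.le.trans (le_of_eq (by ring))
    · intro i j hij hi hj
      have h9 := h8 i j hij hi hj
      have hi3 := (h1 i).2.1
      have hj3 := (h1 j).2.1
      have e1 := Real.sq_sqrt (by linarith : 0 ≤ 3 - x i 0)
      have e2 := Real.sq_sqrt (by linarith : 0 ≤ 3 - x j 0)
      have r1 := Real.sqrt_nonneg (3 - x i 0)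
      have r2 := Real.sqrt_nonneg (3 - x j 0)
      set r := √(3 - x i 0)
      set r' := √(3 - x j 0)
      -- Near the tip the abscissa is quadratic in the parameter, so a parameter gap `1 / G`
      -- guarantees only an abscissa gap `(1 / G) ^ 2`.
      have hle : |r - r'| ≤ |r + r'| := by
        rw [abs_of_nonneg (by linarith : 0 ≤ r + r')]
        exact abs_sub_le_of_nonneg_of_le r1 (by linarith) r2 (by linarith)
      have hprod : |x i 0 - x j 0| = |r - r'| * |r + r'| := by
        rw [← abs_mul, ← abs_neg]
        congr 1
        linear_combination e2 - e1
      rw [hprod, sq]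
      exact mul_le_mul h9 (h9.trans hle) (by positivity) (abs_nonneg _)
  refine (measureReal_mono hsub (measure_ne_top _ _)).trans ?_
  have hcells : P.real (⋃ q ∈ Finset.range K ×ˢ Finset.range (4 * K ^ 2),
      {x | (2 ≤ q.1 ∧ q.1 + 3 ≤ K) ∧ (hits (p.cellAt K q.1 q.2) x : ℝ) ≤ u}) ≤
      4 * K ^ 3 * Real.exp (-u) := by
    refine (measureReal_biUnion_finset_le _ _).trans
      ((Finset.sum_le_card_nsmul _ _ _ hcell).trans (le_of_eq ?_))
    rw [nsmul_eq_mul, Finset.card_product, Finset.card_range, Finset.card_range]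
    push_cast
    ring
  have hslabs : P.real (⋃ k ∈ Finset.range K,
      {x | 4 * 102400 * n / K ≤ (hits (p.slabAt K k) x : ℝ)}) ≤ K * Real.exp (-u) := by
    refine (measureReal_biUnion_finset_le _ _).trans
      ((Finset.sum_le_card_nsmul _ _ _ hslab).trans (le_of_eq ?_))
    rw [nsmul_eq_mul, Finset.card_range]
  refine (measureReal_union_le _ _).trans (add_le_add ?_ hclose)
  -- There are `4 * K ^ 3` cells, `K` slabs and four single regions.
  have hK3 : 4 * (K : ℝ) ^ 3 + K + 4 ≤ 9 * K ^ 3 := by nlinarith [sq_nonneg ((K : ℝ) - 2)]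
  have hexp := Real.exp_pos (-u)
  have hfin : 4 * (K : ℝ) ^ 3 * Real.exp (-u) + K * Real.exp (-u) + Real.exp (-u) +
      Real.exp (-u) + Real.exp (-u) + Real.exp (-u) ≤ 9 * K ^ 3 * Real.exp (-u) := by
    calc _ = (4 * (K : ℝ) ^ 3 + K + 4) * Real.exp (-u) := by ring
      _ ≤ _ := by gcongr
  refine le_trans ?_ hfin
  refine (measureReal_union_le _ _).trans (add_le_add ?_ hmiddle)
  refine (measureReal_union_le _ _).trans (add_le_add ?_ hbelt)
  refine (measureReal_union_le _ _).trans (add_le_add ?_ htail)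
  refine (measureReal_union_le _ _).trans (add_le_add ?_ hjoint)
  refine (measureReal_union_le _ _).trans (add_le_add ?_ hslabs)
  refine (measureReal_union_le _ _).trans ?_
  rw [hnull, zero_add]
  exact hcells

end TubeParams

end TypicalSamples

/-! ### Choice of the scales for large `n`, and the remaining small `n` -/

section Conclusion

theorem eventually_mul_log_pow_le (C : ℝ) (k : ℕ) :
    ∀ᶠ n : ℕ in Filter.atTop, C * Real.log n ^ k ≤ n := by
  have h := (Real.isLittleO_pow_log_id_atTop (n := k)).comp_tendsto tendsto_natCast_atTop_atTop
  have hC : 0 < |C| + 1 := by positivity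
  filter_upwards [h.bound (inv_pos.2 hC), Filter.eventually_ge_atTop 1] with n hn hn1
  have hlog : 0 ≤ Real.log n ^ k := pow_nonneg (Real.log_natCast_nonneg n) k
  simp only [Function.comp_apply, id, Real.norm_of_nonneg hlog,
    Real.norm_of_nonneg (Nat.cast_nonneg n : (0 : ℝ) ≤ n)] at hn
  rw [inv_mul_eq_div, le_div_iff₀ hC] at hn
  calc C * Real.log n ^ k ≤ (|C| + 1) * Real.log n ^ k := by
        gcongr
        linarith [le_abs_self C]
    _ ≤ n := by linarith

/-- The bounds for the complexity in terms of the number of points. -/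
def ComplexityBounds (a b : ℝ) {n : ℕ} (x : Fin n → E3) : Prop :=
  a * ((n : ℝ) ^ 2 / Real.log n ^ 2) ≤ delaunayComplexity (Set.range x) ∧
    (delaunayComplexity (Set.range x) : ℝ) ≤ b * ((n : ℝ) ^ 2 / Real.log n ^ 2)

namespace TubeParams

theorem exists_measure_not_complexityBounds_le {c : ℝ} (hc : 0 < c) {n : ℕ}
    (h1 : 2 ≤ Real.log n) (h2 : 1 * Real.log n ^ 2 ≤ n) (h3 : 31104 * Real.log n ^ 6 ≤ n)
    (h4 : (c + 1) * (768000 * lipConst * 12 ^ 5) * Real.log n ^ 11 ≤ n)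
    (h5 : 1536000 * lipConst * Real.log n ^ 1 ≤ n) :
    ∃ p : TubeParams, Measure.pi (fun _ : Fin n => uniformOnSurface p.surf)
      {x | ¬ ComplexityBounds (1 / (4 * (768000 * lipConst) ^ 2))
        (1310720 * lipConst + 1638400 ^ 2 + 14 * 409600 ^ 2 / 20 + 2 * 409600 * 1638400 + 2) x} ≤
      ENNReal.ofReal ((n : ℝ) ^ (-c)) := by
  have hl := one_le_lipConst
  set L := Real.log n with hL
  have hn0 : (0 : ℝ) < n := by
    have : 0 < L ^ 2 := by positivity
    linarith
  have hLn : L ≤ n := Real.log_le_self hn0.le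
  have hn2 : (2 : ℝ) ≤ n := h1.trans hLn
  -- The number `2 * H` of slabs lies between `10 * L ^ 2` and `12 * L ^ 2`, so `n ^ 2 / K` has the
  -- desired order and `K ≥ 10 L`.
  set H := ⌈5 * L ^ 2⌉₊ with hH
  have hH1 : 5 * L ^ 2 ≤ H := Nat.le_ceil _
  have hH2 : (H : ℝ) ≤ 6 * L ^ 2 := by
    have := Nat.ceil_lt_add_one (by positivity : 0 ≤ 5 * L ^ 2)
    nlinarith
  have hH20 : (20 : ℝ) ≤ H := by nlinarith
  have hHnat : 20 ≤ H := by exact_mod_cast hH20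
  have hKc : ((2 * H : ℕ) : ℝ) = 2 * H := by push_cast; ring
  have hKle : ((2 * H : ℕ) : ℝ) ≤ 12 * L ^ 2 := by rw [hKc]; linarith
  have hKge : 10 * L ^ 2 ≤ ((2 * H : ℕ) : ℝ) := by rw [hKc]; linarith
  have hK10 : 10 * L ≤ ((2 * H : ℕ) : ℝ) := by
    have : L * 1 ≤ L * L := by gcongr; linarith
    linarith [sq L]
  have hpow : (n : ℝ) ≤ (n : ℝ) ^ (c + 2) := by
    conv_lhs => rw [← Real.rpow_one n]
    exact Real.rpow_le_rpow_of_exponent_le (by linarith) (by linarith)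
  -- Makes the birthday bound `2 * 409600 ^ 2 * n ^ 2 / G` at most `n ^ (-c) / 2`.
  set G := ⌈4 * 409600 ^ 2 * (n : ℝ) ^ (c + 2)⌉₊ with hG
  have hG1 : 4 * 409600 ^ 2 * (n : ℝ) ^ (c + 2) ≤ G := Nat.le_ceil _
  have hGn : 6 * (n : ℝ) ≤ G := by linarith
  have hG10 : (10 : ℝ) ≤ G := by linarith
  have hGnat : 10 ≤ G := by exact_mod_cast hG10
  have hg0 : (0 : ℝ) < (1 / (G : ℝ)) ^ 2 := by positivity
  have hg1 : (1 / (G : ℝ)) ^ 2 ≤ 1 :=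
    pow_le_one₀ (by positivity) (by rw [div_le_one (by linarith)]; linarith)
  have hsm : 3 * (L * (2 * H : ℕ) * (1 / (G : ℝ)) ^ 2) ≤ 1 := by
    rw [div_pow, one_pow, mul_one_div, ← mul_div_assoc, div_le_one (by positivity)]
    calc 3 * (L * (2 * H : ℕ)) ≤ 3 * (L * (12 * L ^ 2)) := by gcongr
      _ = 36 * (L * (1 * L ^ 2)) := by ring
      _ ≤ 36 * (n * n) := by gcongr
      _ = (6 * (n : ℝ)) ^ 2 := by ring
      _ ≤ (G : ℝ) ^ 2 := by gcongr
  obtain ⟨p, hw, hε, hρη, hs1, hs2⟩ :=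
    exists_of_small (K := 2 * H) (by omega) (by linarith : 1 ≤ L) hg0 hsm
  refine ⟨p, ?_⟩
  rw [ENNReal.le_ofReal_iff_toReal_le (measure_ne_top _ _) (by positivity)]
  change (Measure.pi (fun _ : Fin n => uniformOnSurface p.surf)).real _ ≤ _
  -- With `u = (c + 1) * L`, `exp (-u) = n ^ (-c) / n`; the spare factor `1 / n` absorbs the
  -- polylogarithmic number of events. The condition on `u` becomes `L ^ 11 ≲ n`.
  have hprob := measure_not_typical_le (p := p) (n := n) (H := H) (G := G) (L := L)
    (u := (c + 1) * L) (by omega) h1 (by linarith) hGnat hw hε (by positivity) (by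
      calc (c + 1) * L * (768000 * lipConst * ((2 * H : ℕ) : ℝ) ^ 5)
          ≤ (c + 1) * L * (768000 * lipConst * (12 * L ^ 2) ^ 5) := by gcongr
        _ = (c + 1) * (768000 * lipConst * 12 ^ 5) * L ^ 11 := by ring
        _ ≤ n := h4)
  have hKpos : (0 : ℝ) < (2 * H : ℕ) := by linarith
  refine (measureReal_mono ?_ (measure_ne_top _ _)).trans (hprob.trans ?_)
  · intro x hx htyp
    refine hx ⟨?_, ?_⟩
    · have hlow := htyp.le_delaunayComplexity (by
        rw [div_le_div_iff₀ hKpos (by norm_num)]; linarith) hg0 hg1 hρη hs1 (by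
        rw [le_div_iff₀ (by positivity)]
        linarith)
      refine le_trans (le_of_eq ?_) hlow
      rw [← hL]
      field_simp
    · have hup := htyp.delaunayComplexity_le (by omega) (by linarith) hK10 (by positivity)
        (by rw [div_le_one hKpos]; linarith) hg0 hg1 hs2
      refine hup.trans ?_
      rw [← hL]
      have e1 : 2 * (n * (6553600 * lipConst * n / (2 * H : ℕ))) ≤
          1310720 * lipConst * ((n : ℝ) ^ 2 / L ^ 2) := by
        calc 2 * (n * (6553600 * lipConst * n / (2 * H : ℕ)))
            ≤ 2 * (n * (6553600 * lipConst * n / (10 * L ^ 2))) := by gcongr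
          _ = _ := by field_simp; ring
      have e2 : 14 * (H * (409600 * n / ((2 * H : ℕ) : ℝ)) ^ 2) ≤
          14 * 409600 ^ 2 / 20 * ((n : ℝ) ^ 2 / L ^ 2) := by
        calc 14 * (H * (409600 * n / ((2 * H : ℕ) : ℝ)) ^ 2)
            = 14 * 409600 ^ 2 / 4 * ((n : ℝ) ^ 2 / H) := by rw [hKc]; field_simp; ring
          _ ≤ 14 * 409600 ^ 2 / 4 * ((n : ℝ) ^ 2 / (5 * L ^ 2)) := by gcongr
          _ = _ := by field_simp; ring
      have e3 : 2 * (n : ℝ) ≤ 2 * ((n : ℝ) ^ 2 / L ^ 2) := by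
        gcongr
        rw [le_div_iff₀ (by positivity), sq (n : ℝ)]
        gcongr
        linarith
      have e4 : (1638400 * n / L) ^ 2 = 1638400 ^ 2 * ((n : ℝ) ^ 2 / L ^ 2) := by ring
      have e5 : 2 * (409600 * n / L * (1638400 * n / L)) =
          2 * 409600 * 1638400 * ((n : ℝ) ^ 2 / L ^ 2) := by ring
      rw [e4, e5]
      linarith
  · have hexp : Real.exp (-((c + 1) * L)) = (n : ℝ) ^ (-c) / n := by
      rw [← Real.rpow_sub_one hn0.ne', Real.rpow_def_of_pos hn0, ← hL]
      ring_nf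
    have hnc : 0 < (n : ℝ) ^ (-c) := Real.rpow_pos_of_pos hn0 _
    have f1 : 9 * ((2 * H : ℕ) : ℝ) ^ 3 * Real.exp (-((c + 1) * L)) ≤ (n : ℝ) ^ (-c) / 2 := by
      calc 9 * ((2 * H : ℕ) : ℝ) ^ 3 * Real.exp (-((c + 1) * L))
          ≤ 9 * (12 * L ^ 2) ^ 3 * Real.exp (-((c + 1) * L)) := by gcongr
        _ = 31104 * L ^ 6 * ((n : ℝ) ^ (-c) / n) / 2 := by rw [hexp]; ring
        _ ≤ n * ((n : ℝ) ^ (-c) / n) / 2 := by gcongr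
        _ = _ := by field_simp
    have f2 : 2 * 409600 ^ 2 * (n : ℝ) ^ 2 / G ≤ (n : ℝ) ^ (-c) / 2 := by
      have hp : (n : ℝ) ^ (c + 2) * (n : ℝ) ^ (-c) = (n : ℝ) ^ 2 := by
        rw [← Real.rpow_add hn0, ← Real.rpow_natCast]
        norm_num
      rw [div_le_iff₀ (by linarith)]
      calc 2 * 409600 ^ 2 * (n : ℝ) ^ 2
          = (n : ℝ) ^ (-c) / 2 * (4 * 409600 ^ 2 * (n : ℝ) ^ (c + 2)) := by rw [← hp]; ring
        _ ≤ _ := by gcongr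
    linarith

/-- Almost surely two sample points differ, so there is at least one edge, and there are never more
than `n ^ 2`. For bounded `n` this already has the right order, on any of the surfaces. -/
theorem measure_not_complexityBounds_eq_zero (p : TubeParams) {n N : ℕ} (hn : 2 ≤ n) (hnN : n ≤ N)
    {a b : ℝ} (ha : a ≤ (Real.log 2 / N) ^ 2) (hb : Real.log N ^ 2 ≤ b) :
    Measure.pi (fun _ : Fin n => uniformOnSurface p.surf) {x | ¬ ComplexityBounds a b x} = 0 := by
  have := nullSingletonClass_uniformOnSurface p.surf
  have hij : (⟨0, by omega⟩ : Fin n) ≠ ⟨1, by omega⟩ := by simp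
  refine measure_mono_null ?_
    (measure_eval_eq_eval_eq_zero (uniformOnSurface p.surf) hij)
  intro x hx
  by_contra hne
  apply hx
  have hn2 : (2 : ℝ) ≤ n := by exact_mod_cast hn
  have hnN' : (n : ℝ) ≤ N := by exact_mod_cast hnN
  have hlog2 : 0 < Real.log 2 := Real.log_pos (by norm_num)
  have hlogn : Real.log 2 ≤ Real.log n := Real.log_le_log (by norm_num) hn2
  have hlogN : Real.log n ≤ Real.log N := Real.log_le_log (by linarith) hnN'
  have hlogn0 : 0 < Real.log n := hlog2.trans_le hlogn
  have hlow : 1 ≤ delaunayComplexity (Set.range x) := by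
    obtain ⟨P, Q, hPQ⟩ := exists_adj_of_finite (Set.finite_range x) ⟨_, rfl⟩ ⟨_, rfl⟩ hne
    exact (Set.ncard_pos
      (delaunayGraph_edgeSet_finite (Set.finite_range x))).2 ⟨s(P, Q), hPQ⟩
  have hup : delaunayComplexity (Set.range x) ≤ n ^ 2 := by
    refine (delaunayComplexity_range_le Finset.univ fun i j _ => Finset.mem_univ _).trans ?_
    simp [sq]
  have hlow' : (1 : ℝ) ≤ delaunayComplexity (Set.range x) := by exact_mod_cast hlow
  have hup' : (delaunayComplexity (Set.range x) : ℝ) ≤ (n : ℝ) ^ 2 := by exact_mod_cast hup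
  constructor
  · refine le_trans ?_ hlow'
    calc a * ((n : ℝ) ^ 2 / Real.log n ^ 2)
        ≤ (Real.log 2 / N) ^ 2 * ((n : ℝ) ^ 2 / Real.log n ^ 2) := by gcongr
      _ ≤ (Real.log n / n) ^ 2 * ((n : ℝ) ^ 2 / Real.log n ^ 2) := by gcongr
      _ = 1 := by field_simp
  · refine hup'.trans ?_
    calc (n : ℝ) ^ 2 = Real.log n ^ 2 * ((n : ℝ) ^ 2 / Real.log n ^ 2) := by field_simp
      _ ≤ Real.log N ^ 2 * ((n : ℝ) ^ 2 / Real.log n ^ 2) := by gcongr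
      _ ≤ _ := by gcongr

end TubeParams

theorem ComplexityBounds.mono {a b a' b' : ℝ} {n : ℕ} {x : Fin n → E3}
    (h : ComplexityBounds a b x) (ha : a' ≤ a) (hb : b ≤ b') : ComplexityBounds a' b' x := by
  have h0 : 0 ≤ (n : ℝ) ^ 2 / Real.log n ^ 2 := by positivity
  exact ⟨(mul_le_mul_of_nonneg_right ha h0).trans h.1,
    h.2.trans (mul_le_mul_of_nonneg_right hb h0)⟩

theorem mainTheorem9 (c : ℝ) (hc : 0 < c) :
    ∃ a b : ℝ, 0 < a ∧ 0 < b ∧ ∀ n : ℕ, 2 ≤ n →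
      ∃ S : Set E3, IsSmoothSurface S ∧ IsCompact S ∧ IsConnected S ∧
        0 < surfaceArea S ∧ surfaceArea S < ⊤ ∧
        Measure.pi (fun _ : Fin n => uniformOnSurface S)
            {x | ¬ (a * ((n : ℝ) ^ 2 / Real.log n ^ 2) ≤ delaunayComplexity (Set.range x) ∧
              (delaunayComplexity (Set.range x) : ℝ) ≤ b * ((n : ℝ) ^ 2 / Real.log n ^ 2))}
          ≤ ENNReal.ofReal ((n : ℝ) ^ (-c)) := by
  have hl := one_le_lipConst
  have hev : ∀ᶠ n : ℕ in Filter.atTop, ∃ p : TubeParams,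
      Measure.pi (fun _ : Fin n => uniformOnSurface p.surf)
      {x | ¬ ComplexityBounds (1 / (4 * (768000 * lipConst) ^ 2))
        (1310720 * lipConst + 1638400 ^ 2 + 14 * 409600 ^ 2 / 20 + 2 * 409600 * 1638400 + 2) x} ≤
      ENNReal.ofReal ((n : ℝ) ^ (-c)) := by
    filter_upwards [(Real.tendsto_log_atTop.comp
      tendsto_natCast_atTop_atTop).eventually_ge_atTop 2, eventually_mul_log_pow_le 1 2,
      eventually_mul_log_pow_le 31104 6,
      eventually_mul_log_pow_le ((c + 1) * (768000 * lipConst * 12 ^ 5)) 11,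
      eventually_mul_log_pow_le (1536000 * lipConst) 1] with n h1 h2 h3 h4 h5
    exact TubeParams.exists_measure_not_complexityBounds_le hc h1 h2 h3 h4 h5
  obtain ⟨M, hM⟩ := Filter.eventually_atTop.1 hev
  set a₀ := 1 / (4 * (768000 * lipConst) ^ 2) with ha₀
  set b₀ := 1310720 * lipConst + 1638400 ^ 2 + 14 * 409600 ^ 2 / 20 + 2 * 409600 * 1638400 + 2
    with hb₀
  have hlog2 : 0 < Real.log 2 := Real.log_pos (by norm_num)
  -- `M + 1` instead of `M` keeps the lower constant positive even if `M = 0`.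
  refine ⟨min a₀ ((Real.log 2 / (M + 1 : ℕ)) ^ 2), max b₀ (Real.log (M + 1 : ℕ) ^ 2),
    lt_min (by positivity) (by positivity), lt_max_of_lt_left (by positivity), fun n hn => ?_⟩
  obtain ⟨p, hp⟩ : ∃ p : TubeParams, Measure.pi (fun _ : Fin n => uniformOnSurface p.surf)
      {x | ¬ ComplexityBounds (min a₀ ((Real.log 2 / (M + 1 : ℕ)) ^ 2))
        (max b₀ (Real.log (M + 1 : ℕ) ^ 2)) x} ≤ ENNReal.ofReal ((n : ℝ) ^ (-c)) := by
    rcases le_or_gt M n with h | h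
    · obtain ⟨p, hp⟩ := hM n h
      exact ⟨p, (measure_mono fun x (hx : ¬ ComplexityBounds _ _ x) hb =>
        hx (ComplexityBounds.mono hb (min_le_left _ _) (le_max_left _ _))).trans hp⟩
    · obtain ⟨p, -⟩ := TubeParams.exists_of_small (K := 3) (L := 1) (g := 1 / 9) le_rfl le_rfl
        (by norm_num) (by norm_num)
      refine ⟨p, ?_⟩
      rw [p.measure_not_complexityBounds_eq_zero hn (by omega : n ≤ M + 1) (min_le_right _ _)
        (le_max_right _ _)]
      exact zero_le
  exact ⟨p.surf, p.isSmoothSurface_surf, p.isCompact_surf, p.isConnected_surf,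
    p.surfaceArea_surf_pos, p.surfaceArea_surf_lt_top, hp⟩

end Conclusion
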